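/- Let $N\ge 2$, $p\in(1,2)$, $s_1\in(0,1)$ and $s_p\in\left(\frac{p-1}{p},1\right)$, and let $\Omega\subset\mathbb{R}^N$ be a bounded domain. For $q\ge 1$, $s\in(0,1)$ and $A\subseteq\mathbb{R}^N$ open put $$[u]_{W^{s,q}(A)}:=\Big(\int_A\int_A\frac{|u(x)-u(y)|^q}{|x-y|^{N+sq}}\,dx\,dy\Big)^{1/q},\qquad W^{s,q}(A):=\{u\in L^q(A): [u]_{W^{s,q}(A)}<\infty\}.$$ A function $u:\mathbb{R}^N\to\mathbb{R}$ is called a weak solution of $$(-\Delta_1)^{s_1}u+(-\Delta_p)^{s_p}u=0\quad\text{in }\Omega$$ if $u\in W^{s_1,1}_{\mathrm{loc}}(\Omega)\cap W^{s_p,p}_{\mathrm{loc}}(\Omega)\cap L^p_{\mathrm{loc}}(\mathbb{R}^N)$, $\int_{\mathbb{R}^N}\frac{|u(x)|^{p-1}}{(1+|x|)^{N+s_pp}}\,dx<\infty$, and there is $Z\in L^\infty(\mathbb{R}^N\times\mathbb{R}^N)$ with $Z(x,y)\in\mathrm{sgn}(u(x)-u(y))$ for a.e. $(x,y)$, where $\mathrm{sgn}(t)=\{t/|t|\}$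 for $t\ne0$ and $\mathrm{sgn}(0)=[-1,1]$, such that $$0=\int_{\mathbb{R}^N}\int_{\mathbb{R}^N}Z(x,y)\frac{\varphi(x)-\varphi(y)}{|x-y|^{N+s_1}}\,dx\,dy+\int_{\mathbb{R}^N}\int_{\mathbb{R}^N}\frac{|u(x)-u(y)|^{p-2}(u(x)-u(y))(\varphi(x)-\varphi(y))}{|x-y|^{N+s_pp}}\,dx\,dy$$ for every $\varphi\in W^{s_1,1}(\mathbb{R}^N)\cap W^{s_p,p}(\mathbb{R}^N)$ with compact support in $\Omega$. For a ball $B_R(x_0)$ put $$\mathcal{T}:=\|u\|_{L^\infty(B_R(x_0))}+\Big(R^{s_pp}\int_{\mathbb{R}^N\setminus B_R(x_0)}\frac{|u(x)|^{p-1}}{|x-x_0|^{N+s_pp}}\,dx\Big)^{\frac1{p-1}}.$$ **Theorem.** Let $u$ be a weak solution that is locally bounded in $\Omega$, i.e. $u\in L^\infty_{\mathrm{loc}}(\Omega)$. Then $u\in W^{1,q}_{\mathrm{loc}}(\Omega)$ for every $q\ge p$. Moreover, for every $q\ge p$ there are constants $C>0$ and $\kappa>0$, depending only on $N,p,q,s_1,s_p$,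 such that for every ball $B_R=B_R(x_0)\subset\subset\Omega$ with $R\in(0,1)$ and every $r\in(0,R)$, writing $B_r=B_r(x_0)$, $$\|\nabla u\|_{L^q(B_r)}^q\le\frac{C\left(\mathcal{T}+[u]_{W^{s_p,p}(B_R)}+1\right)^q}{(R-r)^{\kappa}}.$$ -/

import Mathlib

open MeasureTheory Set
open scoped ENNReal

noncomputable section

/-- The Euclidean space `ℝ^N`, with the Euclidean norm and Lebesgue measure. -/
abbrev Rn (N : ℕ) : Type := EuclideanSpace ℝ (Fin N)

/-- `U ⊂⊂ Ω`: the closure of `U` is a compact subset of `Ω`. -/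
def CompactlyInside {N : ℕ} (U Ω : Set (Rn N)) : Prop :=
  IsCompact (closure U) ∧ closure U ⊆ Ω

/-- `u ∈ L^q_loc(Ω)`. -/
def MemLpLoc {N : ℕ} {F : Type} [NormedAddCommGroup F] (q : ℝ≥0∞) (Ω : Set (Rn N))
    (u : Rn N → F) : Prop :=
  ∀ U : Set (Rn N), IsOpen U → CompactlyInside U Ω → MemLp u q (volume.restrict U)

/-- The Gagliardo seminorm
`[u]_{W^{s,q}(A)} = (∫_A ∫_A |u(x) - u(y)|^q / |x - y|^{N + s q} dx dy)^{1/q}`,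
with values in `[0, ∞]`. (On the diagonal, a null set, the quotient is `0 / 0 = 0`.) -/
def gagliardo {N : ℕ} (s q : ℝ) (A : Set (Rn N)) (u : Rn N → ℝ) : ℝ≥0∞ :=
  (∫⁻ x in A, ∫⁻ y in A, ‖u x - u y‖ₑ ^ q / ‖x - y‖ₑ ^ ((N : ℝ) + s * q)) ^ (1 / q)

/-- The fractional Sobolev space: `u ∈ W^{s,q}(A)`. -/
def MemFracSobolev {N : ℕ} (s q : ℝ) (A : Set (Rn N)) (u : Rn N → ℝ) : Prop :=
  MemLp u (ENNReal.ofReal q) (volume.restrict A) ∧ gagliardo s q A u < ∞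

/-- The local fractional Sobolev space: `u ∈ W^{s,q}_loc(Ω)`. -/
def MemFracSobolevLoc {N : ℕ} (s q : ℝ) (Ω : Set (Rn N)) (u : Rn N → ℝ) : Prop :=
  ∀ U : Set (Rn N), IsOpen U → CompactlyInside U Ω → MemFracSobolev s q U u

/-- The tail space `L^{p-1}_{sp}(ℝ^N)`: all `u ∈ L^p_loc(ℝ^N)` with
`∫_{ℝ^N} |u|^{p-1} / (1 + |x|)^{N + s p} dx < ∞`. -/
def MemTailSpace {N : ℕ} (s p : ℝ) (u : Rn N → ℝ) : Prop :=
  MemLpLoc (ENNReal.ofReal p) univ u ∧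
    ∫⁻ x, ‖u x‖ₑ ^ (p - 1) / (1 + ‖x‖ₑ) ^ ((N : ℝ) + s * p) < ∞

/-- `Tail(u; x₀, R) = (R^{s p} ∫_{ℝ^N ∖ B_R(x₀)} |u|^{p-1} / |x - x₀|^{N + s p} dx)^{1/(p-1)}`. -/
def tail {N : ℕ} (s p : ℝ) (u : Rn N → ℝ) (x₀ : Rn N) (R : ℝ) : ℝ≥0∞ :=
  (ENNReal.ofReal (R ^ (s * p)) *
    ∫⁻ x in (Metric.ball x₀ R)ᶜ, ‖u x‖ₑ ^ (p - 1) / ‖x - x₀‖ₑ ^ ((N : ℝ) + s * p)) ^ (1 / (p - 1))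

/-- The set-valued sign: `sgn(t) = {t / |t|}` for `t ≠ 0` and `sgn(0) = [-1, 1]`. -/
def sgnSet (t : ℝ) : Set ℝ := {z | (t = 0 ∧ z ∈ Icc (-1 : ℝ) 1) ∨ (t ≠ 0 ∧ z = t / |t|)}

/-- The test functions `W^{s₁,1}_0(Ω) ∩ W^{s_p,p}_0(Ω)`: functions in
`W^{s₁,1}(ℝ^N) ∩ W^{s_p,p}(ℝ^N)` with compact support in `Ω`. For these both integrals in the
weak formulation converge absolutely. -/
structure IsTestFunction {N : ℕ} (s₁ sp p : ℝ) (Ω : Set (Rn N)) (φ : Rn N → ℝ) : Prop where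
  mem_one : MemFracSobolev s₁ 1 univ φ
  mem_p : MemFracSobolev sp p univ φ
  compactSupport : HasCompactSupport φ
  support_subset : tsupport φ ⊆ Ω

/-- Weak solutions of `(-Δ₁)^{s₁} u + (-Δ_p)^{s_p} u = 0` in `Ω`. -/
structure IsWeakSolution {N : ℕ} (s₁ sp p : ℝ) (Ω : Set (Rn N)) (u : Rn N → ℝ) : Prop where
  memLoc_one : MemFracSobolevLoc s₁ 1 Ω u
  memLoc_p : MemFracSobolevLoc sp p Ω u
  memTail : MemTailSpace sp p u
  exists_sign : ∃ Z : Rn N × Rn N → ℝ,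
    MemLp Z ∞ volume ∧ (∀ᵐ z : Rn N × Rn N, Z z ∈ sgnSet (u z.1 - u z.2)) ∧
    ∀ φ : Rn N → ℝ, IsTestFunction s₁ sp p Ω φ →
      0 = (∫ z : Rn N × Rn N, Z z * ((φ z.1 - φ z.2) / ‖z.1 - z.2‖ ^ ((N : ℝ) + s₁))) +
        ∫ z : Rn N × Rn N,
          |u z.1 - u z.2| ^ (p - 2) * (u z.1 - u z.2) * (φ z.1 - φ z.2) /
            ‖z.1 - z.2‖ ^ ((N : ℝ) + sp * p)

/-- `g` is the weak (distributional) gradient of `u` in `Ω`. -/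
structure IsWeakGradient {N : ℕ} (Ω : Set (Rn N)) (u : Rn N → ℝ) (g : Rn N → Rn N) : Prop where
  locInt : LocallyIntegrableOn u Ω
  locInt_grad : LocallyIntegrableOn g Ω
  integral_eq : ∀ φ : Rn N → ℝ, ContDiff ℝ ((⊤ : ℕ∞) : WithTop ℕ∞) φ → HasCompactSupport φ → tsupport φ ⊆ Ω →
    ∫ x in Ω, u x • gradient φ x = -∫ x in Ω, φ x • g x

/-- The local Sobolev space: `u ∈ W^{1,q}_loc(Ω)`. -/
def MemSobolevOneLoc {N : ℕ} (q : ℝ) (Ω : Set (Rn N)) (u : Rn N → ℝ) : Prop :=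
  MemLpLoc (ENNReal.ofReal q) Ω u ∧
    ∃ g : Rn N → Rn N, IsWeakGradient Ω u g ∧ MemLpLoc (ENNReal.ofReal q) Ω g

end

/-! Write δ_h u(x) = u(x+h) − u(x). The proof is a finite bootstrap on the order σ in ∫ |δ_h u|^q ≲
|h|^{σq}. It starts at σ = 0, which is boundedness, and reaches σ = 1. Difference quotients are then
bounded in L^q, and the weak gradient inherits the bound.

Normalisation. The two operators are homogeneous of degree 0 and p − 1. Dividing u by M = ‖u‖_∞ +
Tail + 1 therefore gives a solution bounded by 1, with tail at most 1, of the equation with a factor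
λ = M^{1−p} ≤ 1 in front of the 1-Laplacian (`exists_normSol`). Every later estimate is uniform in
λ, and its constants see the geometry only through a negative power of the distance between radii
(`PolyBound`).

Caccioppoli. The equation is subtracted from its translate by h and tested with η²|δ_h u|^{q−1}δ_h
u. The set-valued sign is monotone, so the 1-Laplacian contributes a nonnegative term, which is
discarded, and a cutoff error (`sign_localised_lower`). The p-flux contributes the energy with
density (|u(x+h)−u(y+h)| + |u(x)−u(y)|)^{p−2} |δ_h u(x)−δ_h u(y)|^{q+1} |x−y|^{−N−s_p p}
(`exists_flux_localised_lower`). Cutoff errors and tails together are bounded by ∫ |δ_h u|^q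
(`exists_polyBound_caccioppoli`).

One step of the bootstrap. For p < 2 the weight in the energy is small where u oscillates strongly.
Young's inequality removes it at the price of a Gagliardo energy of u with exponent (2−p)q and order
σ − ε (`energy_interpolation`), which the order σ bound already controls
(`gagInt_le_of_diff_bound`). This leaves a Gagliardo energy of δ_h u, and averaging over balls of
radius |h| turns it into a bound on δ_h δ_h u (`exists_lintegral_diff_le_gagInt`). The resulting
order τ satisfies (q+1)(τ − σ) = s_p p − (p−1)σ − ε(2−p), see `FirstDiffBound.second`. The
hypothesis s_p > (p−1)/p says exactly that s_p p − (p−1) > 0, so the gain stays bounded below for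
all σ ≤ 1.

Back to first differences. From δ_h u = ½ δ_{2h} u − ½ δ_h δ_h u, iterated along dyadic dilations,
second differences of order τ ≠ 1 give first differences of order min(τ, 1)
(`SecondDiffBound.first`). The increments in `firstDiffBound_one` are chosen so that the order 1 is
never hit from below.

The gradient. A weak derivative exists by weak compactness in a weighted L² (`exists_weakDeriv`).
The L^q bound passes to it by mollification and Fatou's lemma (`lintegral_rpow_le_of_tendsto`). The
seminorm of u enters only through its finiteness, so the estimate obtained does not contain it. -/

noncomputable section
namespace FracReg
variable {N : ℕ}

/-! ### Odd powers and their monotonicity inequalities -/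

/-- The odd power `|t|^{p-2} t`. -/
def oddPow (p t : ℝ) : ℝ := |t| ^ (p - 2) * t

lemma oddPow_neg (p t : ℝ) : oddPow p (-t) = -oddPow p t := by
  simp [oddPow]

lemma oddPow_zero (p : ℝ) : oddPow p 0 = 0 := by simp [oddPow]

lemma oddPow_of_nonneg {p t : ℝ} (hp : 1 < p) (ht : 0 ≤ t) : oddPow p t = t ^ (p - 1) := by
  rcases ht.eq_or_lt with rfl | ht'
  · rw [oddPow_zero, Real.zero_rpow (by linarith)]
  · rw [oddPow, abs_of_pos ht', show p - 1 = (p - 2) + 1 by ring, Real.rpow_add_one ht'.ne']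

lemma abs_oddPow {p : ℝ} (hp : 1 < p) (t : ℝ) : |oddPow p t| = |t| ^ (p - 1) := by
  rcases le_total 0 t with ht | ht
  · rw [oddPow_of_nonneg hp ht, abs_of_nonneg (Real.rpow_nonneg ht _), abs_of_nonneg ht]
  · rw [← abs_neg, ← oddPow_neg, oddPow_of_nonneg hp (by linarith), abs_of_nonpos ht,
      abs_of_nonneg (Real.rpow_nonneg (by linarith) _)]

@[fun_prop]
lemma measurable_oddPow (p : ℝ) : Measurable (oddPow p) := by
  unfold oddPow; fun_prop

/-- The inequalities below are symmetric in the two arguments and invariant under a joint change of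
sign, so only ordered nonnegative pairs and pairs of opposite sign need an argument. -/
lemma pair_induction {P : ℝ → ℝ → Prop} (symm : ∀ a b, P a b → P b a)
    (neg : ∀ a b, P a b → P (-a) (-b)) (h1 : ∀ a b, 0 ≤ b → b ≤ a → P a b)
    (h2 : ∀ a b, 0 ≤ a → 0 ≤ b → P a (-b)) (a b : ℝ) : P a b := by
  rcases le_total 0 a with ha | ha <;> rcases le_total 0 b with hb | hb
  · rcases le_total a b with h | h
    · exact symm _ _ (h1 _ _ ha h)
    · exact h1 _ _ hb h
  · simpa using h2 a (-b) ha (by linarith)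
  · apply symm; simpa using h2 b (-a) hb (by linarith)
  · have : P (-a) (-b) := by
      rcases le_total (-a) (-b) with h | h
      · exact symm _ _ (h1 _ _ (by linarith) h)
      · exact h1 _ _ (by linarith) h
    simpa using neg _ _ this

/-- Bernoulli's inequality at y/x − 1, multiplied by x^q. -/
lemma rpow_sub_le_mul {x y q : ℝ} (hq : 1 ≤ q) (hy : 0 ≤ y) (hyx : y ≤ x) :
    x ^ q - y ^ q ≤ q * x ^ (q - 1) * (x - y) := by
  rcases hy.eq_or_lt with rfl | hy'
  · rcases hyx.eq_or_lt with rfl | hx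
    · simp
    · rw [Real.zero_rpow (by linarith), sub_zero, sub_zero, mul_assoc, ← Real.rpow_add_one hx.ne']
      have := Real.rpow_nonneg hx.le q
      simp only [sub_add_cancel]
      nlinarith
  · have hx : 0 < x := by linarith
    have h := one_add_mul_self_le_rpow_one_add (s := y / x - 1) (by
      have : 0 ≤ y / x := by positivity
      linarith) hq
    rw [add_sub_cancel, Real.div_rpow hy hx.le, le_div_iff₀ (by positivity)] at h
    have e : x ^ q = x ^ (q - 1) * x := by rw [← Real.rpow_add_one hx.ne']; simp
    have e2 : (1 + q * (y / x - 1)) * x ^ q = x ^ q - q * x ^ (q - 1) * (x - y) := by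
      rw [e]; field_simp; ring
    linarith

lemma mul_le_rpow_sub_of_le_one {x y q : ℝ} (hq0 : 0 < q) (hq : q ≤ 1) (hy : 0 ≤ y) (hyx : y ≤ x) :
    q * x ^ (q - 1) * (x - y) ≤ x ^ q - y ^ q := by
  have hx : 0 ≤ x := hy.trans hyx
  rcases hx.eq_or_lt with rfl | hx
  · have : y = 0 := le_antisymm hyx hy
    simp [this]
  · have h := rpow_one_add_le_one_add_mul_self (s := y / x - 1) (by
      have : 0 ≤ y / x := by positivity
      linarith) hq0.le hq
    rw [add_sub_cancel, Real.div_rpow hy hx.le, div_le_iff₀ (by positivity)] at h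
    have e : x ^ q = x ^ (q - 1) * x := by rw [← Real.rpow_add_one hx.ne']; simp
    have e2 : (1 + q * (y / x - 1)) * x ^ q = x ^ q - q * x ^ (q - 1) * (x - y) := by
      rw [e]; field_simp; ring
    linarith

lemma rpow_pred_mul {x q : ℝ} (hx : 0 ≤ x) (hq : q ≠ 0) : x ^ (q - 1) * x = x ^ q := by
  rcases hx.eq_or_lt with rfl | hx
  · rw [mul_zero, Real.zero_rpow hq]
  · rw [← Real.rpow_add_one hx.ne']; simp

lemma add_rpow_le_mul {q a b : ℝ} (hq : 0 ≤ q) (ha : 0 ≤ a) (hb : 0 ≤ b) :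
    (a + b) ^ q ≤ 2 ^ q * (a ^ q + b ^ q) := by
  rcases le_total a b with h | h
  · calc (a + b) ^ q ≤ (2 * b) ^ q := Real.rpow_le_rpow (by linarith) (by linarith) (by linarith)
      _ = 2 ^ q * b ^ q := by rw [Real.mul_rpow (by norm_num) hb]
      _ ≤ _ := by
        have := Real.rpow_nonneg ha q
        gcongr; linarith
  · calc (a + b) ^ q ≤ (2 * a) ^ q := Real.rpow_le_rpow (by linarith) (by linarith) (by linarith)
      _ = 2 ^ q * a ^ q := by rw [Real.mul_rpow (by norm_num) ha]
      _ ≤ _ := by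
        have := Real.rpow_nonneg hb q
        gcongr; linarith

/-- For equal signs, concavity of t^{p−1} gives the slope at the larger number, and (a+b)^{p−2} ≤
a^{p−2} since p ≤ 2. For opposite signs, subadditivity of t^{p−1} suffices. -/
lemma oddPow_lower_sub {p : ℝ} (hp : 1 < p) (hp2 : p ≤ 2) (a b : ℝ) :
    (p - 1) * (|a| + |b|) ^ (p - 2) * (a - b) ^ 2 ≤ (oddPow p a - oddPow p b) * (a - b) := by
  induction a, b using pair_induction with
  | symm a b h => rw [add_comm]; linarith
  | neg a b h =>
    rw [oddPow_neg, oddPow_neg, abs_neg, abs_neg]; linarith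
  | h1 a b hb hab =>
    have ha : 0 ≤ a := hb.trans hab
    rw [oddPow_of_nonneg hp ha, oddPow_of_nonneg hp hb, abs_of_nonneg ha, abs_of_nonneg hb]
    rcases ha.eq_or_lt with rfl | ha'
    · have : b = 0 := le_antisymm hab hb
      simp [this]
    have h := mul_le_rpow_sub_of_le_one (q := p - 1) (by linarith) (by linarith) hb hab
    have h2 : (a + b) ^ (p - 2) ≤ a ^ (p - 2) :=
      Real.rpow_le_rpow_of_nonpos ha' (by linarith) (by linarith)
    rw [show p - 1 - 1 = p - 2 by ring] at h
    calc (p - 1) * (a + b) ^ (p - 2) * (a - b) ^ 2 ≤ (p - 1) * a ^ (p - 2) * (a - b) ^ 2 := by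
          gcongr
      _ = ((p - 1) * a ^ (p - 2) * (a - b)) * (a - b) := by ring
      _ ≤ _ := by gcongr
  | h2 a b ha hb =>
    rw [oddPow_neg, oddPow_of_nonneg hp ha, oddPow_of_nonneg hp hb, abs_neg, abs_of_nonneg ha,
      abs_of_nonneg hb]
    have h := Real.rpow_add_le_add_rpow ha hb (p := p - 1) (by linarith) (by linarith)
    have e := rpow_pred_mul (x := a + b) (q := p - 1) (by linarith) (by linarith)
    rw [show p - 1 - 1 = p - 2 by ring] at e
    have h3 : 0 ≤ (a + b) ^ (p - 1) := by positivity
    calc (p - 1) * (a + b) ^ (p - 2) * (a - -b) ^ 2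
        = (p - 1) * ((a + b) ^ (p - 2) * (a + b)) * (a + b) := by ring
      _ ≤ 1 * (a + b) ^ (p - 1) * (a + b) := by rw [e]; gcongr; linarith
      _ ≤ _ := by
        rw [one_mul, sub_neg_eq_add, sub_neg_eq_add]
        gcongr

/-- For 0 < b ≤ a one has b^{p−1} = b^{p−2} b ≥ a^{p−2} b, hence a^{p−1} − b^{p−1} ≤ a^{p−2}(a − b).
Then a + b ≤ 2a and 2^{p−2} ≥ 1/2 replace a^{p−2} by 2(a+b)^{p−2}. -/
lemma oddPow_upper_sub {p : ℝ} (hp : 1 < p) (hp2 : p ≤ 2) (a b : ℝ) :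
    |oddPow p a - oddPow p b| ≤ 2 * (|a| + |b|) ^ (p - 2) * |a - b| := by
  induction a, b using pair_induction with
  | symm a b h => rwa [add_comm, abs_sub_comm, abs_sub_comm b a]
  | neg a b h =>
    rw [oddPow_neg, oddPow_neg, abs_neg, abs_neg, ← neg_sub', abs_neg, ← neg_sub', abs_neg]
    exact h
  | h1 a b hb hab =>
    have ha : 0 ≤ a := hb.trans hab
    rw [oddPow_of_nonneg hp ha, oddPow_of_nonneg hp hb, abs_of_nonneg ha, abs_of_nonneg hb,
      abs_of_nonneg (sub_nonneg.2 (Real.rpow_le_rpow hb hab (by linarith))),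
      abs_of_nonneg (sub_nonneg.2 hab)]
    rcases hb.eq_or_lt with rfl | hb'
    · rw [add_zero, sub_zero, Real.zero_rpow (by linarith), sub_zero, mul_assoc]
      have e := rpow_pred_mul (x := a) (q := p - 1) ha (by linarith)
      rw [show p - 1 - 1 = p - 2 by ring] at e
      rw [e]
      have : 0 ≤ a ^ (p - 1) := by positivity
      linarith
    have ha' : 0 < a := by linarith
    have ea := rpow_pred_mul (x := a) (q := p - 1) ha (by linarith)
    have eb := rpow_pred_mul (x := b) (q := p - 1) hb (by linarith)
    rw [show p - 1 - 1 = p - 2 by ring] at ea eb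
    have h1 : a ^ (p - 2) ≤ b ^ (p - 2) := Real.rpow_le_rpow_of_nonpos hb' hab (by linarith)
    have h2 : (2 * a) ^ (p - 2) ≤ (a + b) ^ (p - 2) :=
      Real.rpow_le_rpow_of_nonpos (by linarith) (by linarith) (by linarith)
    have h3 : (2 : ℝ)⁻¹ ≤ 2 ^ (p - 2) := by
      rw [← Real.rpow_neg_one]
      exact Real.rpow_le_rpow_of_exponent_le (by norm_num) (by linarith)
    rw [Real.mul_rpow (by norm_num) ha] at h2
    have h4 : 0 < a ^ (p - 2) := by positivity
    have h5 : a ^ (p - 2) ≤ 2 * (a + b) ^ (p - 2) := by nlinarith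
    calc a ^ (p - 1) - b ^ (p - 1) ≤ a ^ (p - 2) * a - a ^ (p - 2) * b := by
          rw [← ea, ← eb]; gcongr
      _ = a ^ (p - 2) * (a - b) := by ring
      _ ≤ _ := by gcongr
  | h2 a b ha hb =>
    rw [oddPow_neg, oddPow_of_nonneg hp ha, oddPow_of_nonneg hp hb, abs_neg, abs_of_nonneg ha,
      abs_of_nonneg hb, sub_neg_eq_add, sub_neg_eq_add, abs_of_nonneg (by positivity),
      abs_of_nonneg (by positivity), mul_assoc]
    have e := rpow_pred_mul (x := a + b) (q := p - 1) (by linarith) (by linarith)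
    rw [show p - 1 - 1 = p - 2 by ring] at e
    rw [e]
    have h1 : a ^ (p - 1) ≤ (a + b) ^ (p - 1) :=
      Real.rpow_le_rpow ha (by linarith) (by linarith)
    have h2 : b ^ (p - 1) ≤ (a + b) ^ (p - 1) :=
      Real.rpow_le_rpow hb (by linarith) (by linarith)
    linarith

lemma oddPow_upper_sub_of_one_le {q : ℝ} (hq : 1 ≤ q) (a b : ℝ) :
    |oddPow (q + 1) a - oddPow (q + 1) b| ≤ 2 * q * (|a| + |b|) ^ (q - 1) * |a - b| := by
  induction a, b using pair_induction with
  | symm a b h => rwa [add_comm |b|, abs_sub_comm, abs_sub_comm b a]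
  | neg a b h =>
    rw [oddPow_neg, oddPow_neg, abs_neg, abs_neg, ← neg_sub', abs_neg, ← neg_sub', abs_neg]
    exact h
  | h1 a b hb hab =>
    have ha : 0 ≤ a := hb.trans hab
    rw [oddPow_of_nonneg (by linarith) ha, oddPow_of_nonneg (by linarith) hb, abs_of_nonneg ha,
      abs_of_nonneg hb, add_sub_cancel_right,
      abs_of_nonneg (sub_nonneg.2 (Real.rpow_le_rpow hb hab (by linarith))),
      abs_of_nonneg (sub_nonneg.2 hab)]
    refine (rpow_sub_le_mul hq hb hab).trans ?_
    have h1 : a ^ (q - 1) ≤ (a + b) ^ (q - 1) :=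
      Real.rpow_le_rpow ha (by linarith) (by linarith)
    have h2 : 0 ≤ a - b := by linarith
    gcongr
    linarith
  | h2 a b ha hb =>
    rw [oddPow_neg, oddPow_of_nonneg (by linarith) ha, oddPow_of_nonneg (by linarith) hb, abs_neg,
      abs_of_nonneg ha, abs_of_nonneg hb, sub_neg_eq_add, sub_neg_eq_add,
      abs_of_nonneg (by positivity), abs_of_nonneg (by positivity), add_sub_cancel_right, mul_assoc,
      rpow_pred_mul (by positivity) (by linarith)]
    have h1 : a ^ q ≤ (a + b) ^ q := Real.rpow_le_rpow ha (by linarith) (by linarith)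
    have h2 : b ^ q ≤ (a + b) ^ q := Real.rpow_le_rpow hb (by linarith) (by linarith)
    have h3 : 0 ≤ (a + b) ^ q := by positivity
    nlinarith

/-- For equal signs, b^q ≤ a^{q−1} b already gives a^{q−1}(a − b) ≤ a^q − b^q. The factor 2^{−q}
pays for passing from a to a + b. -/
lemma oddPow_lower_sub_of_one_le {q : ℝ} (hq : 1 ≤ q) (a b : ℝ) :
    2 ^ (-q) * (|a| + |b|) ^ (q - 1) * (a - b) ^ 2 ≤
      (oddPow (q + 1) a - oddPow (q + 1) b) * (a - b) := by
  induction a, b using pair_induction with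
  | symm a b h => rw [add_comm]; linarith
  | neg a b h =>
    rw [oddPow_neg, oddPow_neg, abs_neg, abs_neg]; linarith
  | h1 a b hb hab =>
    have ha : 0 ≤ a := hb.trans hab
    rw [oddPow_of_nonneg (by linarith) ha, oddPow_of_nonneg (by linarith) hb, abs_of_nonneg ha,
      abs_of_nonneg hb, add_sub_cancel_right]
    have h1 : (a + b) ^ (q - 1) ≤ 2 ^ q * a ^ (q - 1) := by
      calc (a + b) ^ (q - 1) ≤ (2 * a) ^ (q - 1) :=
            Real.rpow_le_rpow (by linarith) (by linarith) (by linarith)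
        _ = 2 ^ (q - 1) * a ^ (q - 1) := by rw [Real.mul_rpow (by norm_num) ha]
        _ ≤ _ := by
          gcongr
          · norm_num
          · linarith
    have h2 : b ^ q ≤ a ^ (q - 1) * b := by
      rw [← rpow_pred_mul hb (by linarith)]
      gcongr
    have h3 : a ^ (q - 1) * (a - b) ≤ a ^ q - b ^ q := by
      have := rpow_pred_mul ha (show q ≠ 0 by linarith)
      linarith
    calc 2 ^ (-q) * (a + b) ^ (q - 1) * (a - b) ^ 2
        ≤ 2 ^ (-q) * (2 ^ q * a ^ (q - 1)) * (a - b) ^ 2 := by gcongr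
      _ = (a ^ (q - 1) * (a - b)) * (a - b) := by
        rw [← mul_assoc, ← Real.rpow_add (by norm_num)]; simp; ring
      _ ≤ _ := by gcongr
  | h2 a b ha hb =>
    rw [oddPow_neg, oddPow_of_nonneg (by linarith) ha, oddPow_of_nonneg (by linarith) hb, abs_neg,
      abs_of_nonneg ha, abs_of_nonneg hb, sub_neg_eq_add, sub_neg_eq_add, add_sub_cancel_right]
    have e := rpow_pred_mul (x := a + b) (q := q) (by positivity) (by linarith)
    have h1 := add_rpow_le_mul (show 0 ≤ q by linarith) ha hb
    calc 2 ^ (-q) * (a + b) ^ (q - 1) * (a + b) ^ 2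
        = 2 ^ (-q) * ((a + b) ^ (q - 1) * (a + b)) * (a + b) := by ring
      _ ≤ 2 ^ (-q) * (2 ^ q * (a ^ q + b ^ q)) * (a + b) := by rw [e]; gcongr
      _ = _ := by rw [← mul_assoc, ← Real.rpow_add (by norm_num)]; simp

lemma oddPow_sub_mul_nonneg {q : ℝ} (hq : 1 ≤ q) (a b : ℝ) :
    0 ≤ (oddPow (q + 1) a - oddPow (q + 1) b) * (a - b) :=
  le_trans (by positivity) (oddPow_lower_sub_of_one_le hq a b)

/-! ### Pointwise lower bounds for the localised flux and sign terms -/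

/-- Absorbs a cutoff error into an energy with the singular weight A^{p−2}. If X ≤ A, then A^{p−2}X²
≤ X^p, and the quadratic Young inequality works. If X ≥ A, the left side is at most 2A^{p−1}X ≤ 2X^p
and needs no absorption. -/
lemma weighted_young {p A δ X s ε : ℝ} (hp : 1 < p) (hp2 : p ≤ 2) (hδ : 0 ≤ δ) (hδA : δ ≤ A)
    (hX : 0 ≤ X) (hs : 0 ≤ s) (hs2 : s ≤ 2) (hε : 0 < ε) :
    A ^ (p - 2) * δ * X * s ≤ ε * s ^ 2 * (A ^ (p - 2) * δ ^ 2) + (1 / ε + 2) * X ^ p := by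
  have hA : 0 ≤ A := hδ.trans hδA
  rcases hX.eq_or_lt with rfl | hX'
  · rw [Real.zero_rpow (by linarith)]
    simp only [mul_zero, zero_mul, add_zero]
    positivity
  rcases le_total X A with h | h
  · have h1 : A ^ (p - 2) ≤ X ^ (p - 2) := Real.rpow_le_rpow_of_nonpos hX' h (by linarith)
    have h2 : X ^ (p - 2) * X ^ 2 = X ^ p := by
      rw [← Real.rpow_natCast X 2, ← Real.rpow_add hX']; norm_num
    have h3 : A ^ (p - 2) * X ^ 2 ≤ X ^ p := by rw [← h2]; gcongr
    have h4 : δ * X * s ≤ ε * s ^ 2 * δ ^ 2 + 1 / ε * X ^ 2 := by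
      have e : ε * s ^ 2 * δ ^ 2 + 1 / ε * X ^ 2 - δ * X * s =
        1 / ε * ((ε * (s * δ) - X / 2) ^ 2 + 3 / 4 * X ^ 2) := by field_simp; ring
      have : 0 ≤ 1 / ε * ((ε * (s * δ) - X / 2) ^ 2 + 3 / 4 * X ^ 2) := by positivity
      linarith
    have h5 : 0 ≤ A ^ (p - 2) := by positivity
    have h6 : 0 < 1 / ε := by positivity
    have h7 : 0 ≤ X ^ p := by positivity
    calc A ^ (p - 2) * δ * X * s = A ^ (p - 2) * (δ * X * s) := by ring
      _ ≤ A ^ (p - 2) * (ε * s ^ 2 * δ ^ 2 + 1 / ε * X ^ 2) := by gcongr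
      _ = ε * s ^ 2 * (A ^ (p - 2) * δ ^ 2) + 1 / ε * (A ^ (p - 2) * X ^ 2) := by ring
      _ ≤ ε * s ^ 2 * (A ^ (p - 2) * δ ^ 2) + 1 / ε * X ^ p := by gcongr
      _ ≤ _ := by nlinarith
  · have e := rpow_pred_mul (x := A) (q := p - 1) hA (by linarith)
    rw [show p - 1 - 1 = p - 2 by ring] at e
    have e2 := rpow_pred_mul (x := X) (q := p) hX (by linarith)
    have h1 : A ^ (p - 1) ≤ X ^ (p - 1) := Real.rpow_le_rpow hA h (by linarith)
    have h7 : 0 ≤ X ^ p := by positivity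
    have h6 : 0 < 1 / ε := by positivity
    have h8 : 0 ≤ ε * s ^ 2 * (A ^ (p - 2) * δ ^ 2) := by positivity
    calc A ^ (p - 2) * δ * X * s ≤ A ^ (p - 2) * A * X * 2 := by gcongr
      _ = A ^ (p - 1) * X * 2 := by rw [e]
      _ ≤ X ^ (p - 1) * X * 2 := by gcongr
      _ = 2 * X ^ p := by rw [e2]; ring
      _ ≤ _ := by nlinarith

/-- Testing the difference of two `p`-Laplace fluxes with a localised odd power: the good term
controls `(|a| + |b|)^{p - 2} |a - b|^{q + 1}`, up to the error caused by the cutoff. -/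
lemma exists_flux_localised_lower {p q : ℝ} (hp : 1 < p) (hp2 : p ≤ 2) (hq : 1 ≤ q) :
    ∃ c C : ℝ, 0 < c ∧ 0 < C ∧ ∀ a b ω₁ ω₂ η₁ η₂ ℓ : ℝ, a - b = ω₁ - ω₂ →
      |ω₁| ≤ 2 → |ω₂| ≤ 2 → 0 ≤ η₁ → η₁ ≤ 1 → 0 ≤ η₂ → η₂ ≤ 1 → |η₁ - η₂| ≤ ℓ →
      c * (η₁ ^ 2 + η₂ ^ 2) * ((|a| + |b|) ^ (p - 2) * |a - b| ^ (q + 1)) ≤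
        (oddPow p a - oddPow p b) * (η₁ ^ 2 * oddPow (q + 1) ω₁ - η₂ ^ 2 * oddPow (q + 1) ω₂) +
          C * ℓ ^ p * (|ω₁| ^ q + |ω₂| ^ q) := by
  set c₀ : ℝ := (p - 1) * 2 ^ (-q) with hc₀
  have hc₀pos : 0 < c₀ := mul_pos (by linarith) (by positivity)
  refine ⟨c₀ / 4, 2 * (1 / (c₀ / 16) + 2) * 4 * 2 ^ q, by positivity, by positivity, ?_⟩
  intro a b ω₁ ω₂ η₁ η₂ ℓ hab h1 h2 hη1 hη1' hη2 hη2' hℓ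
  set A := |a| + |b| with hA
  set W := |ω₁| + |ω₂| with hW
  set δ := |a - b| with hδ
  set D := oddPow p a - oddPow p b with hD
  set g₁ := oddPow (q + 1) ω₁ with hg₁
  set g₂ := oddPow (q + 1) ω₂ with hg₂
  have hℓ0 : 0 ≤ ℓ := (abs_nonneg _).trans hℓ
  have hδ0 : 0 ≤ δ := abs_nonneg _
  have hA0 : 0 ≤ A := by positivity
  have hW0 : 0 ≤ W := by positivity
  have hδA : δ ≤ A := abs_sub a b
  have hδW : δ ≤ W := by rw [hδ, hab]; exact abs_sub _ _
  have hW4 : W ≤ 4 := by linarith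
  have hsq : (a - b) ^ 2 = δ ^ 2 := by rw [hδ, sq_abs]
  -- The two monotonicity inequalities share the factor a − b = ω₁ − ω₂. They are multiplied and δ²
  -- is divided out, the case δ = 0 being trivial.
  have hmain : c₀ * (A ^ (p - 2) * δ ^ 2 * W ^ (q - 1)) ≤ D * (g₁ - g₂) := by
    have e1 := oddPow_lower_sub hp hp2 a b
    have e2 := oddPow_lower_sub_of_one_le hq ω₁ ω₂
    rw [← hab] at e2
    rw [hsq] at e1 e2
    rcases hδ0.eq_or_lt with h0 | h0
    · have : a = b := by
        have : |a - b| = 0 := h0.symm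
        linarith [abs_eq_zero.1 this]
      simp [hD, this, ← h0]
    · have h3 : (0 : ℝ) ≤ (p - 1) * A ^ (p - 2) * δ ^ 2 :=
        mul_nonneg (mul_nonneg (by linarith) (by positivity)) (by positivity)
      have h4 := mul_le_mul e1 e2 (by positivity) (h3.trans e1)
      have h5 : D * (a - b) * ((g₁ - g₂) * (a - b)) = D * (g₁ - g₂) * δ ^ 2 := by
        rw [← hsq]; ring
      rw [h5] at h4
      have h6 : (p - 1) * A ^ (p - 2) * δ ^ 2 * (2 ^ (-q) * W ^ (q - 1) * δ ^ 2) =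
        c₀ * (A ^ (p - 2) * δ ^ 2 * W ^ (q - 1)) * δ ^ 2 := by rw [hc₀]; ring
      rw [h6] at h4
      exact le_of_mul_le_mul_right h4 (by positivity)
  have hg : |g₁ + g₂| ≤ 2 * W ^ q := by
    have e1 : |g₁| ≤ W ^ q := by
      rw [hg₁, abs_oddPow (by linarith), add_sub_cancel_right]
      exact Real.rpow_le_rpow (abs_nonneg _) (by rw [hW]; linarith [abs_nonneg ω₂]) (by linarith)
    have e2 : |g₂| ≤ W ^ q := by
      rw [hg₂, abs_oddPow (by linarith), add_sub_cancel_right]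
      exact Real.rpow_le_rpow (abs_nonneg _) (by rw [hW]; linarith [abs_nonneg ω₁]) (by linarith)
    exact (abs_add_le _ _).trans (by linarith)
  have hDu : |D| ≤ 2 * A ^ (p - 2) * δ := oddPow_upper_sub hp hp2 a b
  have hWq : W ^ (q - 1) * W = W ^ q := rpow_pred_mul hW0 (by linarith)
  have herr : |(η₁ ^ 2 - η₂ ^ 2) / 2 * (D * (g₁ + g₂))| ≤
      2 * W ^ (q - 1) * (A ^ (p - 2) * δ * (ℓ * W) * (η₁ + η₂)) := by
    have e : (η₁ ^ 2 - η₂ ^ 2) / 2 * (D * (g₁ + g₂)) =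
      (η₁ - η₂) * (η₁ + η₂) / 2 * (D * (g₁ + g₂)) := by ring
    rw [e, abs_mul, abs_mul D, abs_div, abs_mul, abs_of_nonneg (add_nonneg hη1 hη2),
      abs_of_pos (show (0 : ℝ) < 2 by norm_num)]
    calc |η₁ - η₂| * (η₁ + η₂) / 2 * (|D| * |g₁ + g₂|)
        ≤ ℓ * (η₁ + η₂) / 2 * ((2 * A ^ (p - 2) * δ) * (2 * (W ^ (q - 1) * W))) := by
          rw [hWq]; gcongr
      _ = _ := by ring
  -- With ε = c₀/16 and (η₁+η₂)² ≤ 2(η₁²+η₂²), the absorbed part is c₀/4 of the energy. The good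
  -- term provides c₀/2, so c₀/4 remains.
  have hyoung := weighted_young (X := ℓ * W) (s := η₁ + η₂) (ε := c₀ / 16) hp hp2 hδ0 hδA
    (by positivity) (by linarith) (by linarith) (by positivity)
  have hs2 : (η₁ + η₂) ^ 2 ≤ 2 * (η₁ ^ 2 + η₂ ^ 2) := by nlinarith [sq_nonneg (η₁ - η₂)]
  -- Boundedness of the differences is used here: W ≤ 4 gives W^p ≤ 4W, so the error has homogeneity
  -- q instead of q − 1 + p.
  have hWpow : W ^ (q - 1) * (ℓ * W) ^ p ≤ 4 * 2 ^ q * ℓ ^ p * (|ω₁| ^ q + |ω₂| ^ q) := by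
    have e1 : W ^ p ≤ 4 * W := by
      have : W ^ (p - 1) * W = W ^ p := rpow_pred_mul hW0 (by linarith)
      rw [← this]
      gcongr
      calc W ^ (p - 1) ≤ 4 ^ (p - 1) := Real.rpow_le_rpow hW0 hW4 (by linarith)
        _ ≤ 4 ^ (1 : ℝ) := Real.rpow_le_rpow_of_exponent_le (by norm_num) (by linarith)
        _ = 4 := by norm_num
    have e2 : W ^ q ≤ 2 ^ q * (|ω₁| ^ q + |ω₂| ^ q) :=
      add_rpow_le_mul (by linarith) (abs_nonneg _) (abs_nonneg _)
    calc W ^ (q - 1) * (ℓ * W) ^ p = W ^ (q - 1) * ℓ ^ p * W ^ p := by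
          rw [Real.mul_rpow hℓ0 hW0]; ring
      _ ≤ W ^ (q - 1) * ℓ ^ p * (4 * W) := by gcongr
      _ = 4 * ℓ ^ p * (W ^ (q - 1) * W) := by ring
      _ ≤ 4 * ℓ ^ p * (2 ^ q * (|ω₁| ^ q + |ω₂| ^ q)) := by rw [hWq]; gcongr
      _ = _ := by ring
  have hδq : A ^ (p - 2) * δ ^ (q + 1) ≤ A ^ (p - 2) * δ ^ 2 * W ^ (q - 1) := by
    rw [mul_assoc]
    gcongr
    have : δ ^ (q + 1) = δ ^ 2 * δ ^ (q - 1) := by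
      rcases hδ0.eq_or_lt with h0 | h0
      · rw [← h0, Real.zero_rpow (by linarith)]; simp
      · rw [← Real.rpow_natCast δ 2, ← Real.rpow_add h0]; congr 1; push_cast; ring
    rw [this]
    gcongr
  -- Symmetric splitting: averaged cutoff times the difference of the powers, plus difference of
  -- cutoffs times their sum. Only the second part is an error.
  have hsplit : D * (η₁ ^ 2 * g₁ - η₂ ^ 2 * g₂) = (η₁ ^ 2 + η₂ ^ 2) / 2 * (D * (g₁ - g₂)) +
    (η₁ ^ 2 - η₂ ^ 2) / 2 * (D * (g₁ + g₂)) := by ring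
  have hE0 : 0 ≤ A ^ (p - 2) * δ ^ 2 * W ^ (q - 1) := by positivity
  have hfirst : (η₁ ^ 2 + η₂ ^ 2) / 2 * (c₀ * (A ^ (p - 2) * δ ^ 2 * W ^ (q - 1))) ≤
      (η₁ ^ 2 + η₂ ^ 2) / 2 * (D * (g₁ - g₂)) := by gcongr
  have hsecond : -((η₁ ^ 2 - η₂ ^ 2) / 2 * (D * (g₁ + g₂))) ≤
      c₀ / 4 * (η₁ ^ 2 + η₂ ^ 2) * (A ^ (p - 2) * δ ^ 2 * W ^ (q - 1)) +
        2 * (1 / (c₀ / 16) + 2) * 4 * 2 ^ q * ℓ ^ p * (|ω₁| ^ q + |ω₂| ^ q) := by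
    calc -((η₁ ^ 2 - η₂ ^ 2) / 2 * (D * (g₁ + g₂)))
        ≤ 2 * W ^ (q - 1) * (A ^ (p - 2) * δ * (ℓ * W) * (η₁ + η₂)) :=
          (neg_le_abs _).trans herr
      _ ≤ 2 * W ^ (q - 1) * (c₀ / 16 * (2 * (η₁ ^ 2 + η₂ ^ 2)) * (A ^ (p - 2) * δ ^ 2) +
          (1 / (c₀ / 16) + 2) * (ℓ * W) ^ p) := by
        gcongr
        refine hyoung.trans ?_
        gcongr
      _ = c₀ / 4 * (η₁ ^ 2 + η₂ ^ 2) * (A ^ (p - 2) * δ ^ 2 * W ^ (q - 1)) +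
          2 * (1 / (c₀ / 16) + 2) * (W ^ (q - 1) * (ℓ * W) ^ p) := by ring
      _ ≤ c₀ / 4 * (η₁ ^ 2 + η₂ ^ 2) * (A ^ (p - 2) * δ ^ 2 * W ^ (q - 1)) +
          2 * (1 / (c₀ / 16) + 2) * (4 * 2 ^ q * ℓ ^ p * (|ω₁| ^ q + |ω₂| ^ q)) := by gcongr
      _ = _ := by ring
  have hlow : c₀ / 4 * (η₁ ^ 2 + η₂ ^ 2) * (A ^ (p - 2) * δ ^ (q + 1)) ≤
      c₀ / 4 * (η₁ ^ 2 + η₂ ^ 2) * (A ^ (p - 2) * δ ^ 2 * W ^ (q - 1)) := by gcongr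
  rw [hsplit]
  linarith

lemma sgnSet_abs_le {t z : ℝ} (h : z ∈ sgnSet t) : |z| ≤ 1 := by
  rcases h with ⟨-, h⟩ | ⟨h, rfl⟩
  · exact abs_le.2 h
  · rw [abs_div, abs_abs, div_self (by simpa using h)]

/-- Monotonicity of the subdifferential of |·|: y s = |s| and z t = |t|, while y t ≤ |t| and z s ≤
|s|. -/
lemma sgnSet_mono {s t y z : ℝ} (hy : y ∈ sgnSet s) (hz : z ∈ sgnSet t) :
    0 ≤ (y - z) * (s - t) := by
  have h1 : y * s = |s| := by
    rcases hy with ⟨rfl, -⟩ | ⟨h, rfl⟩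
    · simp
    · have : |s| ≠ 0 := by simpa using h
      field_simp; rw [sq_abs]
  have h2 : z * t = |t| := by
    rcases hz with ⟨rfl, -⟩ | ⟨h, rfl⟩
    · simp
    · have : |t| ≠ 0 := by simpa using h
      field_simp; rw [sq_abs]
  have h3 : y * t ≤ |t| := by
    calc y * t ≤ |y * t| := le_abs_self _
      _ = |y| * |t| := abs_mul _ _
      _ ≤ 1 * |t| := by gcongr; exact sgnSet_abs_le hy
      _ = _ := one_mul _
  have h4 : z * s ≤ |s| := by
    calc z * s ≤ |z * s| := le_abs_self _
      _ = |z| * |s| := abs_mul _ _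
      _ ≤ 1 * |s| := by gcongr; exact sgnSet_abs_le hz
      _ = _ := one_mul _
  nlinarith

/-- Both y − z and the difference of the odd powers have the sign of a − b, so the symmetric part is
nonnegative and can be dropped whatever the selection of the sign. What remains is the cutoff error,
bounded by |y − z| ≤ 2. -/
lemma sign_localised_lower {q a b y z ω₁ ω₂ η₁ η₂ ℓ : ℝ} (hq : 1 ≤ q) (hy : y ∈ sgnSet a)
    (hz : z ∈ sgnSet b) (hab : a - b = ω₁ - ω₂) (hη1 : 0 ≤ η₁) (hη1' : η₁ ≤ 1) (hη2 : 0 ≤ η₂)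
    (hη2' : η₂ ≤ 1) (hℓ : |η₁ - η₂| ≤ ℓ) :
    -(2 * ℓ * (|ω₁| ^ q + |ω₂| ^ q)) ≤
      (y - z) * (η₁ ^ 2 * oddPow (q + 1) ω₁ - η₂ ^ 2 * oddPow (q + 1) ω₂) := by
  set g₁ := oddPow (q + 1) ω₁ with hg₁
  set g₂ := oddPow (q + 1) ω₂ with hg₂
  have h1 : 0 ≤ (y - z) * (g₁ - g₂) := by
    have e1 := sgnSet_mono hy hz
    have e2 := oddPow_sub_mul_nonneg hq ω₁ ω₂
    rw [← hab] at e2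
    by_cases h0 : a - b = 0
    · have : ω₁ = ω₂ := by linarith
      simp [hg₁, hg₂, this]
    · have h3 : 0 < (a - b) ^ 2 := by positivity
      have h4 := mul_nonneg e1 e2
      have h5 : (y - z) * (a - b) * ((g₁ - g₂) * (a - b)) = (y - z) * (g₁ - g₂) * (a - b) ^ 2 := by
        ring
      rw [h5] at h4
      exact nonneg_of_mul_nonneg_left h4 h3
  have hyz : |y - z| ≤ 2 := (abs_sub y z).trans (by linarith [sgnSet_abs_le hy, sgnSet_abs_le hz])
  have hg : |g₁ + g₂| ≤ |ω₁| ^ q + |ω₂| ^ q := by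
    refine (abs_add_le _ _).trans (le_of_eq ?_)
    rw [hg₁, hg₂, abs_oddPow (by linarith), abs_oddPow (by linarith), add_sub_cancel_right]
  have h2 : |(η₁ ^ 2 - η₂ ^ 2) / 2 * ((y - z) * (g₁ + g₂))| ≤ 2 * ℓ * (|ω₁| ^ q + |ω₂| ^ q) := by
    have e : (η₁ ^ 2 - η₂ ^ 2) / 2 * ((y - z) * (g₁ + g₂)) =
      (η₁ - η₂) * ((η₁ + η₂) / 2) * ((y - z) * (g₁ + g₂)) := by ring
    have hℓ0 : 0 ≤ ℓ := (abs_nonneg _).trans hℓ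
    rw [e, abs_mul, abs_mul, abs_mul (y - z), abs_of_nonneg (show 0 ≤ (η₁ + η₂) / 2 by linarith)]
    calc |η₁ - η₂| * ((η₁ + η₂) / 2) * (|y - z| * |g₁ + g₂|)
        ≤ ℓ * 1 * (2 * (|ω₁| ^ q + |ω₂| ^ q)) := by
          gcongr
          linarith
      _ = _ := by ring
  have hsplit : (y - z) * (η₁ ^ 2 * g₁ - η₂ ^ 2 * g₂) =
      (η₁ ^ 2 + η₂ ^ 2) / 2 * ((y - z) * (g₁ - g₂)) +
    (η₁ ^ 2 - η₂ ^ 2) / 2 * ((y - z) * (g₁ + g₂)) := by ring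
  have h3 : 0 ≤ (η₁ ^ 2 + η₂ ^ 2) / 2 * ((y - z) * (g₁ - g₂)) := by positivity
  have h4 := neg_abs_le ((η₁ ^ 2 - η₂ ^ 2) / 2 * ((y - z) * (g₁ + g₂)))
  rw [hsplit]
  linarith

/-! ### Functions with polynomial blow-up in the margin -/

/-- `f d` is bounded by a negative power of `d`, for `d ∈ (0,1)`. -/
def PolyBound (f : ℝ → ℝ≥0∞) : Prop :=
  ∃ C κ : ℝ, 0 ≤ C ∧ 0 ≤ κ ∧ ∀ d ∈ Ioo (0 : ℝ) 1, f d ≤ ENNReal.ofReal (C * d ^ (-κ))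

lemma rpow_neg_mono {d κ κ' : ℝ} (hd : d ∈ Ioo (0 : ℝ) 1) (h : κ ≤ κ') :
    d ^ (-κ) ≤ d ^ (-κ') :=
  Real.rpow_le_rpow_of_exponent_ge hd.1 hd.2.le (by linarith)

lemma PolyBound.const {c : ℝ≥0∞} (hc : c ≠ ∞) : PolyBound fun _ => c :=
  ⟨c.toReal, 0, ENNReal.toReal_nonneg, le_rfl, fun d _ => by simp [ENNReal.ofReal_toReal hc]⟩

lemma PolyBound.pow (a : ℝ) : PolyBound fun d => ENNReal.ofReal (d ^ a) := by
  refine ⟨1, |a|, zero_le_one, abs_nonneg a, fun d hd => ENNReal.ofReal_le_ofReal ?_⟩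
  rw [one_mul]
  exact Real.rpow_le_rpow_of_exponent_ge hd.1 hd.2.le (neg_abs_le a)

lemma PolyBound.add {f g : ℝ → ℝ≥0∞} (hf : PolyBound f) (hg : PolyBound g) :
    PolyBound fun d => f d + g d := by
  obtain ⟨C, κ, hC, hκ, H⟩ := hf
  obtain ⟨C', κ', hC', hκ', H'⟩ := hg
  refine ⟨C + C', max κ κ', by positivity, le_max_of_le_left hκ, fun d hd => ?_⟩
  have hd0 := hd.1
  refine (add_le_add (H d hd) (H' d hd)).trans ?_
  rw [← ENNReal.ofReal_add (by positivity) (by positivity), add_mul]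
  refine ENNReal.ofReal_le_ofReal (add_le_add ?_ ?_) <;> gcongr 1
  · exact rpow_neg_mono hd (le_max_left _ _)
  · exact rpow_neg_mono hd (le_max_right _ _)

lemma PolyBound.mul {f g : ℝ → ℝ≥0∞} (hf : PolyBound f) (hg : PolyBound g) :
    PolyBound fun d => f d * g d := by
  obtain ⟨C, κ, hC, hκ, H⟩ := hf
  obtain ⟨C', κ', hC', hκ', H'⟩ := hg
  refine ⟨C * C', κ + κ', by positivity, by positivity, fun d hd => ?_⟩
  have hd0 := hd.1
  refine (mul_le_mul' (H d hd) (H' d hd)).trans ?_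
  rw [← ENNReal.ofReal_mul (by positivity), neg_add, Real.rpow_add hd0]
  refine ENNReal.ofReal_le_ofReal (le_of_eq (by ring))

lemma PolyBound.rpow {f : ℝ → ℝ≥0∞} (hf : PolyBound f) {a : ℝ} (ha : 0 ≤ a) :
    PolyBound fun d => f d ^ a := by
  obtain ⟨C, κ, hC, hκ, H⟩ := hf
  refine ⟨C ^ a, κ * a, by positivity, by positivity, fun d hd => ?_⟩
  have hd0 := hd.1
  refine (ENNReal.rpow_le_rpow (H d hd) ha).trans ?_
  rw [ENNReal.ofReal_rpow_of_nonneg (by positivity) ha, Real.mul_rpow hC (by positivity),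
    ← Real.rpow_mul hd0.le]
  simp

lemma PolyBound.comp_mul {f : ℝ → ℝ≥0∞} (hf : PolyBound f) {c : ℝ} (hc : 0 < c) (hc1 : c ≤ 1) :
    PolyBound fun d => f (c * d) := by
  obtain ⟨C, κ, hC, hκ, H⟩ := hf
  refine ⟨C * c ^ (-κ), κ, by positivity, hκ, fun d hd => ?_⟩
  have hd0 := hd.1
  refine (H (c * d) ⟨by positivity, by nlinarith [hd.2]⟩).trans (le_of_eq ?_)
  rw [Real.mul_rpow hc.le hd0.le, mul_assoc]

lemma PolyBound.ne_top {f : ℝ → ℝ≥0∞} (hf : PolyBound f) {d : ℝ} (hd : d ∈ Ioo (0 : ℝ) 1) :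
    f d ≠ ∞ := by
  obtain ⟨C, κ, hC, hκ, H⟩ := hf
  exact ((H d hd).trans_lt ENNReal.ofReal_lt_top).ne

/-! ### The singular kernel near and away from the diagonal -/

/-- The singular kernel `|z|^{-(N + α)}`. -/
def kern (α : ℝ) (z : Rn N) : ℝ := ‖z‖ ^ (-((N : ℝ) + α))

lemma kern_nonneg (α : ℝ) (z : Rn N) : 0 ≤ kern α z := by unfold kern; positivity

@[fun_prop]
lemma measurable_kern (α : ℝ) : Measurable (kern α : Rn N → ℝ) := by unfold kern; fun_prop

lemma kern_neg (α : ℝ) (z : Rn N) : kern α (-z) = kern α z := by simp [kern]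

lemma kern_sub_comm (α : ℝ) (x y : Rn N) : kern α (x - y) = kern α (y - x) := by
  rw [← kern_neg, neg_sub]

lemma kern_le_of_le {α d : ℝ} (hα : 0 ≤ α) (hd : 0 < d) {z : Rn N} (hz : d ≤ ‖z‖) :
    kern α z ≤ d ^ (-((N : ℝ) + α)) := by
  unfold kern
  exact Real.rpow_le_rpow_of_nonpos hd hz (by have : (0 : ℝ) ≤ N := by positivity
                                              linarith)

lemma lintegral_kern_ball_lt_top (hN : 1 ≤ N) {α r : ℝ} (hα : α < 0) :
    ∫⁻ z in Metric.ball (0 : Rn N) r, ENNReal.ofReal (kern α z) < ∞ := by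
  have h : IntegrableOn (kern α : Rn N → ℝ) (Metric.ball 0 r) := by
    refine integrableOn_ball_of_norm_le_rpow (C := 1) (α := (N : ℝ) + α) (by simpa using hN)
      (by simpa using hα) ?_ ?_
    · refine Filter.Eventually.of_forall fun z => ?_
      rw [Real.norm_of_nonneg (kern_nonneg _ _), one_mul, kern]
    · exact (measurable_kern α).aestronglyMeasurable
  have := h.lintegral_lt_top
  exact this

/-- For d < 1 and |z| ≥ d one has |z| ≥ (d/2)(1 + |z|), so the kernel is at most a power of d times
the integrable function (1+|z|)^{−(N+α)}. -/
lemma exists_polyBound_lintegral_kern_compl {α : ℝ} (hα : 0 < α) :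
    ∃ f, PolyBound f ∧ ∀ d ∈ Ioo (0 : ℝ) 1,
      ∫⁻ z in {z : Rn N | d ≤ ‖z‖}, ENNReal.ofReal (kern α z) ≤ f d := by
  have hfin : ∫⁻ z : Rn N, ENNReal.ofReal ((1 + ‖z‖) ^ (-((N : ℝ) + α))) < ∞ :=
    finite_integral_one_add_norm (by simpa using hα)
  refine ⟨fun d => ENNReal.ofReal (2 ^ ((N : ℝ) + α)) * ENNReal.ofReal (d ^ (-((N : ℝ) + α))) *
    ∫⁻ z : Rn N, ENNReal.ofReal ((1 + ‖z‖) ^ (-((N : ℝ) + α))),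
    ((PolyBound.const (by simp)).mul (PolyBound.pow _)).mul (PolyBound.const hfin.ne), ?_⟩
  intro d hd
  have hd0 := hd.1
  beta_reduce
  rw [← lintegral_const_mul' _ _ (by finiteness)]
  refine (setLIntegral_mono' ?_ ?_).trans (setLIntegral_le_lintegral _ _)
  · exact measurableSet_le measurable_const measurable_norm
  · intro z hz
    rw [← ENNReal.ofReal_mul (by positivity), ← ENNReal.ofReal_mul (by positivity)]
    refine ENNReal.ofReal_le_ofReal ?_
    have hz' : d ≤ ‖z‖ := hz
    have h1 : 2⁻¹ * d * (1 + ‖z‖) ≤ ‖z‖ := by nlinarith [hd.2]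
    have h2 : 0 < 2⁻¹ * d * (1 + ‖z‖) := by positivity
    calc kern α z ≤ (2⁻¹ * d * (1 + ‖z‖)) ^ (-((N : ℝ) + α)) :=
          Real.rpow_le_rpow_of_nonpos h2 h1 (by have : (0 : ℝ) ≤ N := by positivity
                                                linarith)
      _ = _ := by
        rw [Real.mul_rpow (by positivity) (by positivity), Real.mul_rpow (by positivity) hd0.le]
        congr 2
        rw [Real.rpow_neg (by norm_num), Real.inv_rpow (by norm_num), inv_inv]

/-- Off-diagonal part of a symmetric double integral whose integrand vanishes off `S`. -/
lemma lintegral_offdiag_le {E : Type*} [MeasurableSpace E] {μ : Measure E} [SFinite μ]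
    {S U : Set E} (hS : MeasurableSet S)
    (hU : MeasurableSet U) (hSU : S ⊆ U) {F : E × E → ℝ≥0∞} (hF : Measurable F)
    (hsymm : ∀ x y, F (x, y) = F (y, x)) (hzero : ∀ x y, x ∉ S → y ∉ S → F (x, y) = 0) :
    ∫⁻ z in (U ×ˢ U)ᶜ, F z ∂(μ.prod μ) ≤ 2 * ∫⁻ x in S, ∫⁻ y in Uᶜ, F (x, y) ∂μ ∂μ := by
  have h1 : ∫⁻ z in S ×ˢ Uᶜ, F z ∂(μ.prod μ) = ∫⁻ x in S, ∫⁻ y in Uᶜ, F (x, y) ∂μ ∂μ := by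
    rw [← Measure.prod_restrict, lintegral_prod _ hF.aemeasurable]
  have h2 : ∫⁻ z in Uᶜ ×ˢ S, F z ∂(μ.prod μ) = ∫⁻ x in S, ∫⁻ y in Uᶜ, F (x, y) ∂μ ∂μ := by
    rw [← Measure.prod_restrict, lintegral_prod_symm' _ hF]
    simp only [hsymm]
  have h3 : ∫⁻ z in (U ×ˢ U)ᶜ, F z ∂(μ.prod μ) ≤
      ∫⁻ z in (S ×ˢ Uᶜ) ∪ (Uᶜ ×ˢ S), F z ∂(μ.prod μ) := by
    rw [← lintegral_indicator (hU.prod hU).compl,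
      ← lintegral_indicator ((hS.prod hU.compl).union (hU.compl.prod hS))]
    refine lintegral_mono fun z => ?_
    by_cases hz : z ∈ (S ×ˢ Uᶜ) ∪ (Uᶜ ×ˢ S)
    · rw [indicator_of_mem hz]; exact indicator_le_self _ _ _
    · by_cases hz' : z ∈ (U ×ˢ U)ᶜ
      · have : F z = 0 := by
          refine hzero z.1 z.2 ?_ ?_
          · intro h
            exact hz (Or.inl ⟨h, fun h' => hz' ⟨hSU h, h'⟩⟩)
          · intro h
            exact hz (Or.inr ⟨fun h' => hz' ⟨h', hSU h⟩, h⟩)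
        rw [indicator_of_mem hz', this]; exact zero_le
      · rw [indicator_of_notMem hz']; exact zero_le
  calc _ ≤ _ := h3
    _ ≤ _ := lintegral_union_le _ _ _
    _ = _ := by rw [h1, h2, two_mul]

lemma lintegral_kern_sub_le {α d : ℝ} (x : Rn N) :
    ∫⁻ y in {y : Rn N | d ≤ ‖x - y‖}, ENNReal.ofReal (kern α (x - y)) =
      ∫⁻ z in {z : Rn N | d ≤ ‖z‖}, ENNReal.ofReal (kern α z) := by
  have hm : MeasurableSet {z : Rn N | d ≤ ‖z‖} := measurableSet_le measurable_const measurable_norm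
  have hm' : MeasurableSet {y : Rn N | d ≤ ‖x - y‖} :=
    measurableSet_le measurable_const (by fun_prop)
  rw [← lintegral_indicator hm, ← lintegral_indicator hm',
    ← lintegral_sub_left_eq_self ({z : Rn N | d ≤ ‖z‖}.indicator _) x]
  rfl

lemma lintegral_kern_sub_ball_le {α r : ℝ} {x x₀ : Rn N} (hx : x ∈ Metric.ball x₀ r) :
    ∫⁻ y in Metric.ball x₀ r, ENNReal.ofReal (kern α (x - y)) ≤
      ∫⁻ z in Metric.ball (0 : Rn N) (2 * r), ENNReal.ofReal (kern α z) := by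
  rw [← lintegral_indicator Metric.isOpen_ball.measurableSet,
    ← lintegral_indicator Metric.isOpen_ball.measurableSet, 
    ← lintegral_sub_left_eq_self ((Metric.ball (0 : Rn N) (2 * r)).indicator _) x]
  refine lintegral_mono fun y => ?_
  by_cases hy : y ∈ Metric.ball x₀ r
  · have : x - y ∈ Metric.ball (0 : Rn N) (2 * r) := by
      rw [mem_ball_zero_iff, ← dist_eq_norm]
      rw [Metric.mem_ball] at hx hy
      linarith [dist_triangle_right x y x₀]
    rw [indicator_of_mem hy, indicator_of_mem this]
  · rw [indicator_of_notMem hy]; exact zero_le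

/-! ### Normalised solutions and their tails -/

/-- The power of the Gagliardo seminorm with kernel `|x - y|^{-(N + α)}`, as an integral over the
product. -/
def gagInt (α m : ℝ) (A : Set (Rn N)) (u : Rn N → ℝ) : ℝ≥0∞ :=
  ∫⁻ z in A ×ˢ A, ENNReal.ofReal (|u z.1 - u z.2| ^ m * kern α (z.1 - z.2))

/-- A normalised solution in `B_R(x₀)` of `λ (-Δ₁)^{s₁} u + (-Δ_p)^{s_p} u = 0`: it is bounded by
`1` in the ball and has tail at most `1`. -/
structure NormSol (s₁ sp p : ℝ) (x₀ : Rn N) (R lam : ℝ) (u : Rn N → ℝ) (Z : Rn N × Rn N → ℝ) :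
    Prop where
  meas : Measurable u
  R_pos : 0 < R
  R_lt : R < 1
  bdd : ∀ x ∈ Metric.ball x₀ R, |u x| ≤ 1
  tail_le : ∫⁻ x in (Metric.ball x₀ R)ᶜ, ENNReal.ofReal (|u x| ^ (p - 1) * kern (sp * p) (x - x₀)) ≤
    ENNReal.ofReal (R ^ (-(sp * p)))
  -- The two seminorms are only required to be finite. They make the weak formulation meaningful but
  -- enter no estimate quantitatively.
  gag_one : gagInt s₁ 1 (Metric.ball x₀ R) u < ∞
  gag_p : gagInt (sp * p) p (Metric.ball x₀ R) u < ∞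
  lam_nonneg : 0 ≤ lam
  lam_le : lam ≤ 1
  Z_meas : AEStronglyMeasurable Z
  Z_sgn : ∀ᵐ z : Rn N × Rn N, Z z ∈ sgnSet (u z.1 - u z.2)
  eqn : ∀ (φ : Rn N → ℝ) (ρ B : ℝ), Measurable φ → ρ < R → (∀ x, |φ x| ≤ B) →
    (∀ x ∉ Metric.closedBall x₀ ρ, φ x = 0) → gagInt s₁ 1 (Metric.ball x₀ R) φ < ∞ →
    gagInt (sp * p) p (Metric.ball x₀ R) φ < ∞ →
    0 = lam * (∫ z : Rn N × Rn N, Z z * ((φ z.1 - φ z.2) * kern s₁ (z.1 - z.2))) +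
      ∫ z : Rn N × Rn N, oddPow p (u z.1 - u z.2) * (φ z.1 - φ z.2) * kern (sp * p) (z.1 - z.2)

/-- The shifted point y + h lies either in the ball, where |u| ≤ 1 and the kernel is at most
d^{−(N+s_p p)}, or outside, where |y + h − x₀| ≤ 3d^{−1}|x − y| and the kernel is comparable to that
of the tail. In both cases the loss is a power of d, uniformly in h. -/
lemma exists_polyBound_tail (N : ℕ) {p sp : ℝ} (hp : 1 < p) (hsp : 0 < sp) :
    ∃ f, PolyBound f ∧ ∀ (s₁ : ℝ) (x₀ : Rn N) (R lam : ℝ) (u : Rn N → ℝ) (Z : Rn N × Rn N → ℝ),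
      NormSol s₁ sp p x₀ R lam u Z → ∀ d : ℝ, 0 < d → d < R →
      ∀ x ∈ Metric.ball x₀ R, ∀ h : Rn N, ‖h‖ ≤ d →
      ∫⁻ y in {y : Rn N | d ≤ ‖x - y‖},
        ENNReal.ofReal (|u (y + h)| ^ (p - 1) * kern (sp * p) (x - y)) ≤ f d := by
  have hα : 0 < sp * p := by positivity
  refine ⟨fun d => ENNReal.ofReal (3 ^ ((N : ℝ) + sp * p)) *
    ENNReal.ofReal (d ^ (-((N : ℝ) + sp * p))) * ENNReal.ofReal (d ^ (-(sp * p))) +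
      ENNReal.ofReal (d ^ (-((N : ℝ) + sp * p))) * volume (Metric.ball (0 : Rn N) 1),
    (((PolyBound.const (by simp)).mul (PolyBound.pow _)).mul (PolyBound.pow _)).add
      ((PolyBound.pow _).mul (PolyBound.const measure_ball_lt_top.ne)), ?_⟩
  intro s₁ x₀ R lam u Z hu d hd hdR x hx h hh
  have hR1 := hu.R_lt
  have hmu := hu.meas
  set B := Metric.ball x₀ R with hB
  have hBm : MeasurableSet B := Metric.isOpen_ball.measurableSet
  set G : Rn N → ℝ≥0∞ := fun y' => Bᶜ.indicator (fun y' => ENNReal.ofReal (3 ^ ((N : ℝ) + sp * p)) *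
      ENNReal.ofReal (d ^ (-((N : ℝ) + sp * p))) *
      ENNReal.ofReal (|u y'| ^ (p - 1) * kern (sp * p) (y' - x₀))) y' +
    B.indicator (fun _ => ENNReal.ofReal (d ^ (-((N : ℝ) + sp * p)))) y' with hG
  have hNp : 0 ≤ (N : ℝ) + sp * p := by positivity
  have hm' : MeasurableSet {y : Rn N | d ≤ ‖x - y‖} :=
    measurableSet_le measurable_const (by fun_prop)
  have hpt : ∀ y ∈ {y : Rn N | d ≤ ‖x - y‖},
      ENNReal.ofReal (|u (y + h)| ^ (p - 1) * kern (sp * p) (x - y)) ≤ G (y + h) := by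
    intro y hy
    have hy' : d ≤ ‖x - y‖ := hy
    by_cases hyB : y + h ∈ B
    · rw [hG]
      simp only [indicator_of_mem hyB]
      rw [indicator_of_notMem (by simpa using hyB), zero_add]
      refine ENNReal.ofReal_le_ofReal ?_
      have h1 : |u (y + h)| ^ (p - 1) ≤ 1 :=
        Real.rpow_le_one (abs_nonneg _) (hu.bdd _ hyB) (by linarith)
      have h2 := kern_le_of_le (N := N) hα.le hd hy'
      have h3 := kern_nonneg (N := N) (sp * p) (x - y)
      nlinarith
    · rw [hG]
      have hyB' : y + h ∈ Bᶜ := hyB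
      simp only [indicator_of_mem hyB']
      rw [indicator_of_notMem hyB, add_zero, ← ENNReal.ofReal_mul (by positivity),
        ← ENNReal.ofReal_mul (by positivity)]
      refine ENNReal.ofReal_le_ofReal ?_
      have hpos : 0 < ‖y + h - x₀‖ := by
        rw [hB, Metric.mem_ball, dist_eq_norm, not_lt] at hyB
        linarith [hu.R_pos]
      -- Each of |x − y|, |x − x₀| < 1 and |h| ≤ d < 1 is at most d^{−1}|x − y|, which explains the
      -- factor 3.
      have h1 : ‖y + h - x₀‖ ≤ 3 * d⁻¹ * ‖x - y‖ := by
        have e1 : ‖y + h - x₀‖ ≤ ‖x - y‖ + ‖x - x₀‖ + ‖h‖ := by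
          calc ‖y + h - x₀‖ = ‖-(x - y) + (x - x₀) + h‖ := by congr 1; abel
            _ ≤ ‖-(x - y) + (x - x₀)‖ + ‖h‖ := norm_add_le _ _
            _ ≤ _ := by rw [← norm_neg (x - y)]; gcongr; exact norm_add_le _ _
        have e2 : ‖x - x₀‖ ≤ 1 := by
          rw [hB, Metric.mem_ball, dist_eq_norm] at hx; linarith
        have e3 : 1 ≤ d⁻¹ * ‖x - y‖ := by
          rw [inv_mul_eq_div, le_div_iff₀ hd]; linarith
        have e4 : ‖x - y‖ ≤ d⁻¹ * ‖x - y‖ := by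
          have : 1 ≤ d⁻¹ := (one_le_inv₀ hd).2 (by linarith)
          nlinarith [norm_nonneg (x - y)]
        linarith
      have h2 : kern (sp * p) (x - y) ≤ 3 ^ ((N : ℝ) + sp * p) * d ^ (-((N : ℝ) + sp * p)) *
          kern (sp * p) (y + h - x₀) := by
        have e1 : (3 * d⁻¹ * ‖x - y‖) ^ (-((N : ℝ) + sp * p)) ≤
          ‖y + h - x₀‖ ^ (-((N : ℝ) + sp * p)) :=
          Real.rpow_le_rpow_of_nonpos hpos h1 (by linarith)
        rw [Real.mul_rpow (by positivity) (by positivity),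
          Real.mul_rpow (by positivity) (by positivity), Real.inv_rpow hd.le] at e1
        have e2 : 0 < (3 : ℝ) ^ (-((N : ℝ) + sp * p)) := by positivity
        have e3 : 0 < d ^ (-((N : ℝ) + sp * p)) := by positivity
        have e4 : (3 : ℝ) ^ ((N : ℝ) + sp * p) * 3 ^ (-((N : ℝ) + sp * p)) = 1 := by
          rw [← Real.rpow_add (by norm_num)]; simp
        unfold kern
        calc ‖x - y‖ ^ (-((N : ℝ) + sp * p)) =
            (3 ^ ((N : ℝ) + sp * p) * 3 ^ (-((N : ℝ) + sp * p))) *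
              (d ^ (-((N : ℝ) + sp * p)) * (d ^ (-((N : ℝ) + sp * p)))⁻¹) *
              ‖x - y‖ ^ (-((N : ℝ) + sp * p)) := by
              rw [e4, mul_inv_cancel₀ e3.ne']; ring
          _ = 3 ^ ((N : ℝ) + sp * p) * d ^ (-((N : ℝ) + sp * p)) *
              (3 ^ (-((N : ℝ) + sp * p)) * (d ^ (-((N : ℝ) + sp * p)))⁻¹ *
                ‖x - y‖ ^ (-((N : ℝ) + sp * p))) := by ring
          _ ≤ _ := by gcongr
      have h3 : 0 ≤ |u (y + h)| ^ (p - 1) := by positivity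
      calc |u (y + h)| ^ (p - 1) * kern (sp * p) (x - y)
          ≤ |u (y + h)| ^ (p - 1) * (3 ^ ((N : ℝ) + sp * p) * d ^ (-((N : ℝ) + sp * p)) *
          kern (sp * p) (y + h - x₀)) := by gcongr
        _ = _ := by ring
  have hmeasG1 : Measurable fun y' : Rn N => ENNReal.ofReal (3 ^ ((N : ℝ) + sp * p)) *
      ENNReal.ofReal (d ^ (-((N : ℝ) + sp * p))) *
      ENNReal.ofReal (|u y'| ^ (p - 1) * kern (sp * p) (y' - x₀)) := by fun_prop
  calc _ ≤ ∫⁻ y in {y : Rn N | d ≤ ‖x - y‖}, G (y + h) := setLIntegral_mono' hm' hpt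
    _ ≤ ∫⁻ y, G (y + h) := setLIntegral_le_lintegral _ _
    _ = ∫⁻ y, G y := lintegral_add_right_eq_self G h
    _ ≤ _ := by
      rw [hG, lintegral_add_left (hmeasG1.indicator hBm.compl), lintegral_indicator hBm.compl,
        lintegral_indicator hBm, lintegral_const_mul' _ _ (by finiteness), setLIntegral_const]
      have hvol : volume B ≤ volume (Metric.ball (0 : Rn N) 1) := by
        rw [hB, Measure.addHaar_ball_center volume x₀ R]
        exact measure_mono (Metric.ball_subset_ball hR1.le)
      have htail : ENNReal.ofReal (R ^ (-(sp * p))) ≤ ENNReal.ofReal (d ^ (-(sp * p))) :=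
        ENNReal.ofReal_le_ofReal (Real.rpow_le_rpow_of_nonpos hd hdR.le (by linarith))
      exact add_le_add (mul_le_mul_right (hu.tail_le.trans htail) _) (mul_le_mul_right hvol _)

/-- Since p − 1 ≤ 1, the power t^{p−1} is subadditive and |u(x+h)| ≤ 1. The flux is thus at most 1 +
|u(y+h)|^{p−1}, and the two parts are the kernel integral and the tail. -/
lemma exists_polyBound_flux_tail (N : ℕ) {p sp : ℝ} (hp : 1 < p) (hp2 : p ≤ 2) (hsp : 0 < sp) :
    ∃ f, PolyBound f ∧ ∀ (s₁ : ℝ) (x₀ : Rn N) (R lam : ℝ) (u : Rn N → ℝ) (Z : Rn N × Rn N → ℝ),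
      NormSol s₁ sp p x₀ R lam u Z → ∀ d : ℝ, 0 < d → d < R →
      ∀ x ∈ Metric.ball x₀ R, ∀ h : Rn N, ‖h‖ ≤ d → x + h ∈ Metric.ball x₀ R →
      ∫⁻ y in {y : Rn N | d ≤ ‖x - y‖},
        ENNReal.ofReal (|oddPow p (u (x + h) - u (y + h))| * kern (sp * p) (x - y)) ≤ f d := by
  obtain ⟨f, hf, H⟩ := exists_polyBound_tail N hp hsp
  obtain ⟨k, hk, K⟩ := exists_polyBound_lintegral_kern_compl (N := N) (α := sp * p) (by positivity)
  refine ⟨fun d => k d + f d, hk.add hf, ?_⟩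
  intro s₁ x₀ R lam u Z hu d hd hdR x hx h hh hxh
  have hmu := hu.meas
  have hd1 : d < 1 := hdR.trans hu.R_lt
  have h1 := H s₁ x₀ R lam u Z hu d hd hdR x hx h hh
  have h2 := K d ⟨hd, hd1⟩
  rw [← lintegral_kern_sub_le x] at h2
  refine le_trans ?_ (add_le_add h2 h1)
  rw [← lintegral_add_left (by fun_prop)]
  refine lintegral_mono fun y => ?_
  rw [← ENNReal.ofReal_add (kern_nonneg _ _) (mul_nonneg (by positivity) (kern_nonneg _ _))]
  refine ENNReal.ofReal_le_ofReal ?_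
  have h3 : |oddPow p (u (x + h) - u (y + h))| ≤ 1 + |u (y + h)| ^ (p - 1) := by
    rw [abs_oddPow hp]
    calc |u (x + h) - u (y + h)| ^ (p - 1) ≤ (|u (x + h)| + |u (y + h)|) ^ (p - 1) :=
          Real.rpow_le_rpow (abs_nonneg _) (abs_sub _ _) (by linarith)
      _ ≤ |u (x + h)| ^ (p - 1) + |u (y + h)| ^ (p - 1) :=
          Real.rpow_add_le_add_rpow (abs_nonneg _) (abs_nonneg _) (by linarith) (by linarith)
      _ ≤ _ := by
          gcongr
          exact Real.rpow_le_one (abs_nonneg _) (hu.bdd _ hxh) (by linarith)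
  calc _ ≤ (1 + |u (y + h)| ^ (p - 1)) * kern (sp * p) (x - y) := by
        gcongr
        exact kern_nonneg _ _
    _ = _ := by ring

/-! ### Localisation of double integrals and integrability of the weak form -/

lemma norm_rpow_mul_kern_le {α m : ℝ} (hm : 0 < m) (z : Rn N) :
    ‖z‖ ^ m * kern α z ≤ kern (α - m) z := by
  rcases (norm_nonneg z).eq_or_lt with h | h
  · rw [← h, Real.zero_rpow hm.ne', zero_mul]; exact kern_nonneg _ _
  · unfold kern
    rw [← Real.rpow_add h]
    apply le_of_eq; congr 1; ring

lemma dist_le_of_mem_of_notMem {x₀ x y : Rn N} {ρ d : ℝ} (hx : x ∈ Metric.closedBall x₀ ρ)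
    (hy : y ∉ Metric.ball x₀ (ρ + d)) : d ≤ ‖x - y‖ := by
  rw [Metric.mem_closedBall] at hx
  rw [Metric.mem_ball, not_lt] at hy
  rw [← dist_eq_norm]
  linarith [dist_triangle_left y x₀ x]

/-- Common device for all far interactions: a symmetric integrand that vanishes unless one point
lies in the small closed ball only sees, off the product of larger balls, pairs at distance at least
d. -/
lemma lintegral_compl_ball_le {x₀ : Rn N} {ρ d : ℝ} (hd : 0 < d) {F : Rn N × Rn N → ℝ≥0∞}
    (hF : Measurable F) (hsymm : ∀ x y, F (x, y) = F (y, x))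
    (hzero : ∀ x y, x ∉ Metric.closedBall x₀ ρ → y ∉ Metric.closedBall x₀ ρ → F (x, y) = 0)
    {G : Rn N → Rn N → ℝ≥0∞} {c : Rn N → ℝ≥0∞}
    (hG : ∀ x ∈ Metric.closedBall x₀ ρ, ∀ y ∉ Metric.closedBall x₀ ρ, F (x, y) ≤ G x y)
    (hc : ∀ x ∈ Metric.closedBall x₀ ρ, ∫⁻ y in {y | d ≤ ‖x - y‖}, G x y ≤ c x) :
    ∫⁻ z in (Metric.ball x₀ (ρ + d) ×ˢ Metric.ball x₀ (ρ + d))ᶜ, F z ≤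
      2 * ∫⁻ x in Metric.closedBall x₀ ρ, c x := by
  refine (lintegral_offdiag_le (μ := volume) Metric.isClosed_closedBall.measurableSet
    Metric.isOpen_ball.measurableSet (Metric.closedBall_subset_ball (by linarith)) hF hsymm
    hzero).trans ?_
  refine mul_le_mul_right (setLIntegral_mono' Metric.isClosed_closedBall.measurableSet
    fun x hx => ?_) _
  refine le_trans ?_ (hc x hx)
  refine le_trans ?_ (lintegral_mono_set (s := (Metric.ball x₀ (ρ + d))ᶜ) fun y hy =>
    dist_le_of_mem_of_notMem hx hy)
  refine setLIntegral_mono' Metric.isOpen_ball.measurableSet.compl fun y hy => hG x hx y ?_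
  exact fun h => hy (Metric.closedBall_subset_ball (by linarith) h)

lemma lintegral_eq_add_compl_ball {x₀ : Rn N} {R : ℝ} (F : Rn N × Rn N → ℝ≥0∞) :
    ∫⁻ z, F z = (∫⁻ z in Metric.ball x₀ R ×ˢ Metric.ball x₀ R, F z) +
      ∫⁻ z in (Metric.ball x₀ R ×ˢ Metric.ball x₀ R)ᶜ, F z :=
  (lintegral_add_compl _ (Metric.isOpen_ball.measurableSet.prod
    Metric.isOpen_ball.measurableSet)).symm

lemma lintegral_kern_compl_lt_top {α d : ℝ} (hα : 0 < α) (hd : 0 < d) :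
    ∫⁻ z in {z : Rn N | d ≤ ‖z‖}, ENNReal.ofReal (kern α z) < ∞ := by
  obtain ⟨f, hf, H⟩ := exists_polyBound_lintegral_kern_compl (N := N) hα
  have hd' : min d 2⁻¹ ∈ Ioo (0 : ℝ) 1 :=
    ⟨by positivity, (min_le_right _ _).trans_lt (by norm_num)⟩
  refine lt_of_le_of_lt (lintegral_mono_set fun z hz => ?_)
    ((H _ hd').trans_lt (hf.ne_top hd').lt_top)
  exact (min_le_left d _).trans (show d ≤ ‖z‖ from hz)

/-- A bounded function supported strictly inside a ball has finite Gagliardo seminorm on the whole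
space as soon as it has one on the ball. -/
lemma gagInt_univ_lt_top {α m B ρ d : ℝ} {x₀ : Rn N} {φ : Rn N → ℝ} (hα : 0 < α) (hm : 0 < m)
    (hd : 0 < d) (hφ : Measurable φ) (hB : ∀ x, |φ x| ≤ B)
    (hzero : ∀ x ∉ Metric.closedBall x₀ ρ, φ x = 0)
    (hg : gagInt α m (Metric.ball x₀ (ρ + d)) φ < ∞) : gagInt α m univ φ < ∞ := by
  unfold gagInt
  rw [univ_prod_univ, Measure.restrict_univ, lintegral_eq_add_compl_ball (x₀ := x₀) (R := ρ + d)]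
  refine ENNReal.add_lt_top.2 ⟨hg, ?_⟩
  have hB0 : 0 ≤ B := (abs_nonneg _).trans (hB x₀)
  refine lt_of_le_of_lt (lintegral_compl_ball_le (c := fun _ => ENNReal.ofReal (B ^ m) *
    ∫⁻ z in {z : Rn N | d ≤ ‖z‖}, ENNReal.ofReal (kern α z))
    (G := fun x y => ENNReal.ofReal (B ^ m) * ENNReal.ofReal (kern α (x - y))) hd (by fun_prop)
    ?_ ?_ ?_ ?_) ?_
  · intro x y
    simp only
    rw [abs_sub_comm, kern_sub_comm]
  · intro x y hx hy
    simp [hzero x hx, hzero y hy, Real.zero_rpow hm.ne']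
  · intro x hx y hy
    rw [← ENNReal.ofReal_mul (by positivity)]
    refine ENNReal.ofReal_le_ofReal ?_
    gcongr
    · exact kern_nonneg _ _
    · simpa [hzero y hy] using hB x
  · intro x hx
    rw [lintegral_const_mul' _ _ (by finiteness), lintegral_kern_sub_le]
  · rw [setLIntegral_const]
    have h1 := lintegral_kern_compl_lt_top (N := N) hα hd
    have h2 : volume (Metric.closedBall x₀ ρ) < ∞ := measure_closedBall_lt_top
    finiteness

lemma integrable_of_lintegral_abs_lt_top {X : Type*} [MeasurableSpace X] {μ : Measure X}
    {f : X → ℝ} (hf : AEStronglyMeasurable f μ) {g : X → ℝ} (hfg : ∀ᵐ x ∂μ, |f x| ≤ g x)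
    (hg : ∫⁻ x, ENNReal.ofReal (g x) ∂μ < ∞) : Integrable f μ := by
  refine ⟨hf, ?_⟩
  refine lt_of_le_of_lt (lintegral_mono_ae ?_) hg
  filter_upwards [hfg] with x hx
  rw [← ofReal_norm, Real.norm_eq_abs]
  exact ENNReal.ofReal_le_ofReal hx

section integrability

variable {s₁ sp p : ℝ} {x₀ : Rn N} {R lam : ℝ} {u : Rn N → ℝ} {Z : Rn N × Rn N → ℝ}

lemma NormSol.integrable_sign (hu : NormSol s₁ sp p x₀ R lam u Z) (hs₁ : 0 < s₁)
    {φ : Rn N → ℝ} {B ρ : ℝ} (hφ : Measurable φ) (hρ : ρ < R) (hB : ∀ x, |φ x| ≤ B)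
    (hzero : ∀ x ∉ Metric.closedBall x₀ ρ, φ x = 0)
    (hg : gagInt s₁ 1 (Metric.ball x₀ R) φ < ∞) :
    Integrable fun z : Rn N × Rn N => Z z * ((φ z.1 - φ z.2) * kern s₁ (z.1 - z.2)) := by
  have h1 := gagInt_univ_lt_top (d := R - ρ) hs₁ one_pos (by linarith) hφ hB hzero
    (by simpa using hg)
  unfold gagInt at h1
  rw [univ_prod_univ, Measure.restrict_univ] at h1
  have hmeas : Measurable fun z : Rn N × Rn N => (φ z.1 - φ z.2) * kern s₁ (z.1 - z.2) := by
    fun_prop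
  refine integrable_of_lintegral_abs_lt_top (hu.Z_meas.mul hmeas.aestronglyMeasurable) ?_ h1
  filter_upwards [hu.Z_sgn] with z hz
  rw [abs_mul, abs_mul, abs_of_nonneg (kern_nonneg _ _), Real.rpow_one]
  have := sgnSet_abs_le hz
  have h2 : 0 ≤ |φ z.1 - φ z.2| * kern s₁ (z.1 - z.2) :=
    mul_nonneg (abs_nonneg _) (kern_nonneg _ _)
  nlinarith

lemma NormSol.integrable_flux (hu : NormSol s₁ sp p x₀ R lam u Z) (hp : 1 < p) (hp2 : p ≤ 2)
    (hsp : 0 < sp) {φ : Rn N → ℝ} {B ρ : ℝ} (hφ : Measurable φ) (hρ0 : 0 < ρ) (hρ : ρ < R)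
    (hB : ∀ x, |φ x| ≤ B)
    (hzero : ∀ x ∉ Metric.closedBall x₀ ρ, φ x = 0)
    (hg : gagInt (sp * p) p (Metric.ball x₀ R) φ < ∞) :
    Integrable fun z : Rn N × Rn N =>
      oddPow p (u z.1 - u z.2) * (φ z.1 - φ z.2) * kern (sp * p) (z.1 - z.2) := by
  have hmu := hu.meas
  have hmeas : Measurable fun z : Rn N × Rn N =>
    oddPow p (u z.1 - u z.2) * (φ z.1 - φ z.2) * kern (sp * p) (z.1 - z.2) := by fun_prop
  refine integrable_of_lintegral_abs_lt_top hmeas.aestronglyMeasurable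
    (Filter.Eventually.of_forall fun z => le_rfl) ?_
  rw [lintegral_eq_add_compl_ball (x₀ := x₀) (R := R)]
  refine ENNReal.add_lt_top.2 ⟨?_, ?_⟩
  · refine lt_of_le_of_lt ?_ (ENNReal.add_lt_top.2 ⟨hu.gag_p, hg⟩)
    unfold gagInt
    rw [← lintegral_add_left (by fun_prop)]
    refine lintegral_mono fun z => ?_
    rw [← ENNReal.ofReal_add (mul_nonneg (by positivity) (kern_nonneg _ _))
      (mul_nonneg (by positivity) (kern_nonneg _ _))]
    refine ENNReal.ofReal_le_ofReal ?_
    rw [abs_mul, abs_mul, abs_oddPow hp, abs_of_nonneg (kern_nonneg _ _), ← add_mul]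
    refine mul_le_mul_of_nonneg_right ?_ (kern_nonneg _ _)
    set s := |u z.1 - u z.2|
    set t := |φ z.1 - φ z.2|
    have hs : 0 ≤ s := abs_nonneg _
    have ht : 0 ≤ t := abs_nonneg _
    -- Young's inequality in the crude form s^{p−1} t ≤ s^p + t^p, by comparing s and t.
    rcases le_total s t with h | h
    · calc s ^ (p - 1) * t ≤ t ^ (p - 1) * t := by gcongr
        _ = t ^ p := rpow_pred_mul ht (by linarith)
        _ ≤ _ := le_add_of_nonneg_left (by positivity)
    · calc s ^ (p - 1) * t ≤ s ^ (p - 1) * s := by gcongr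
        _ = s ^ p := rpow_pred_mul hs (by linarith)
        _ ≤ _ := le_add_of_nonneg_right (by positivity)
  · obtain ⟨f, hf, H⟩ := exists_polyBound_flux_tail N hp hp2 hsp
    have hB0 : 0 ≤ B := (abs_nonneg _).trans (hB x₀)
    have hd0 : 0 < R - ρ := by linarith
    have hdI : R - ρ ∈ Ioo (0 : ℝ) 1 := ⟨hd0, by linarith [hu.R_lt]⟩
    -- Far from the diagonal the flux is controlled by the tail bound with zero shift and the margin
    -- R − ρ as distance.
    have key := lintegral_compl_ball_le (x₀ := x₀) (ρ := ρ) (d := R - ρ)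
      (F := fun z => ENNReal.ofReal
        |oddPow p (u z.1 - u z.2) * (φ z.1 - φ z.2) * kern (sp * p) (z.1 - z.2)|)
      (c := fun _ => ENNReal.ofReal B * f (R - ρ))
      (G := fun x y => ENNReal.ofReal B *
        ENNReal.ofReal (|oddPow p (u (x + 0) - u (y + 0))| * kern (sp * p) (x - y)))
      hd0 (by fun_prop) ?_ ?_ ?_ ?_
    · rw [add_sub_cancel] at key
      refine key.trans_lt ?_
      rw [setLIntegral_const]
      have h2 : volume (Metric.closedBall x₀ ρ) < ∞ := measure_closedBall_lt_top
      have h3 := hf.ne_top hdI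
      finiteness
    · intro x y
      simp only
      rw [kern_sub_comm, ← neg_sub (u y), oddPow_neg, ← neg_sub (φ y), neg_mul_neg]
    · intro x y hx hy
      simp [hzero x hx, hzero y hy]
    · intro x hx y hy
      rw [← ENNReal.ofReal_mul hB0]
      refine ENNReal.ofReal_le_ofReal ?_
      simp only [add_zero]
      rw [abs_mul, abs_mul, abs_of_nonneg (kern_nonneg _ _), hzero y hy, sub_zero, mul_comm _ |φ x|,
        mul_assoc]
      have := kern_nonneg (sp * p) (x - y)
      gcongr
      exact hB x
    · intro x hx
      rw [lintegral_const_mul' _ _ (by finiteness)]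
      have hxB : x ∈ Metric.ball x₀ R := Metric.closedBall_subset_ball hρ hx
      gcongr
      exact H s₁ x₀ R lam u Z hu (R - ρ) hd0 (by linarith) x hxB 0 (by simpa using hd0.le)
        (by simpa using hxB)

end integrability

/-- Converts a pointwise inequality between energy, equation and error into an integral one without
knowing beforehand that the energy is finite. If the error is not integrable, the claim is trivial.
-/
lemma lintegral_le_of_integral_eq_zero {X : Type*} [MeasurableSpace X] {μ : Measure X}
    {F e H : X → ℝ} (hF : Integrable F μ) (hF0 : ∫ x, F x ∂μ = 0) (hH : AEStronglyMeasurable H μ)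
    (hH0 : ∀ x, 0 ≤ H x) (he0 : ∀ x, 0 ≤ e x) (h : ∀ᵐ x ∂μ, e x ≤ F x + H x) :
    ∫⁻ x, ENNReal.ofReal (e x) ∂μ ≤ ∫⁻ x, ENNReal.ofReal (H x) ∂μ := by
  by_cases hfin : ∫⁻ x, ENNReal.ofReal (H x) ∂μ = ∞
  · rw [hfin]; exact le_top
  have hHi : Integrable H μ := by
    refine integrable_of_lintegral_abs_lt_top hH (Filter.Eventually.of_forall fun x => ?_)
      (lt_top_iff_ne_top.2 hfin)
    rw [abs_of_nonneg (hH0 x)]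
  calc ∫⁻ x, ENNReal.ofReal (e x) ∂μ ≤ ∫⁻ x, ENNReal.ofReal (F x + H x) ∂μ := by
        refine lintegral_mono_ae ?_
        filter_upwards [h] with x hx using ENNReal.ofReal_le_ofReal hx
    _ = ENNReal.ofReal (∫ x, (F x + H x) ∂μ) := by
        rw [← ofReal_integral_eq_lintegral_ofReal (f := fun x => F x + H x) (hF.add hHi)]
        filter_upwards [h] with x hx using (he0 x).trans hx
    _ = ENNReal.ofReal (∫ x, H x ∂μ) := by rw [integral_add hF hHi, hF0, zero_add]
    _ = _ := by
        rw [← ofReal_integral_eq_lintegral_ofReal hHi (Filter.Eventually.of_forall hH0)]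

/-! ### Cutoffs, differences and the test function -/

/-- The radial Lipschitz cutoff, equal to `1` on `B_ρ(x₀)` and to `0` off `B_{ρ + d}(x₀)`. -/
def cutoff (x₀ : Rn N) (ρ d : ℝ) (x : Rn N) : ℝ := max 0 (min 1 ((ρ + d - ‖x - x₀‖) / d))

@[fun_prop]
lemma measurable_cutoff (x₀ : Rn N) (ρ d : ℝ) : Measurable (cutoff x₀ ρ d) := by
  unfold cutoff; fun_prop

lemma cutoff_nonneg (x₀ : Rn N) (ρ d : ℝ) (x : Rn N) : 0 ≤ cutoff x₀ ρ d x := le_max_left _ _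

lemma cutoff_le_one (x₀ : Rn N) (ρ d : ℝ) (x : Rn N) : cutoff x₀ ρ d x ≤ 1 :=
  max_le zero_le_one (min_le_left _ _)

lemma cutoff_eq_one {x₀ : Rn N} {ρ d : ℝ} (hd : 0 < d) {x : Rn N} (hx : x ∈ Metric.ball x₀ ρ) :
    cutoff x₀ ρ d x = 1 := by
  rw [Metric.mem_ball, dist_eq_norm] at hx
  have : 1 ≤ (ρ + d - ‖x - x₀‖) / d := by rw [le_div_iff₀ hd]; linarith
  rw [cutoff, min_eq_left this, max_eq_right zero_le_one]

lemma cutoff_eq_zero {x₀ : Rn N} {ρ d : ℝ} (hd : 0 < d) {x : Rn N}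
    (hx : x ∉ Metric.closedBall x₀ (ρ + d)) : cutoff x₀ ρ d x = 0 := by
  rw [Metric.mem_closedBall, dist_eq_norm, not_le] at hx
  have : (ρ + d - ‖x - x₀‖) / d ≤ 0 := div_nonpos_of_nonpos_of_nonneg (by linarith) hd.le
  rw [cutoff, max_eq_left ((min_le_right _ _).trans this)]

lemma abs_cutoff_sub_le {x₀ : Rn N} {ρ d : ℝ} (hd : 0 < d) (x y : Rn N) :
    |cutoff x₀ ρ d x - cutoff x₀ ρ d y| ≤ ‖x - y‖ / d := by
  unfold cutoff
  refine (abs_max_sub_max_le_max _ _ _ _).trans (max_le ?_ ?_)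
  · simp; positivity
  refine (abs_min_sub_min_le_max _ _ _ _).trans (max_le ?_ ?_)
  · simp; positivity
  rw [← sub_div, abs_div, abs_of_pos hd]
  gcongr
  have : ρ + d - ‖x - x₀‖ - (ρ + d - ‖y - x₀‖) = ‖y - x₀‖ - ‖x - x₀‖ := by ring
  rw [this]
  refine (abs_norm_sub_norm_le _ _).trans (le_of_eq ?_)
  rw [sub_sub_sub_cancel_right, norm_sub_rev]

/-- The first difference `u(x + h) - u(x)`. -/
def diff (u : Rn N → ℝ) (h x : Rn N) : ℝ := u (x + h) - u x

@[fun_prop]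
lemma measurable_diff {u : Rn N → ℝ} (hu : Measurable u) (h : Rn N) : Measurable (diff u h) := by
  unfold diff; fun_prop

/-- The test function `η² |δ_h u|^{q-1} δ_h u`. -/
def testFun (x₀ : Rn N) (ρ d q : ℝ) (u : Rn N → ℝ) (h x : Rn N) : ℝ :=
  cutoff x₀ ρ d x ^ 2 * oddPow (q + 1) (diff u h x)

lemma measurable_testFun {x₀ : Rn N} {ρ d q : ℝ} {u : Rn N → ℝ} (hu : Measurable u) (h : Rn N) :
    Measurable (testFun x₀ ρ d q u h) := by
  unfold testFun
  have h1 : Measurable (diff u h) := measurable_diff hu h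
  have h2 : Measurable (oddPow (q + 1)) := measurable_oddPow _
  exact ((measurable_cutoff x₀ ρ d).pow_const 2).mul (h2.comp h1)

lemma add_mem_ball {x₀ x h : Rn N} {r s t : ℝ} (hx : x ∈ Metric.ball x₀ r) (hh : ‖h‖ ≤ s)
    (hrs : r + s ≤ t) : x + h ∈ Metric.ball x₀ t := by
  rw [Metric.mem_ball, dist_eq_norm] at *
  calc ‖x + h - x₀‖ = ‖(x - x₀) + h‖ := by congr 1; abel
    _ ≤ ‖x - x₀‖ + ‖h‖ := norm_add_le _ _
    _ < t := by linarith

instance : (volume : Measure (Rn N × Rn N)).IsAddHaarMeasure := by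
  rw [Measure.volume_eq_prod]; infer_instance

lemma lintegral_translate_prod (F : Rn N × Rn N → ℝ≥0∞) (h : Rn N) :
    ∫⁻ z, F (z + (h, h)) = ∫⁻ z, F z :=
  lintegral_add_right_eq_self (μ := (volume : Measure (Rn N × Rn N))) F (h, h)

lemma setLIntegral_translate_le {A B : Set (Rn N)} (hA : MeasurableSet A) (hB : MeasurableSet B)
    {h : Rn N} (hAB : ∀ x ∈ A, x + h ∈ B) (F : Rn N → ℝ≥0∞) :
    ∫⁻ x in A, F (x + h) ≤ ∫⁻ x in B, F x := by
  rw [← lintegral_indicator hA, ← lintegral_indicator hB,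
    ← lintegral_add_right_eq_self (B.indicator _) h]
  refine lintegral_mono fun x => ?_
  by_cases hx : x ∈ A
  · rw [indicator_of_mem hx, indicator_of_mem (hAB x hx)]
  · rw [indicator_of_notMem hx]; exact zero_le

lemma setLIntegral_translate_prod_le {A B : Set (Rn N)} (hA : MeasurableSet A)
    (hB : MeasurableSet B) {h : Rn N} (hAB : ∀ x ∈ A, x + h ∈ B) (F : Rn N × Rn N → ℝ≥0∞) :
    ∫⁻ z in A ×ˢ A, F (z + (h, h)) ≤ ∫⁻ z in B ×ˢ B, F z := by
  rw [← lintegral_indicator (hA.prod hA), ← lintegral_indicator (hB.prod hB),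
    ← lintegral_translate_prod ((B ×ˢ B).indicator _) h]
  refine lintegral_mono fun x => ?_
  by_cases hx : x ∈ A ×ˢ A
  · have : x + (h, h) ∈ B ×ˢ B := ⟨hAB _ hx.1, hAB _ hx.2⟩
    rw [indicator_of_mem hx, indicator_of_mem this]
  · rw [indicator_of_notMem hx]; exact zero_le

lemma gagInt_translate_le {α m : ℝ} {A B : Set (Rn N)} (hA : MeasurableSet A)
    (hB : MeasurableSet B) {h : Rn N} (hAB : ∀ x ∈ A, x + h ∈ B) (u : Rn N → ℝ) :
    gagInt α m A (fun x => u (x + h)) ≤ gagInt α m B u := by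
  have := setLIntegral_translate_prod_le hA hB hAB
    fun z => ENNReal.ofReal (|u z.1 - u z.2| ^ m * kern α (z.1 - z.2))
  simpa [gagInt] using this

lemma gagInt_mono {α m : ℝ} {A B : Set (Rn N)} (h : A ⊆ B) (u : Rn N → ℝ) :
    gagInt α m A u ≤ gagInt α m B u :=
  lintegral_mono_set (prod_mono h h)

/-- The Gagliardo integral of a Lipschitz-type bound. -/
lemma gagInt_lt_top_of_le (hN : 1 ≤ N) {α m L M r : ℝ} {x₀ : Rn N} {φ u v : Rn N → ℝ}
    (hm : 1 ≤ m) (hαm : α < m) (hL : 0 ≤ L) (hM : 0 ≤ M) (hu : Measurable u)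
    (hgu : gagInt α m (Metric.ball x₀ r) u < ∞) (hgv : gagInt α m (Metric.ball x₀ r) v < ∞)
    (h : ∀ x ∈ Metric.ball x₀ r, ∀ y ∈ Metric.ball x₀ r,
      |φ x - φ y| ≤ L * ‖x - y‖ + M * (|u x - u y| + |v x - v y|)) :
    gagInt α m (Metric.ball x₀ r) φ < ∞ := by
  have hm0 : 0 < m := by linarith
  set B := Metric.ball x₀ r with hBdef
  have hB : MeasurableSet B := Metric.isOpen_ball.measurableSet
  set c : ℝ := 2 ^ m * (L ^ m + M ^ m * 2 ^ m) with hc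
  have hc0 : 0 ≤ c := by positivity
  have hk : ∫⁻ z in B ×ˢ B, ENNReal.ofReal (kern (α - m) (z.1 - z.2)) < ∞ := by
    rw [Measure.volume_eq_prod, ← Measure.prod_restrict, lintegral_prod _ (by fun_prop)]
    -- The Lipschitz part gains m orders at the diagonal, and α − m < 0 makes the remaining kernel
    -- integrable on balls.
    refine lt_of_le_of_lt (setLIntegral_mono' hB fun x hx => lintegral_kern_sub_ball_le hx) ?_
    rw [setLIntegral_const]
    have h1 := lintegral_kern_ball_lt_top (N := N) hN (α := α - m) (r := 2 * r) (by linarith)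
    have h2 : volume B < ∞ := measure_ball_lt_top
    finiteness
  have hfin : ENNReal.ofReal c * ((∫⁻ z in B ×ˢ B, ENNReal.ofReal (kern (α - m) (z.1 - z.2))) +
      (gagInt α m B u + gagInt α m B v)) < ∞ := by finiteness
  refine lt_of_le_of_lt ?_ hfin
  unfold gagInt
  rw [← lintegral_add_left (by fun_prop), ← lintegral_add_left (by fun_prop),
    ← lintegral_const_mul' _ _ (by finiteness)]
  refine setLIntegral_mono' (hB.prod hB) fun z hz => ?_
  have k0 := kern_nonneg α (z.1 - z.2)
  have k1 := kern_nonneg (α - m) (z.1 - z.2)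
  rw [← ENNReal.ofReal_add (mul_nonneg (by positivity) k0) (mul_nonneg (by positivity) k0),
    ← ENNReal.ofReal_add k1 (add_nonneg (mul_nonneg (by positivity) k0)
      (mul_nonneg (by positivity) k0)), ← ENNReal.ofReal_mul hc0]
  refine ENNReal.ofReal_le_ofReal ?_
  set s := |u z.1 - u z.2|
  set t := |v z.1 - v z.2|
  have hs : 0 ≤ s := abs_nonneg _
  have ht : 0 ≤ t := abs_nonneg _
  have hkk := norm_rpow_mul_kern_le (N := N) (α := α) hm0 (z.1 - z.2)
  set D := ‖z.1 - z.2‖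
  have hD : 0 ≤ D := norm_nonneg _
  have e1 : |φ z.1 - φ z.2| ^ m ≤ 2 ^ m * ((L * D) ^ m + (M * (s + t)) ^ m) :=
    (Real.rpow_le_rpow (abs_nonneg _) (h _ hz.1 _ hz.2) hm0.le).trans
      (add_rpow_le_mul hm0.le (by positivity) (by positivity))
  have e2 : (s + t) ^ m ≤ 2 ^ m * (s ^ m + t ^ m) := add_rpow_le_mul hm0.le hs ht
  rw [Real.mul_rpow hL hD, Real.mul_rpow hM (by positivity)] at e1
  have hLm : 0 ≤ L ^ m := by positivity
  have hMm : 0 ≤ M ^ m := by positivity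
  have h2m : (0 : ℝ) < 2 ^ m := by positivity
  have hsm : 0 ≤ s ^ m := by positivity
  have htm : 0 ≤ t ^ m := by positivity
  calc |φ z.1 - φ z.2| ^ m * kern α (z.1 - z.2)
      ≤ 2 ^ m * (L ^ m * D ^ m + M ^ m * (2 ^ m * (s ^ m + t ^ m))) * kern α (z.1 - z.2) := by
        gcongr
        refine e1.trans ?_
        gcongr
    _ = 2 ^ m * (L ^ m * (D ^ m * kern α (z.1 - z.2)) +
        M ^ m * 2 ^ m * (s ^ m * kern α (z.1 - z.2) + t ^ m * kern α (z.1 - z.2))) := by ring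
    _ ≤ 2 ^ m * (L ^ m * kern (α - m) (z.1 - z.2) +
        M ^ m * 2 ^ m * (s ^ m * kern α (z.1 - z.2) + t ^ m * kern α (z.1 - z.2))) := by gcongr
    _ ≤ 2 ^ m * ((L ^ m + M ^ m * 2 ^ m) * kern (α - m) (z.1 - z.2) +
        (L ^ m + M ^ m * 2 ^ m) *
          (s ^ m * kern α (z.1 - z.2) + t ^ m * kern α (z.1 - z.2))) := by
        gcongr
        · exact le_add_of_nonneg_right (by positivity)
        · exact le_add_of_nonneg_left (by positivity)
    _ = _ := by rw [hc]; ring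

section testFun

variable {s₁ sp p : ℝ} {x₀ : Rn N} {R lam : ℝ} {u : Rn N → ℝ} {Z : Rn N × Rn N → ℝ}

lemma NormSol.abs_diff_le (hu : NormSol s₁ sp p x₀ R lam u Z) {x h : Rn N}
    (hx : x ∈ Metric.ball x₀ R) (hxh : x + h ∈ Metric.ball x₀ R) : |diff u h x| ≤ 2 :=
  (abs_sub _ _).trans (by linarith [hu.bdd _ hx, hu.bdd _ hxh])

lemma testFun_eq_zero {ρ d q : ℝ} (hd : 0 < d) {h x : Rn N}
    (hx : x ∉ Metric.closedBall x₀ (ρ + d)) : testFun x₀ ρ d q u h x = 0 := by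
  simp [testFun, cutoff_eq_zero hd hx]

lemma abs_testFun_le {ρ d q : ℝ} (hq : 1 ≤ q) (h x : Rn N) :
    |testFun x₀ ρ d q u h x| ≤ |diff u h x| ^ q := by
  rw [testFun, abs_mul, abs_oddPow (by linarith), add_sub_cancel_right,
    abs_of_nonneg (by positivity)]
  have h1 := cutoff_nonneg x₀ ρ d x
  have h2 := cutoff_le_one x₀ ρ d x
  have h3 : cutoff x₀ ρ d x ^ 2 ≤ 1 := pow_le_one₀ h1 h2
  exact mul_le_of_le_one_left (by positivity) h3

lemma NormSol.abs_testFun_le_two (hu : NormSol s₁ sp p x₀ R lam u Z) {ρ d q : ℝ} (hq : 1 ≤ q)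
    (hd : 0 < d) (hρ : ρ + 4 * d ≤ R) {h : Rn N} (hh : ‖h‖ ≤ d) (x : Rn N) :
    |testFun x₀ ρ d q u h x| ≤ 2 ^ q := by
  by_cases hx : x ∈ Metric.closedBall x₀ (ρ + d)
  · have hx' : x ∈ Metric.ball x₀ (ρ + 2 * d) :=
      Metric.closedBall_subset_ball (by linarith) hx
    refine (abs_testFun_le hq h x).trans ?_
    exact Real.rpow_le_rpow (abs_nonneg _)
      (hu.abs_diff_le (Metric.ball_subset_ball (by linarith) hx')
        (add_mem_ball hx' hh (by linarith))) (by linarith)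
  · rw [testFun_eq_zero hd hx, abs_zero]; positivity

/-- On the ball the test function varies at most like a Lipschitz function plus a multiple of the
variations of u and of its translate. Indeed, the cutoff is Lipschitz and the odd power is Lipschitz
on [−2, 2]. Outside, compact support takes over. -/
lemma NormSol.gagInt_testFun_lt_top (hu : NormSol s₁ sp p x₀ R lam u Z) (hN : 1 ≤ N)
    {ρ d q α m : ℝ} (hq : 1 ≤ q)
    (hα : 0 < α) (hm : 1 ≤ m) (hαm : α < m) (hg : gagInt α m (Metric.ball x₀ R) u < ∞)
    (hd : 0 < d) (hρ : ρ + 4 * d ≤ R) {h : Rn N} (hh : ‖h‖ ≤ d) :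
    gagInt α m univ (testFun x₀ ρ d q u h) < ∞ := by
  have hmu := hu.meas
  refine gagInt_univ_lt_top (ρ := ρ + d) (d := d) (B := 2 ^ q) hα (by linarith) hd
    (measurable_testFun hu.meas h) (hu.abs_testFun_le_two hq hd hρ hh)
    (fun x hx => testFun_eq_zero hd hx) ?_
  have hsub : Metric.ball x₀ (ρ + d + d) ⊆ Metric.ball x₀ R :=
    Metric.ball_subset_ball (by linarith)
  have hadd : ∀ x ∈ Metric.ball x₀ (ρ + d + d), x + h ∈ Metric.ball x₀ R := fun x hx =>
    add_mem_ball hx hh (by linarith)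
  refine gagInt_lt_top_of_le (u := fun x => u (x + h)) (v := u) (L := 2 * 2 ^ q / d)
    (M := 2 * q * 4 ^ (q - 1)) hN hm hαm (by positivity) (by positivity) (by fun_prop) ?_ ?_ ?_
  · exact (gagInt_translate_le Metric.isOpen_ball.measurableSet Metric.isOpen_ball.measurableSet
      hadd u).trans_lt hg
  · exact (gagInt_mono hsub u).trans_lt hg
  · intro x hx y hy
    have hwx := hu.abs_diff_le (hsub hx) (hadd x hx)
    have hwy := hu.abs_diff_le (hsub hy) (hadd y hy)
    have hη := abs_cutoff_sub_le (x₀ := x₀) (ρ := ρ) hd x y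
    have a1 := cutoff_nonneg x₀ ρ d x
    have a2 := cutoff_le_one x₀ ρ d x
    have b1 := cutoff_nonneg x₀ ρ d y
    have b2 := cutoff_le_one x₀ ρ d y
    unfold testFun
    set a := cutoff x₀ ρ d x
    set b := cutoff x₀ ρ d y
    set w := diff u h x
    set v := diff u h y
    have e1 : a ^ 2 * oddPow (q + 1) w - b ^ 2 * oddPow (q + 1) v =
      (a - b) * (a + b) * oddPow (q + 1) w + b ^ 2 * (oddPow (q + 1) w - oddPow (q + 1) v) := by
      ring
    have e2 : |oddPow (q + 1) w| ≤ 2 ^ q := by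
      rw [abs_oddPow (by linarith), add_sub_cancel_right]
      exact Real.rpow_le_rpow (abs_nonneg _) hwx (by linarith)
    have e3 : |w - v| ≤ |u (x + h) - u (y + h)| + |u x - u y| := by
      have : w - v = (u (x + h) - u (y + h)) - (u x - u y) := by simp only [w, v, diff]; ring
      rw [this]; exact abs_sub _ _
    have e4 : |oddPow (q + 1) w - oddPow (q + 1) v| ≤ 2 * q * 4 ^ (q - 1) * |w - v| := by
      refine (oddPow_upper_sub_of_one_le hq w v).trans ?_
      gcongr
      linarith
    have e5 : b ^ 2 ≤ 1 := pow_le_one₀ b1 b2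
    rw [e1]
    refine (abs_add_le _ _).trans (add_le_add ?_ ?_)
    · rw [abs_mul, abs_mul, abs_of_nonneg (add_nonneg a1 b1)]
      calc |a - b| * (a + b) * |oddPow (q + 1) w| ≤ ‖x - y‖ / d * 2 * 2 ^ q := by
            gcongr; linarith
        _ = _ := by ring
    · rw [abs_mul, abs_of_nonneg (by positivity)]
      calc b ^ 2 * |oddPow (q + 1) w - oddPow (q + 1) v| ≤
            1 * (2 * q * 4 ^ (q - 1) * |w - v|) := by gcongr
        _ ≤ _ := by rw [one_mul]; gcongr

end testFun

/-! ### The differenced equation and the Caccioppoli inequality -/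

section
variable {s₁ sp p : ℝ} {x₀ : Rn N} {R lam : ℝ} {u : Rn N → ℝ} {Z : Rn N × Rn N → ℝ}

/-- The weak formulation for the difference of the equations of `u(· + h)` and `u`. -/
lemma NormSol.diff_eqn (hu : NormSol s₁ sp p x₀ R lam u Z) (hN : 1 ≤ N) (hs₁ : s₁ ∈ Ioo (0 : ℝ) 1)
    (hp : 1 < p) (hp2 : p ≤ 2) (hsp : sp ∈ Ioo (0 : ℝ) 1) {ρ d q : ℝ} (hq : 1 ≤ q) (hd : 0 < d)
    (hρ0 : 0 < ρ) (hρ : ρ + 4 * d ≤ R) {h : Rn N} (hh : ‖h‖ ≤ d) :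
    let F : Rn N × Rn N → ℝ := fun z =>
      lam * ((Z (z + (h, h)) - Z z) *
        ((testFun x₀ ρ d q u h z.1 - testFun x₀ ρ d q u h z.2) * kern s₁ (z.1 - z.2))) +
      (oddPow p (u (z.1 + h) - u (z.2 + h)) - oddPow p (u z.1 - u z.2)) *
        (testFun x₀ ρ d q u h z.1 - testFun x₀ ρ d q u h z.2) * kern (sp * p) (z.1 - z.2)
    Integrable F ∧ ∫ z, F z = 0 := by
  have hα : 0 < sp * p := mul_pos hsp.1 (by linarith)
  set ψ := testFun x₀ ρ d q u h with hψ
  have hψm : Measurable ψ := measurable_testFun hu.meas h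
  have hψB : ∀ x, |ψ x| ≤ 2 ^ q := hu.abs_testFun_le_two hq hd hρ hh
  have hψ0 : ∀ x ∉ Metric.closedBall x₀ (ρ + d), ψ x = 0 := fun x hx => testFun_eq_zero hd hx
  have hψ1 : gagInt s₁ 1 univ ψ < ∞ :=
    hu.gagInt_testFun_lt_top hN hq hs₁.1 le_rfl hs₁.2 hu.gag_one hd hρ hh
  have hψp : gagInt (sp * p) p univ ψ < ∞ :=
    hu.gagInt_testFun_lt_top hN hq hα hp.le (by nlinarith [hsp.2]) hu.gag_p hd hρ hh
  -- Testing with the back-translate of ψ and changing variables yields the equation of u(·+h)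
  -- tested with ψ. The margin of 4d keeps the supports of both test functions strictly inside the
  -- ball of radius R.
  set φ : Rn N → ℝ := fun x => ψ (x - h) with hφ
  have hφm : Measurable φ := by fun_prop
  have hφ0 : ∀ x ∉ Metric.closedBall x₀ (ρ + 2 * d), φ x = 0 := by
    intro x hx
    refine hψ0 _ fun hx' => hx ?_
    rw [Metric.mem_closedBall, dist_eq_norm] at *
    calc ‖x - x₀‖ = ‖(x - h - x₀) + h‖ := by congr 1; abel
      _ ≤ ‖x - h - x₀‖ + ‖h‖ := norm_add_le _ _
      _ ≤ _ := by linarith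
  have hφg : ∀ α m : ℝ, gagInt α m univ ψ < ∞ → gagInt α m (Metric.ball x₀ R) φ < ∞ := by
    intro α m hfin
    refine lt_of_le_of_lt ?_ hfin
    have := gagInt_translate_le (α := α) (m := m) (A := Metric.ball x₀ R) (B := univ) (h := -h)
      Metric.isOpen_ball.measurableSet MeasurableSet.univ (fun _ _ => mem_univ _) ψ
    simpa [hφ, sub_eq_add_neg] using this
  have hψg : ∀ α m : ℝ, gagInt α m univ ψ < ∞ → gagInt α m (Metric.ball x₀ R) ψ < ∞ :=
    fun α m hfin => (gagInt_mono (subset_univ _) _).trans_lt hfin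
  have E1 := hu.eqn ψ (ρ + d) (2 ^ q) hψm (by linarith) hψB hψ0 (hψg _ _ hψ1) (hψg _ _ hψp)
  have E2 := hu.eqn φ (ρ + 2 * d) (2 ^ q) hφm (by linarith) (fun x => hψB _) hφ0
    (hφg _ _ hψ1) (hφg _ _ hψp)
  have I1 := hu.integrable_sign hs₁.1 hψm (by linarith) hψB hψ0 (hψg _ _ hψ1)
  have I1' := hu.integrable_flux hp hp2 hsp.1 hψm (by linarith) (by linarith) hψB hψ0 (hψg _ _ hψp)
  have I2 := hu.integrable_sign hs₁.1 hφm (by linarith) (fun x => hψB _) hφ0 (hφg _ _ hψ1)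
  have I2' := hu.integrable_flux hp hp2 hsp.1 hφm (by linarith) (by linarith) (fun x => hψB _) hφ0
    (hφg _ _ hψp)
  have I2s := I2.comp_add_right (h, h)
  have I2s' := I2'.comp_add_right (h, h)
  -- The diagonal translation by (h, h) leaves the kernels unchanged, since they depend on x − y
  -- only.
  rw [← integral_add_right_eq_self _ (h, h),
    ← integral_add_right_eq_self (fun z : Rn N × Rn N => oddPow p (u z.1 - u z.2) *
      (φ z.1 - φ z.2) * kern (sp * p) (z.1 - z.2)) (h, h)] at E2
  have key : ∀ z : Rn N × Rn N,
      lam * ((Z (z + (h, h)) - Z z) * ((ψ z.1 - ψ z.2) * kern s₁ (z.1 - z.2))) +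
      (oddPow p (u (z.1 + h) - u (z.2 + h)) - oddPow p (u z.1 - u z.2)) *
        (ψ z.1 - ψ z.2) * kern (sp * p) (z.1 - z.2) =
      (lam * (Z (z + (h, h)) * ((φ (z + (h, h)).1 - φ (z + (h, h)).2) *
        kern s₁ ((z + (h, h)).1 - (z + (h, h)).2))) +
        oddPow p (u (z + (h, h)).1 - u (z + (h, h)).2) * (φ (z + (h, h)).1 - φ (z + (h, h)).2) *
          kern (sp * p) ((z + (h, h)).1 - (z + (h, h)).2)) -
      (lam * (Z z * ((ψ z.1 - ψ z.2) * kern s₁ (z.1 - z.2))) +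
        oddPow p (u z.1 - u z.2) * (ψ z.1 - ψ z.2) * kern (sp * p) (z.1 - z.2)) := by
    intro z
    simp only [hφ, Prod.fst_add, Prod.snd_add, add_sub_cancel_right, add_sub_add_right_eq_sub]
    ring
  simp only [key]
  refine ⟨((I2s.const_mul lam).add I2s').sub ((I1.const_mul lam).add I1'), ?_⟩
  refine (integral_sub ((I2s.const_mul lam).add I2s') ((I1.const_mul lam).add I1')).trans ?_
  rw [integral_add' (I2s.const_mul lam) I2s', integral_add' (I1.const_mul lam) I1',
    integral_const_mul, integral_const_mul, ← E1, ← E2, sub_zero]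

end

lemma ae_translate_prod {P : Rn N × Rn N → Prop} (hP : ∀ᵐ z, P z) (h : Rn N) :
    ∀ᵐ z, P (z + (h, h)) :=
  (measurePreserving_add_right volume (h, h)).quasiMeasurePreserving.ae hP

/-- Caccioppoli inequality for the first differences of a normalised solution. -/
lemma exists_polyBound_caccioppoli (hN : 2 ≤ N) {p q s₁ sp : ℝ} (hp : 1 < p) (hp2 : p < 2)
    (hs₁ : s₁ ∈ Ioo (0 : ℝ) 1) (hsp : sp ∈ Ioo (0 : ℝ) 1) (hq : 1 ≤ q) :
    ∃ f, PolyBound f ∧ ∀ (x₀ : Rn N) (R lam : ℝ) (u : Rn N → ℝ) (Z : Rn N × Rn N → ℝ),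
      NormSol s₁ sp p x₀ R lam u Z → ∀ ρ d : ℝ, 0 < d → 0 < ρ → ρ + 4 * d ≤ R →
      ∀ h : Rn N, ‖h‖ ≤ d →
      ∫⁻ z in Metric.ball x₀ ρ ×ˢ Metric.ball x₀ ρ, ENNReal.ofReal
        ((|u (z.1 + h) - u (z.2 + h)| + |u z.1 - u z.2|) ^ (p - 2) *
          |diff u h z.1 - diff u h z.2| ^ (q + 1) * kern (sp * p) (z.1 - z.2)) ≤
      f d * ∫⁻ x in Metric.ball x₀ (ρ + 2 * d), ENNReal.ofReal (|diff u h x| ^ q) := by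
  have hN1 : 1 ≤ N := by omega
  have hα : 0 < sp * p := mul_pos hsp.1 (by linarith)
  obtain ⟨c, C, hc, hC, hflux⟩ := exists_flux_localised_lower hp hp2.le hq
  obtain ⟨k₁, hk₁, K₁⟩ := exists_polyBound_lintegral_kern_compl (N := N) hs₁.1
  obtain ⟨ft, hft, HT⟩ := exists_polyBound_flux_tail N hp hp2.le hsp.1
  set M₁ := ∫⁻ z in Metric.ball (0 : Rn N) 2, ENNReal.ofReal (kern (s₁ - 1) z) with hM₁
  set M₂ := ∫⁻ z in Metric.ball (0 : Rn N) 2, ENNReal.ofReal (kern (sp * p - p) z) with hM₂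
  have hM₁f : M₁ < ∞ := lintegral_kern_ball_lt_top hN1 (by linarith [hs₁.2])
  have hM₂f : M₂ < ∞ := lintegral_kern_ball_lt_top hN1 (by nlinarith [hsp.2])
  refine ⟨fun d => ENNReal.ofReal c⁻¹ * (2 *
    ((ENNReal.ofReal 2 * ENNReal.ofReal (d ^ (-1 : ℝ)) * M₁ +
    ENNReal.ofReal C * ENNReal.ofReal (d ^ (-p)) * M₂) + (2 * k₁ d + (ft d + ft d)))), ?_, ?_⟩
  · exact (PolyBound.const (by simp)).mul ((PolyBound.const (by simp)).mul
      (((((PolyBound.const (by simp)).mul (PolyBound.pow _)).mul (PolyBound.const hM₁f.ne)).add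
        (((PolyBound.const (by simp)).mul (PolyBound.pow _)).mul (PolyBound.const hM₂f.ne))).add
        (((PolyBound.const (by simp)).mul hk₁).add (hft.add hft))))
  intro x₀ R lam u Z hu ρ d hd hρ0 hρ h hh
  have hmu := hu.meas
  have hR1 := hu.R_lt
  have hdI : d ∈ Ioo (0 : ℝ) 1 := ⟨hd, by linarith⟩
  obtain ⟨hFi, hF0⟩ := hu.diff_eqn hN1 hs₁ hp hp2.le hsp hq hd hρ0 hρ hh
  set ψ := testFun x₀ ρ d q u h with hψ
  have hψm : Measurable ψ := measurable_testFun hu.meas h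
  set w := diff u h with hw
  have hwm : Measurable w := measurable_diff hu.meas h
  have hψ0 : ∀ x ∉ Metric.closedBall x₀ (ρ + d), ψ x = 0 := fun x hx => testFun_eq_zero hd hx
  set B := Metric.ball x₀ ρ with hB
  set U := Metric.ball x₀ (ρ + d + d) with hU
  have hBm : MeasurableSet B := Metric.isOpen_ball.measurableSet
  have hUm : MeasurableSet U := Metric.isOpen_ball.measurableSet
  have hBU : B ⊆ U := Metric.ball_subset_ball (by linarith)
  have hUR : U ⊆ Metric.ball x₀ R := Metric.ball_subset_ball (by linarith)
  have hUh : ∀ x ∈ U, x + h ∈ Metric.ball x₀ R := fun x hx => add_mem_ball hx hh (by linarith)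
  set e : Rn N × Rn N → ℝ := (B ×ˢ B).indicator fun z => c *
    ((|u (z.1 + h) - u (z.2 + h)| + |u z.1 - u z.2|) ^ (p - 2) *
          |w z.1 - w z.2| ^ (q + 1) * kern (sp * p) (z.1 - z.2)) with he
  -- The Lipschitz bound |x − y|/d of the cutoff enters to the power 1 in the sign error and p in
  -- the flux error. It lowers the kernel orders to s₁ − 1 and s_p p − p, both negative, so this
  -- error kernel is locally integrable.
  set κ : Rn N → ℝ := fun z => 2 * d ^ (-1 : ℝ) * kern (s₁ - 1) z +
    C * d ^ (-p) * kern (sp * p - p) z with hκ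
  have hκ0 : ∀ z, 0 ≤ κ z := fun z => add_nonneg (mul_nonneg (by positivity) (kern_nonneg _ _))
    (mul_nonneg (by positivity) (kern_nonneg _ _))
  have hκm : Measurable κ := by fun_prop
  -- Two error densities: near the support the pointwise inequalities apply, because both
  -- differences are bounded by 2. Farther away nothing cancels, and the fluxes at u and at its
  -- translate are estimated separately by their absolute values.
  set Hin : Rn N × Rn N → ℝ := fun z => (|w z.1| ^ q + |w z.2| ^ q) * κ (z.1 - z.2) with hHin
  set Hoff : Rn N × Rn N → ℝ := fun z => |ψ z.1 - ψ z.2| * (2 * kern s₁ (z.1 - z.2) +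
    (|oddPow p (u (z.1 + h) - u (z.2 + h))| * kern (sp * p) (z.1 - z.2) +
      |oddPow p (u (z.1 + 0) - u (z.2 + 0))| * kern (sp * p) (z.1 - z.2))) with hHoff
  have hHinm : Measurable Hin := by fun_prop
  have hHoffm : Measurable Hoff := by fun_prop
  have hHin0 : ∀ z, 0 ≤ Hin z := fun z => mul_nonneg (by positivity) (hκ0 _)
  have hHoff0 : ∀ z, 0 ≤ Hoff z := fun z => mul_nonneg (abs_nonneg _)
    (add_nonneg (mul_nonneg (by norm_num) (kern_nonneg _ _))
      (add_nonneg (mul_nonneg (abs_nonneg _) (kern_nonneg _ _))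
        (mul_nonneg (abs_nonneg _) (kern_nonneg _ _))))
  set H : Rn N × Rn N → ℝ := fun z => (U ×ˢ U).indicator Hin z + (U ×ˢ U)ᶜ.indicator Hoff z with hH
  have hHm : Measurable H :=
    (hHinm.indicator (hUm.prod hUm)).add (hHoffm.indicator (hUm.prod hUm).compl)
  have hH0 : ∀ z, 0 ≤ H z := fun z =>
    add_nonneg (indicator_nonneg (fun z _ => hHin0 z) z) (indicator_nonneg (fun z _ => hHoff0 z) z)
  have he0 : ∀ z, 0 ≤ e z := fun z => indicator_nonneg (fun z _ => mul_nonneg hc.le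
    (mul_nonneg (by positivity) (kern_nonneg _ _))) z
  have hpt : ∀ᵐ z : Rn N × Rn N, e z ≤ (lam * ((Z (z + (h, h)) - Z z) *
        ((ψ z.1 - ψ z.2) * kern s₁ (z.1 - z.2))) +
      (oddPow p (u (z.1 + h) - u (z.2 + h)) - oddPow p (u z.1 - u z.2)) *
        (ψ z.1 - ψ z.2) * kern (sp * p) (z.1 - z.2)) + H z := by
    filter_upwards [hu.Z_sgn, ae_translate_prod hu.Z_sgn h] with z hz hzh
    simp only [Prod.fst_add, Prod.snd_add] at hzh
    have k1 := kern_nonneg s₁ (z.1 - z.2)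
    have kp := kern_nonneg (sp * p) (z.1 - z.2)
    by_cases hzU : z ∈ U ×ˢ U
    · have hHz : H z = Hin z := by
        simp only [hH, indicator_of_mem hzU]
        rw [indicator_of_notMem (by simpa using hzU), add_zero]
      rw [hHz]
      have hab : (u (z.1 + h) - u (z.2 + h)) - (u z.1 - u z.2) = w z.1 - w z.2 := by
        simp only [hw, diff]; ring
      set η₁ := cutoff x₀ ρ d z.1
      set η₂ := cutoff x₀ ρ d z.2
      have hη := abs_cutoff_sub_le (x₀ := x₀) (ρ := ρ) hd z.1 z.2
      have h1 := sign_localised_lower hq hzh hz hab (cutoff_nonneg x₀ ρ d z.1)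
        (cutoff_le_one x₀ ρ d z.1) (cutoff_nonneg x₀ ρ d z.2) (cutoff_le_one x₀ ρ d z.2) hη
      have h2 := hflux _ _ _ _ _ _ _ hab (hu.abs_diff_le (hUR hzU.1) (hUh _ hzU.1))
        (hu.abs_diff_le (hUR hzU.2) (hUh _ hzU.2)) (cutoff_nonneg x₀ ρ d z.1)
        (cutoff_le_one x₀ ρ d z.1) (cutoff_nonneg x₀ ρ d z.2) (cutoff_le_one x₀ ρ d z.2) hη
      set Γ := |w z.1| ^ q + |w z.2| ^ q with hΓ
      have hΓ0 : 0 ≤ Γ := by positivity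
      have hψ1 : η₁ ^ 2 * oddPow (q + 1) (w z.1) = ψ z.1 := rfl
      have hψ2 : η₂ ^ 2 * oddPow (q + 1) (w z.2) = ψ z.2 := rfl
      rw [hψ1, hψ2] at h1 h2
      set X := (|u (z.1 + h) - u (z.2 + h)| + |u z.1 - u z.2|) ^ (p - 2) *
        |w z.1 - w z.2| ^ (q + 1) with hX
      rw [hab] at h2
      have hX0 : 0 ≤ X := by positivity
      have h3 : e z ≤ c * (η₁ ^ 2 + η₂ ^ 2) * X * kern (sp * p) (z.1 - z.2) := by
        by_cases hzB : z ∈ B ×ˢ B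
        · rw [he, indicator_of_mem hzB]
          have e1 : η₁ = 1 := cutoff_eq_one hd hzB.1
          have e2 : η₂ = 1 := cutoff_eq_one hd hzB.2
          rw [e1, e2]
          have : 0 ≤ c * (X * kern (sp * p) (z.1 - z.2)) :=
            mul_nonneg hc.le (mul_nonneg hX0 kp)
          norm_num
          linarith
        · rw [he, indicator_of_notMem hzB]
          have : 0 ≤ c * (η₁ ^ 2 + η₂ ^ 2) * X := by positivity
          exact mul_nonneg this kp
      have h4 := mul_le_mul_of_nonneg_right h2 kp
      have h5 := mul_le_mul_of_nonneg_right h1 k1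
      -- Only 0 ≤ λ ≤ 1 is needed: the sign term enters through a lower bound by a negative error,
      -- and multiplication by λ makes that error smaller.
      have h5' : -(2 * (‖z.1 - z.2‖ / d) * Γ * kern s₁ (z.1 - z.2)) ≤
          lam * ((Z (z + (h, h)) - Z z) * ((ψ z.1 - ψ z.2) * kern s₁ (z.1 - z.2))) := by
        have h6 : 0 ≤ 2 * (‖z.1 - z.2‖ / d) * Γ * kern s₁ (z.1 - z.2) := by positivity
        have h7 := mul_le_mul_of_nonneg_left h5 hu.lam_nonneg
        have h8 := mul_le_mul_of_nonneg_right hu.lam_le h6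
        linarith
      have h9 : 2 * (‖z.1 - z.2‖ / d) * Γ * kern s₁ (z.1 - z.2) ≤
          Γ * (2 * d ^ (-1 : ℝ) * kern (s₁ - 1) (z.1 - z.2)) := by
        have := norm_rpow_mul_kern_le (N := N) (α := s₁) one_pos (z.1 - z.2)
        rw [Real.rpow_one] at this
        rw [Real.rpow_neg_one]
        calc _ = Γ * (2 * d⁻¹ * (‖z.1 - z.2‖ * kern s₁ (z.1 - z.2))) := by ring
          _ ≤ _ := by gcongr
      have h10 : C * (‖z.1 - z.2‖ / d) ^ p * Γ * kern (sp * p) (z.1 - z.2) ≤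
          Γ * (C * d ^ (-p) * kern (sp * p - p) (z.1 - z.2)) := by
        have := norm_rpow_mul_kern_le (N := N) (α := sp * p) (show 0 < p by linarith) (z.1 - z.2)
        rw [Real.div_rpow (norm_nonneg _) hd.le, Real.rpow_neg hd.le]
        calc _ = Γ * (C * (d ^ p)⁻¹ * (‖z.1 - z.2‖ ^ p * kern (sp * p) (z.1 - z.2))) := by ring
          _ ≤ _ := by gcongr
      have h11 : Hin z = Γ * (2 * d ^ (-1 : ℝ) * kern (s₁ - 1) (z.1 - z.2)) +
          Γ * (C * d ^ (-p) * kern (sp * p - p) (z.1 - z.2)) := by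
        simp only [hHin, hκ, ← hΓ]; ring
      rw [h11]
      linarith
    · have hHz : H z = Hoff z := by
        have hzU' : z ∈ (U ×ˢ U)ᶜ := hzU
        simp only [hH, indicator_of_notMem hzU]
        rw [indicator_of_mem hzU', zero_add]
      have hez : e z = 0 := by
        rw [he, indicator_of_notMem fun hz' => hzU ⟨hBU hz'.1, hBU hz'.2⟩]
      rw [hHz, hez]
      have h1 : -(|ψ z.1 - ψ z.2| * (2 * kern s₁ (z.1 - z.2))) ≤
          lam * ((Z (z + (h, h)) - Z z) * ((ψ z.1 - ψ z.2) * kern s₁ (z.1 - z.2))) := by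
        refine (neg_le_neg ?_).trans (neg_abs_le _)
        have h2 : |Z (z + (h, h)) - Z z| ≤ 2 :=
          (abs_sub _ _).trans (by linarith [sgnSet_abs_le hz, sgnSet_abs_le hzh])
        rw [abs_mul, abs_mul, abs_mul, abs_of_nonneg k1, abs_of_nonneg hu.lam_nonneg]
        have h3 : 0 ≤ |ψ z.1 - ψ z.2| * kern s₁ (z.1 - z.2) := mul_nonneg (abs_nonneg _) k1
        calc _ ≤ 1 * (2 * (|ψ z.1 - ψ z.2| * kern s₁ (z.1 - z.2))) := by
              gcongr
              exact hu.lam_le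
          _ = _ := by ring
      have h4 : -(|ψ z.1 - ψ z.2| *
          (|oddPow p (u (z.1 + h) - u (z.2 + h))| * kern (sp * p) (z.1 - z.2) +
            |oddPow p (u z.1 - u z.2)| * kern (sp * p) (z.1 - z.2))) ≤
          (oddPow p (u (z.1 + h) - u (z.2 + h)) - oddPow p (u z.1 - u z.2)) *
        (ψ z.1 - ψ z.2) * kern (sp * p) (z.1 - z.2) := by
        refine (neg_le_neg ?_).trans (neg_abs_le _)
        rw [abs_mul, abs_mul, abs_of_nonneg kp]
        calc _ ≤ (|oddPow p (u (z.1 + h) - u (z.2 + h))| + |oddPow p (u z.1 - u z.2)|) *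
              |ψ z.1 - ψ z.2| * kern (sp * p) (z.1 - z.2) := by
              gcongr
              exact abs_sub _ _
          _ = _ := by ring
      simp only [hHoff, add_zero]
      linarith
  -- The tested equation integrates to zero, so the energy is bounded by the integrated errors.
  have hmain := lintegral_le_of_integral_eq_zero hFi hF0 hHm.aestronglyMeasurable hH0 he0 hpt
  have hLHS : ∫⁻ z, ENNReal.ofReal (e z) = ENNReal.ofReal c * ∫⁻ z in B ×ˢ B, ENNReal.ofReal
      ((|u (z.1 + h) - u (z.2 + h)| + |u z.1 - u z.2|) ^ (p - 2) *
        |w z.1 - w z.2| ^ (q + 1) * kern (sp * p) (z.1 - z.2)) := by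
    rw [← lintegral_const_mul' _ _ (by finiteness), ← lintegral_indicator (hBm.prod hBm)]
    refine lintegral_congr fun z => ?_
    by_cases hz : z ∈ B ×ˢ B
    · rw [he, indicator_of_mem hz, indicator_of_mem hz, ENNReal.ofReal_mul hc.le]
    · rw [he, indicator_of_notMem hz, indicator_of_notMem hz, ENNReal.ofReal_zero]
  have hRHS : ∫⁻ z, ENNReal.ofReal (H z) = (∫⁻ z in U ×ˢ U, ENNReal.ofReal (Hin z)) +
      ∫⁻ z in (U ×ˢ U)ᶜ, ENNReal.ofReal (Hoff z) := by
    rw [← lintegral_add_compl _ (hUm.prod hUm)]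
    congr 1
    · refine setLIntegral_congr_fun (hUm.prod hUm) fun z hz => ?_
      simp only [hH, indicator_of_mem hz]
      rw [indicator_of_notMem (by simpa using hz), add_zero]
    · refine setLIntegral_congr_fun (hUm.prod hUm).compl fun z hz => ?_
      simp only [hH, indicator_of_mem hz]
      rw [indicator_of_notMem (by simpa using hz), zero_add]
  set W : ℝ≥0∞ := ∫⁻ x in U, ENNReal.ofReal (|w x| ^ q) with hW
  have hκint : ∀ x ∈ U, ∫⁻ y in U, ENNReal.ofReal (κ (x - y)) ≤
      ENNReal.ofReal 2 * ENNReal.ofReal (d ^ (-1 : ℝ)) * M₁ +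
        ENNReal.ofReal C * ENNReal.ofReal (d ^ (-p)) * M₂ := by
    intro x hx
    have hsub : Metric.ball (0 : Rn N) (2 * (ρ + d + d)) ⊆ Metric.ball 0 2 :=
      Metric.ball_subset_ball (by linarith)
    have m1 := (lintegral_kern_sub_ball_le (α := s₁ - 1) hx).trans (lintegral_mono_set hsub)
    have m2 := (lintegral_kern_sub_ball_le (α := sp * p - p) hx).trans (lintegral_mono_set hsub)
    calc ∫⁻ y in U, ENNReal.ofReal (κ (x - y)) = ∫⁻ y in U,
          (ENNReal.ofReal 2 * ENNReal.ofReal (d ^ (-1 : ℝ)) *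
            ENNReal.ofReal (kern (s₁ - 1) (x - y)) +
          ENNReal.ofReal C * ENNReal.ofReal (d ^ (-p)) *
            ENNReal.ofReal (kern (sp * p - p) (x - y))) := by
          refine lintegral_congr fun y => ?_
          have k1 := kern_nonneg (s₁ - 1) (x - y)
          have k2 := kern_nonneg (sp * p - p) (x - y)
          rw [← ENNReal.ofReal_mul (by positivity), ← ENNReal.ofReal_mul (by positivity),
            ← ENNReal.ofReal_mul (by positivity), ← ENNReal.ofReal_mul (by positivity),
            ← ENNReal.ofReal_add (by positivity) (by positivity)]
      _ = ENNReal.ofReal 2 * ENNReal.ofReal (d ^ (-1 : ℝ)) *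
            (∫⁻ y in U, ENNReal.ofReal (kern (s₁ - 1) (x - y))) +
          ENNReal.ofReal C * ENNReal.ofReal (d ^ (-p)) *
            ∫⁻ y in U, ENNReal.ofReal (kern (sp * p - p) (x - y)) := by
          rw [lintegral_add_left (by fun_prop), lintegral_const_mul' _ _ (by finiteness),
            lintegral_const_mul' _ _ (by finiteness)]
      _ ≤ _ := by gcongr
  have hin : ∫⁻ z in U ×ˢ U, ENNReal.ofReal (Hin z) ≤
      2 * ((ENNReal.ofReal 2 * ENNReal.ofReal (d ^ (-1 : ℝ)) * M₁ +
        ENNReal.ofReal C * ENNReal.ofReal (d ^ (-p)) * M₂) * W) := by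
    have hκsymm : ∀ x y : Rn N, κ (x - y) = κ (y - x) := fun x y => by
      simp only [hκ]; rw [kern_sub_comm, kern_sub_comm (sp * p - p)]
    have s1 : ∫⁻ z in U ×ˢ U, ENNReal.ofReal (|w z.1| ^ q) * ENNReal.ofReal (κ (z.1 - z.2)) ≤
        (ENNReal.ofReal 2 * ENNReal.ofReal (d ^ (-1 : ℝ)) * M₁ +
        ENNReal.ofReal C * ENNReal.ofReal (d ^ (-p)) * M₂) * W := by
      rw [Measure.volume_eq_prod, ← Measure.prod_restrict, lintegral_prod _ (by fun_prop), hW,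
        mul_comm _ (lintegral _ _), ← lintegral_mul_const' _ _ (by finiteness)]
      refine setLIntegral_mono' hUm fun x hx => ?_
      change ∫⁻ y in U, ENNReal.ofReal (|w x| ^ q) * ENNReal.ofReal (κ (x - y)) ≤ _
      rw [lintegral_const_mul' _ _ (by finiteness)]
      exact mul_le_mul_right (hκint x hx) _
    have s2 : ∫⁻ z in U ×ˢ U, ENNReal.ofReal (|w z.2| ^ q) * ENNReal.ofReal (κ (z.1 - z.2)) =
        ∫⁻ z in U ×ˢ U, ENNReal.ofReal (|w z.1| ^ q) * ENNReal.ofReal (κ (z.1 - z.2)) := by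
      rw [Measure.volume_eq_prod, ← Measure.prod_restrict, ← lintegral_prod_swap]
      refine lintegral_congr fun z => ?_
      simp only [Prod.fst_swap, Prod.snd_swap]
      rw [hκsymm]
    calc _ = ∫⁻ z in U ×ˢ U, (ENNReal.ofReal (|w z.1| ^ q) * ENNReal.ofReal (κ (z.1 - z.2)) +
          ENNReal.ofReal (|w z.2| ^ q) * ENNReal.ofReal (κ (z.1 - z.2))) := by
          refine lintegral_congr fun z => ?_
          simp only [hHin]
          rw [ENNReal.ofReal_mul (by positivity),
            ENNReal.ofReal_add (by positivity) (by positivity), add_mul]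
      _ ≤ _ := by
          rw [lintegral_add_left (by fun_prop), s2, two_mul]
          exact add_le_add s1 s1
  have hoff : ∫⁻ z in (U ×ˢ U)ᶜ, ENNReal.ofReal (Hoff z) ≤
      2 * ((2 * k₁ d + (ft d + ft d)) * W) := by
    have hsubU : Metric.closedBall x₀ (ρ + d) ⊆ U := Metric.closedBall_subset_ball (by linarith)
    have h1 := K₁ d hdI
    have key := lintegral_compl_ball_le (x₀ := x₀) (ρ := ρ + d) (d := d)
      (F := fun z => ENNReal.ofReal (Hoff z))
      (c := fun x => ENNReal.ofReal (|w x| ^ q) * (2 * k₁ d + (ft d + ft d)))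
      (G := fun x y => ENNReal.ofReal (|w x| ^ q) * (2 * ENNReal.ofReal (kern s₁ (x - y)) +
        (ENNReal.ofReal (|oddPow p (u (x + h) - u (y + h))| * kern (sp * p) (x - y)) +
          ENNReal.ofReal (|oddPow p (u (x + 0) - u (y + 0))| * kern (sp * p) (x - y)))))
      hd (by fun_prop) ?_ ?_ ?_ ?_
    · refine key.trans (mul_le_mul_right ?_ _)
      rw [lintegral_mul_const _ (by fun_prop), mul_comm]
      exact mul_le_mul_right (lintegral_mono_set hsubU) _
    · intro x y
      simp only [hHoff]
      rw [abs_sub_comm, kern_sub_comm s₁, kern_sub_comm (sp * p) x y, ← neg_sub (u (y + h)),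
        ← neg_sub (u (y + 0)), oddPow_neg, oddPow_neg, abs_neg, abs_neg]
    · intro x y hx hy
      simp [hHoff, hψ0 x hx, hψ0 y hy]
    · intro x hx y hy
      have k1 := kern_nonneg s₁ (x - y)
      have kp := kern_nonneg (sp * p) (x - y)
      have e2 : 2 * ENNReal.ofReal (kern s₁ (x - y)) = ENNReal.ofReal (2 * kern s₁ (x - y)) := by
        rw [ENNReal.ofReal_mul (by norm_num), ENNReal.ofReal_ofNat]
      rw [e2, ← ENNReal.ofReal_add (by positivity)
        (by positivity), ← ENNReal.ofReal_add (by positivity) (by positivity),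
        ← ENNReal.ofReal_mul (by positivity)]
      refine ENNReal.ofReal_le_ofReal ?_
      simp only [hHoff, hψ0 y hy, sub_zero]
      gcongr
      exact abs_testFun_le hq h x
    · intro x hx
      have hxU := hsubU hx
      have t1 := HT s₁ x₀ R lam u Z hu d hd (by linarith) x (hUR hxU) h hh (hUh x hxU)
      have t2 := HT s₁ x₀ R lam u Z hu d hd (by linarith) x (hUR hxU) 0 (by simpa using hd.le)
        (by simpa using hUR hxU)
      rw [lintegral_const_mul' _ _ (by finiteness), lintegral_add_left (by fun_prop),
        lintegral_add_left (by fun_prop), lintegral_const_mul' _ _ (by finiteness),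
        lintegral_kern_sub_le]
      gcongr
  rw [hLHS, hRHS] at hmain
  have hUeq : Metric.ball x₀ (ρ + 2 * d) = U := by rw [hU]; congr 1; ring
  rw [hUeq, ← hW]
  have hfinal := hmain.trans (add_le_add hin hoff)
  set I := ∫⁻ z in B ×ˢ B, ENNReal.ofReal
      ((|u (z.1 + h) - u (z.2 + h)| + |u z.1 - u z.2|) ^ (p - 2) *
        |w z.1 - w z.2| ^ (q + 1) * kern (sp * p) (z.1 - z.2))
  have hcc : ENNReal.ofReal c⁻¹ * ENNReal.ofReal c = 1 := by
    rw [← ENNReal.ofReal_mul (by positivity), inv_mul_cancel₀ hc.ne', ENNReal.ofReal_one]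
  calc I = ENNReal.ofReal c⁻¹ * (ENNReal.ofReal c * I) := by rw [← mul_assoc, hcc, one_mul]
    _ ≤ _ := mul_le_mul_right hfinal _
    _ = _ := by ring

/-! ### Gagliardo seminorms, differences and interpolation -/

/-- Differences are controlled by the Gagliardo seminorm, by averaging over a ball of radius
`|h|`. -/
lemma exists_lintegral_diff_le_gagInt (hN : 1 ≤ N) {κ q : ℝ} (hq : 1 ≤ q) (hκ : 0 ≤ (N : ℝ) + κ) :
    ∃ C : ℝ≥0∞, C ≠ ∞ ∧ ∀ (x₀ : Rn N) (f : Rn N → ℝ) (h : Rn N) (r ρ : ℝ), Measurable f →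
      r + ‖h‖ ≤ ρ →
      ∫⁻ x in Metric.ball x₀ r, ENNReal.ofReal (|diff f h x| ^ q) ≤
        C * ENNReal.ofReal (‖h‖ ^ κ) * gagInt κ q (Metric.ball x₀ ρ) f := by
  set v := volume (Metric.ball (0 : Rn N) 1) with hv
  have : Nonempty (Fin N) := ⟨⟨0, by omega⟩⟩
  have hv0 : v ≠ 0 := (Metric.measure_ball_pos volume 0 one_pos).ne'
  have hvt : v ≠ ∞ := measure_ball_lt_top.ne
  refine ⟨v⁻¹ * (ENNReal.ofReal (2 ^ q * 2 ^ ((N : ℝ) + κ)) * 2), by finiteness, ?_⟩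
  intro x₀ f h r ρ hf hρ
  rcases eq_or_ne h 0 with rfl | hh
  · have : ∀ x, ENNReal.ofReal (|diff f 0 x| ^ q) = 0 := fun x => by
      simp [diff, Real.zero_rpow (show q ≠ 0 by linarith)]
    simp [this]
  have hh0 : 0 < ‖h‖ := norm_pos_iff.2 hh
  set G : Rn N × Rn N → ℝ≥0∞ := fun z =>
    ENNReal.ofReal (|f z.1 - f z.2| ^ q * kern κ (z.1 - z.2)) with hG
  have hGm : Measurable G := by fun_prop
  set c : ℝ := 2 ^ q * (2 * ‖h‖) ^ ((N : ℝ) + κ) with hc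
  have hc0 : 0 ≤ c := by positivity
  -- At distance at most 2|h| the kernel is at least (2|h|)^{−(N+κ)}, because N + κ ≥ 0. An
  -- auxiliary y with |x − y| < |h| is this close to both x and x + h. Averaging over such y divides
  -- by a multiple of |h|^N and leaves the factor |h|^κ.
  have hclose : ∀ x y : Rn N, ‖x - y‖ ≤ 2 * ‖h‖ →
      |f x - f y| ^ q ≤ (2 * ‖h‖) ^ ((N : ℝ) + κ) * (|f x - f y| ^ q * kern κ (x - y)) := by
    intro x y hxy
    rcases eq_or_ne x y with rfl | hne
    · simp [Real.zero_rpow (show q ≠ 0 by linarith)]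
    have hpos : 0 < ‖x - y‖ := norm_pos_iff.2 (sub_ne_zero.2 hne)
    have h1 : (2 * ‖h‖) ^ (-((N : ℝ) + κ)) ≤ kern κ (x - y) :=
      Real.rpow_le_rpow_of_nonpos hpos hxy (by linarith)
    have h2 : 1 ≤ (2 * ‖h‖) ^ ((N : ℝ) + κ) * kern κ (x - y) := by
      calc (1 : ℝ) = (2 * ‖h‖) ^ ((N : ℝ) + κ) * (2 * ‖h‖) ^ (-((N : ℝ) + κ)) := by
            rw [← Real.rpow_add (by positivity), add_neg_cancel, Real.rpow_zero]
        _ ≤ _ := by gcongr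
    have h3 : 0 ≤ |f x - f y| ^ q := by positivity
    nlinarith
  have hpt : ∀ x, ∀ y ∈ Metric.ball x ‖h‖, ENNReal.ofReal (|diff f h x| ^ q) ≤
      ENNReal.ofReal c * (G (x + h, y) + G (x, y)) := by
    intro x y hy
    rw [Metric.mem_ball, dist_comm, dist_eq_norm] at hy
    simp only [hG]
    rw [← ENNReal.ofReal_add (mul_nonneg (by positivity) (kern_nonneg _ _))
      (mul_nonneg (by positivity) (kern_nonneg _ _)), ← ENNReal.ofReal_mul hc0]
    refine ENNReal.ofReal_le_ofReal ?_
    have h1 := hclose (x + h) y (by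
      calc ‖x + h - y‖ = ‖(x - y) + h‖ := by congr 1; abel
        _ ≤ ‖x - y‖ + ‖h‖ := norm_add_le _ _
        _ ≤ _ := by linarith)
    have h2 := hclose x y (by linarith)
    calc |diff f h x| ^ q ≤ (|f (x + h) - f y| + |f x - f y|) ^ q := by
          refine Real.rpow_le_rpow (abs_nonneg _) ?_ (by linarith)
          have : diff f h x = (f (x + h) - f y) - (f x - f y) := by simp only [diff]; ring
          rw [this]; exact abs_sub _ _
      _ ≤ 2 ^ q * (|f (x + h) - f y| ^ q + |f x - f y| ^ q) :=
          add_rpow_le_mul (by linarith) (abs_nonneg _) (abs_nonneg _)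
      _ ≤ 2 ^ q * ((2 * ‖h‖) ^ ((N : ℝ) + κ) * (|f (x + h) - f y| ^ q * kern κ (x + h - y)) +
          (2 * ‖h‖) ^ ((N : ℝ) + κ) * (|f x - f y| ^ q * kern κ (x - y))) := by gcongr
      _ = _ := by rw [hc]; ring
  set B := Metric.ball x₀ ρ with hB
  have hBm : MeasurableSet B := Metric.isOpen_ball.measurableSet
  set Φ : Rn N → ℝ≥0∞ := fun x => ∫⁻ y in B, G (x, y) with hΦ
  have hΦm : Measurable Φ := hGm.lintegral_prod_right'
  have hball : ∀ x : Rn N, volume (Metric.ball x ‖h‖) = ENNReal.ofReal (‖h‖ ^ N) * v := by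
    intro x
    rw [Measure.addHaar_ball volume x hh0.le, finrank_euclideanSpace_fin]
  have hx : ∀ x ∈ Metric.ball x₀ r, ENNReal.ofReal (‖h‖ ^ N) * v *
      ENNReal.ofReal (|diff f h x| ^ q) ≤ ENNReal.ofReal c * (Φ (x + h) + Φ x) := by
    intro x hx
    have hsub : Metric.ball x ‖h‖ ⊆ B := by
      refine Metric.ball_subset_ball' ?_
      rw [Metric.mem_ball] at hx
      linarith
    calc _ = ∫⁻ _ in Metric.ball x ‖h‖, ENNReal.ofReal (|diff f h x| ^ q) := by
          rw [setLIntegral_const, hball, mul_comm]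
      _ ≤ ∫⁻ y in Metric.ball x ‖h‖, ENNReal.ofReal c * (G (x + h, y) + G (x, y)) :=
          setLIntegral_mono' Metric.isOpen_ball.measurableSet fun y hy => hpt x y hy
      _ ≤ ∫⁻ y in B, ENNReal.ofReal c * (G (x + h, y) + G (x, y)) := lintegral_mono_set hsub
      _ = _ := by
          rw [lintegral_const_mul' _ _ (by finiteness), lintegral_add_left (by fun_prop)]
  have hgag : ∫⁻ x in B, Φ x = gagInt κ q B f := by
    rw [gagInt, Measure.volume_eq_prod, ← Measure.prod_restrict, lintegral_prod _ hGm.aemeasurable]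
  have hsub : Metric.ball x₀ r ⊆ B := Metric.ball_subset_ball (by linarith)
  have hmain : ENNReal.ofReal (‖h‖ ^ N) * v *
      ∫⁻ x in Metric.ball x₀ r, ENNReal.ofReal (|diff f h x| ^ q) ≤
      ENNReal.ofReal c * (2 * gagInt κ q B f) := by
    rw [← lintegral_const_mul' _ _ (by finiteness)]
    refine (setLIntegral_mono' Metric.isOpen_ball.measurableSet hx).trans ?_
    rw [lintegral_const_mul' _ _ (by finiteness), lintegral_add_left (by fun_prop), two_mul, ← hgag]
    exact mul_le_mul_right (add_le_add (setLIntegral_translate_le Metric.isOpen_ball.measurableSet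
      hBm (fun x hx => add_mem_ball hx le_rfl hρ) Φ) (lintegral_mono_set hsub)) _
  have hh1 : ENNReal.ofReal ((‖h‖ ^ N)⁻¹) * ENNReal.ofReal (‖h‖ ^ N) = 1 := by
    rw [← ENNReal.ofReal_mul (by positivity), inv_mul_cancel₀ (by positivity), ENNReal.ofReal_one]
  set I := ∫⁻ x in Metric.ball x₀ r, ENNReal.ofReal (|diff f h x| ^ q)
  have hcc : ENNReal.ofReal ((‖h‖ ^ N)⁻¹) * ENNReal.ofReal c =
      ENNReal.ofReal (2 ^ q * 2 ^ ((N : ℝ) + κ)) * ENNReal.ofReal (‖h‖ ^ κ) := by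
    rw [← ENNReal.ofReal_mul (by positivity), ← ENNReal.ofReal_mul (by positivity)]
    congr 1
    rw [hc, Real.mul_rpow (by norm_num) hh0.le, Real.rpow_add hh0, Real.rpow_natCast]
    field_simp
  calc I = (v⁻¹ * v) * (ENNReal.ofReal ((‖h‖ ^ N)⁻¹) * ENNReal.ofReal (‖h‖ ^ N)) * I := by
        rw [hh1, ENNReal.inv_mul_cancel hv0 hvt, one_mul, one_mul]
    _ = v⁻¹ * ENNReal.ofReal ((‖h‖ ^ N)⁻¹) * (ENNReal.ofReal (‖h‖ ^ N) * v * I) := by ring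
    _ ≤ v⁻¹ * ENNReal.ofReal ((‖h‖ ^ N)⁻¹) * (ENNReal.ofReal c * (2 * gagInt κ q B f)) := by gcongr
    _ = v⁻¹ * (ENNReal.ofReal ((‖h‖ ^ N)⁻¹) * ENNReal.ofReal c) * 2 * gagInt κ q B f := by ring
    _ = _ := by rw [hcc]; ring

lemma rpow_le_one_add_rpow {x m q : ℝ} (hx : 0 ≤ x) (hm : 0 ≤ m) (hmq : m ≤ q) :
    x ^ m ≤ 1 + x ^ q := by
  rcases le_total x 1 with h | h
  · have := Real.rpow_le_one hx h hm
    have := Real.rpow_nonneg hx q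
    linarith
  · have := Real.rpow_le_rpow_of_exponent_le h hmq
    linarith

/-- A bound for first differences of order `σ` in `L^q` controls lower order Gagliardo integrals. -/
lemma gagInt_le_of_diff_bound {σ σ' m q ρ d : ℝ} {T : ℝ≥0∞} {x₀ : Rn N} {u : Rn N → ℝ}
    (hm : 0 < m) (hmq : m ≤ q) (hd : 0 < d)
    (hNσ : 0 ≤ (N : ℝ) + σ' * m) (hu : Measurable u) (hρ : ρ ≤ 1)
    (hbdd : ∀ x ∈ Metric.ball x₀ ρ, |u x| ≤ 1)
    (hT : ∀ k : Rn N, ‖k‖ < d →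
      ∫⁻ x in Metric.ball x₀ ρ, ENNReal.ofReal (|diff u k x| ^ q) ≤
        T * ENNReal.ofReal (‖k‖ ^ (σ * q))) :
    gagInt (σ' * m) m (Metric.ball x₀ ρ) u ≤
      (∫⁻ k in Metric.ball (0 : Rn N) d, ENNReal.ofReal (kern ((σ' - σ) * m) k)) *
        (volume (Metric.ball (0 : Rn N) 1) + T) +
      ENNReal.ofReal (2 ^ m) * ENNReal.ofReal (d ^ (-((N : ℝ) + σ' * m))) *
        (volume (Metric.ball (0 : Rn N) 1) * volume (Metric.ball (0 : Rn N) 1)) := by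
  set B := Metric.ball x₀ ρ with hB
  have hBm : MeasurableSet B := Metric.isOpen_ball.measurableSet
  set v := volume (Metric.ball (0 : Rn N) 1) with hv
  have hvol : volume B ≤ v := by
    rw [hB, hv, Measure.addHaar_ball_center volume x₀ ρ]
    exact measure_mono (Metric.ball_subset_ball hρ)
  -- With k = y − x, the Gagliardo integrand is |k|^{−N−(σ'−σ)m} (|k|^{−σ}|δ_k u|)^m. Bounding t^m
  -- by 1 + t^q brings in the exponent q of the hypothesis, and Fubini leaves an integral over k
  -- alone.
  set Φ : Rn N → Rn N → ℝ≥0∞ := fun x k => (Metric.ball (0 : Rn N) d).indicator (fun k =>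
    ENNReal.ofReal (kern ((σ' - σ) * m) k) *
      (1 + ENNReal.ofReal (‖k‖ ^ (-(σ * q))) * ENNReal.ofReal (|diff u k x| ^ q))) k with hΦ
  have hΦm : Measurable (Function.uncurry Φ) := by
    have : Measurable fun z : Rn N × Rn N => ENNReal.ofReal (kern ((σ' - σ) * m) z.2) *
      (1 + ENNReal.ofReal (‖z.2‖ ^ (-(σ * q))) * ENNReal.ofReal (|diff u z.2 z.1| ^ q)) := by
      unfold diff; fun_prop
    exact this.indicator (measurable_snd Metric.isOpen_ball.measurableSet)
  set c₁ : ℝ≥0∞ := ENNReal.ofReal (2 ^ m) * ENNReal.ofReal (d ^ (-((N : ℝ) + σ' * m))) with hc₁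
  have hpt : ∀ x ∈ B, ∀ y ∈ B, ENNReal.ofReal (|u x - u y| ^ m * kern (σ' * m) (x - y)) ≤
      Φ x (y - x) + c₁ := by
    intro x hx y hy
    by_cases hk : y - x ∈ Metric.ball (0 : Rn N) d
    · refine le_add_of_le_of_nonneg ?_ (by simp)
      simp only [hΦ, indicator_of_mem hk]
      rcases eq_or_ne x y with rfl | hne
      · simp [Real.zero_rpow hm.ne']
      have hpos : 0 < ‖y - x‖ := norm_pos_iff.2 (sub_ne_zero.2 hne.symm)
      have hδ : diff u (y - x) x = u y - u x := by simp [diff]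
      have e1 : (1 : ℝ≥0∞) = ENNReal.ofReal 1 := by simp
      rw [e1, ← ENNReal.ofReal_mul (by positivity),
        ← ENNReal.ofReal_add (by norm_num) (by positivity), ← ENNReal.ofReal_mul (kern_nonneg _ _)]
      refine ENNReal.ofReal_le_ofReal ?_
      rw [hδ, kern_sub_comm, abs_sub_comm]
      set k := ‖y - x‖
      set s := |u y - u x|
      have hs : 0 ≤ s := abs_nonneg _
      have e2 := rpow_le_one_add_rpow (x := k ^ (-σ) * s) (by positivity) hm.le hmq
      rw [Real.mul_rpow (by positivity) hs, Real.mul_rpow (by positivity) hs,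
        ← Real.rpow_mul hpos.le, ← Real.rpow_mul hpos.le, neg_mul, neg_mul] at e2
      have e3 : kern (σ' * m) (y - x) = kern ((σ' - σ) * m) (y - x) * k ^ (-(σ * m)) := by
        unfold kern
        rw [← Real.rpow_add hpos]; congr 1; ring
      rw [e3]
      have e4 := kern_nonneg ((σ' - σ) * m) (y - x)
      calc _ = kern ((σ' - σ) * m) (y - x) * (k ^ (-(σ * m)) * s ^ m) := by ring
        _ ≤ _ := by gcongr
    · refine le_add_of_nonneg_of_le (by simp) ?_
      rw [hc₁, ← ENNReal.ofReal_mul (by positivity)]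
      refine ENNReal.ofReal_le_ofReal ?_
      have hk' : d ≤ ‖x - y‖ := by
        rw [mem_ball_zero_iff, not_lt] at hk; rwa [norm_sub_rev]
      have h2 : |u x - u y| ≤ 2 := (abs_sub _ _).trans (by linarith [hbdd x hx, hbdd y hy])
      have h3 : kern (σ' * m) (x - y) ≤ d ^ (-((N : ℝ) + σ' * m)) :=
        Real.rpow_le_rpow_of_nonpos hd hk' (by linarith)
      gcongr
      exact kern_nonneg _ _
  calc gagInt (σ' * m) m B u
      = ∫⁻ x in B, ∫⁻ y in B, ENNReal.ofReal (|u x - u y| ^ m * kern (σ' * m) (x - y)) := by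
        rw [gagInt, Measure.volume_eq_prod, ← Measure.prod_restrict, lintegral_prod _ (by fun_prop)]
    _ ≤ ∫⁻ x in B, ((∫⁻ k, Φ x k) + c₁ * v) := by
        refine setLIntegral_mono' hBm fun x hx => ?_
        calc _ ≤ ∫⁻ y in B, (Φ x (y - x) + c₁) := setLIntegral_mono' hBm fun y hy => hpt x hx y hy
          _ = (∫⁻ y in B, Φ x (y - x)) + c₁ * volume B := by
              rw [lintegral_add_right _ measurable_const, setLIntegral_const]
          _ ≤ _ := by
              refine add_le_add ?_ (mul_le_mul_right hvol _)
              refine (setLIntegral_le_lintegral _ _).trans (le_of_eq ?_)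
              exact lintegral_sub_right_eq_self (Φ x) x
    _ = (∫⁻ k, ∫⁻ x in B, Φ x k) + c₁ * v * volume B := by
        rw [lintegral_add_right _ measurable_const, setLIntegral_const,
          lintegral_lintegral_swap hΦm.aemeasurable]
    _ ≤ (∫⁻ k in Metric.ball (0 : Rn N) d, ENNReal.ofReal (kern ((σ' - σ) * m) k) * (v + T)) +
        c₁ * v * v := by
        refine add_le_add ?_ (mul_le_mul_right hvol _)
        rw [← lintegral_indicator Metric.isOpen_ball.measurableSet]
        refine lintegral_mono fun k => ?_
        by_cases hk : k ∈ Metric.ball (0 : Rn N) d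
        · have hk' := hT k (by simpa using hk)
          simp only [hΦ, indicator_of_mem hk]
          rw [lintegral_const_mul' _ _ (by finiteness), lintegral_add_left measurable_const,
            setLIntegral_const, one_mul, lintegral_const_mul' _ _ (by finiteness)]
          gcongr
          calc _ ≤ ENNReal.ofReal (‖k‖ ^ (-(σ * q))) * (T * ENNReal.ofReal (‖k‖ ^ (σ * q))) := by
                gcongr
            _ = (ENNReal.ofReal (‖k‖ ^ (-(σ * q))) * ENNReal.ofReal (‖k‖ ^ (σ * q))) * T := by ring
            -- Only an inequality in general: for σq ≠ 0 both powers vanish at k = 0.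
            _ ≤ 1 * T := by
                gcongr
                rw [← ENNReal.ofReal_mul (by positivity), ← ENNReal.ofReal_one]
                refine ENNReal.ofReal_le_ofReal ?_
                rw [Real.rpow_neg (norm_nonneg _)]
                exact inv_mul_le_one
            _ = T := one_mul _
        · simp only [hΦ, indicator_of_notMem hk]
          simp
    _ = _ := by
        rw [lintegral_mul_const _ (by fun_prop), mul_assoc c₁]

/-- Interpolation between the Caccioppoli energy and the plain Gagliardo energy. -/
lemma energy_interpolation {p q A δ D s a b c : ℝ} (hq : 1 ≤ q) (hδ : 0 ≤ δ)
    (hδA : δ ≤ A) (hD : 0 < D) (hs : 0 < s)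
    (habc : (q + 1) * c = q * a + b) :
    δ ^ q * D ^ c ≤ s ^ (-(1 / (q + 1))) * (A ^ (p - 2) * δ ^ (q + 1) * D ^ a) +
      s ^ (q / (q + 1)) * (A ^ ((2 - p) * q) * D ^ b) := by
  have hA : 0 ≤ A := hδ.trans hδA
  rcases hδ.eq_or_lt with rfl | hδ'
  · rw [Real.zero_rpow (by linarith), zero_mul]; positivity
  have hA' : 0 < A := by linarith
  have hq1 : 0 < q + 1 := by linarith
  set X := s ^ (-(1 / (q + 1))) * (A ^ (p - 2) * δ ^ (q + 1) * D ^ a) with hX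
  set Y := s ^ (q / (q + 1)) * (A ^ ((2 - p) * q) * D ^ b) with hY
  have hX0 : 0 ≤ X := by positivity
  have hY0 : 0 ≤ Y := by positivity
  -- With weights q/(q+1) and 1/(q+1), the powers of A and of s cancel in the geometric mean, and
  -- the exponents of the distance combine to c.
  have key := Real.geom_mean_le_arith_mean2_weighted (w₁ := q / (q + 1)) (w₂ := 1 / (q + 1))
    (by positivity) (by positivity) hX0 hY0 (by field_simp)
  have e : X ^ (q / (q + 1)) * Y ^ (1 / (q + 1)) = δ ^ q * D ^ c := by
    rw [hX, hY, Real.mul_rpow (by positivity) (by positivity),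
      Real.mul_rpow (by positivity) (by positivity), Real.mul_rpow (by positivity) (by positivity),
      Real.mul_rpow (by positivity) (by positivity), Real.mul_rpow (by positivity) (by positivity),
      ← Real.rpow_mul hs.le, ← Real.rpow_mul hs.le, ← Real.rpow_mul hA, ← Real.rpow_mul hA,
      ← Real.rpow_mul hδ, ← Real.rpow_mul hD.le, ← Real.rpow_mul hD.le]
    have e1 : s ^ (-(1 / (q + 1)) * (q / (q + 1))) * s ^ (q / (q + 1) * (1 / (q + 1))) = 1 := by
      rw [← Real.rpow_add hs]
      rw [show -(1 / (q + 1)) * (q / (q + 1)) + q / (q + 1) * (1 / (q + 1)) = 0 by ring,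
        Real.rpow_zero]
    have e2 : A ^ ((p - 2) * (q / (q + 1))) * A ^ ((2 - p) * q * (1 / (q + 1))) = 1 := by
      rw [← Real.rpow_add hA']
      rw [show (p - 2) * (q / (q + 1)) + (2 - p) * q * (1 / (q + 1)) = 0 by ring,
        Real.rpow_zero]
    have e3 : (q + 1) * (q / (q + 1)) = q := by field_simp
    have e4 : D ^ (a * (q / (q + 1))) * D ^ (b * (1 / (q + 1))) = D ^ c := by
      rw [← Real.rpow_add hD]
      congr 1
      field_simp
      linarith
    rw [e3]
    calc _ = (s ^ (-(1 / (q + 1)) * (q / (q + 1))) * s ^ (q / (q + 1) * (1 / (q + 1)))) *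
          (A ^ ((p - 2) * (q / (q + 1))) * A ^ ((2 - p) * q * (1 / (q + 1)))) * δ ^ q *
          (D ^ (a * (q / (q + 1))) * D ^ (b * (1 / (q + 1)))) := by ring
      _ = _ := by rw [e1, e2, e4]; ring
  rw [e] at key
  have h1 : q / (q + 1) * X ≤ X := mul_le_of_le_one_left hX0 (by rw [div_le_one hq1]; linarith)
  have h2 : 1 / (q + 1) * Y ≤ Y := mul_le_of_le_one_left hY0 (by rw [div_le_one hq1]; linarith)
  linarith

/-! ### The gain in one step of the bootstrap -/

/-- Order `σ` bound in `L^q` for the first differences of all normalised solutions. -/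
def FirstDiffBound (N : ℕ) (p s₁ sp q σ : ℝ) : Prop :=
  ∃ f, PolyBound f ∧ ∀ (x₀ : Rn N) (R lam : ℝ) (u : Rn N → ℝ) (Z : Rn N × Rn N → ℝ),
    NormSol s₁ sp p x₀ R lam u Z → ∀ r : ℝ, 0 < r → r < R → ∀ h : Rn N, ‖h‖ < R - r →
    ∫⁻ x in Metric.ball x₀ r, ENNReal.ofReal (|diff u h x| ^ q) ≤
      f (R - r) * ENNReal.ofReal (‖h‖ ^ (σ * q))

/-- Order `τ` bound in `L^q` for the second differences of all normalised solutions. -/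
def SecondDiffBound (N : ℕ) (p s₁ sp q τ : ℝ) : Prop :=
  ∃ f, PolyBound f ∧ ∀ (x₀ : Rn N) (R lam : ℝ) (u : Rn N → ℝ) (Z : Rn N × Rn N → ℝ),
    NormSol s₁ sp p x₀ R lam u Z → ∀ r : ℝ, 0 < r → r < R → ∀ h : Rn N, ‖h‖ ≤ (R - r) / 16 →
    ∫⁻ x in Metric.ball x₀ r, ENNReal.ofReal (|diff (diff u h) h x| ^ q) ≤
      f (R - r) * ENNReal.ofReal (‖h‖ ^ (τ * q))

/-- The order σ bound is used three times: on the right of the Caccioppoli inequality, and in the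
Gagliardo energies of u and of its translate that compensate the weight. Interpolation and averaging
then produce the new order. The loss ε makes the Gagliardo energy of order σ − ε finite. -/
lemma FirstDiffBound.second (hN : 2 ≤ N) {p q s₁ sp σ ε τ : ℝ} (hp : 1 < p) (hp2 : p < 2)
    (hs₁ : s₁ ∈ Ioo (0 : ℝ) 1) (hsp : sp ∈ Ioo (0 : ℝ) 1) (hq : 1 ≤ q) (hσ : 0 ≤ σ) (hε : 0 < ε)
    (hε1 : ε * ((2 - p) * q) ≤ 1) (hτ : (q + 1) * τ ≤ sp * p + (σ - ε) * (2 - p) + σ * q)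
    (H : FirstDiffBound N p s₁ sp q σ) : SecondDiffBound N p s₁ sp q τ := by
  have hN1 : 1 ≤ N := by omega
  have hNR : (1 : ℝ) ≤ N := by exact_mod_cast hN1
  obtain ⟨fc, hfc, HC⟩ := exists_polyBound_caccioppoli hN hp hp2 hs₁ hsp hq
  obtain ⟨fσ, hfσ, Hσ⟩ := H
  set m : ℝ := (2 - p) * q with hm
  have hm0 : 0 < m := mul_pos (by linarith) (by linarith)
  have hmq : m ≤ q := mul_le_of_le_one_left (by linarith) (by linarith)
  set σ' := σ - ε with hσ'
  have hα : 0 < sp * p := mul_pos hsp.1 (by linarith)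
  -- At σ = 0 the order σ' = −ε is negative. The kernel exponent keeps its sign because εm ≤ 1 ≤ N.
  have hNσ : 0 ≤ (N : ℝ) + σ' * m := by
    have : 0 ≤ σ * m := by positivity
    rw [hσ', sub_mul]; linarith
  have hq1 : 0 < q + 1 := by linarith
  set κ : ℝ := (q * (sp * p) + σ' * m) / (q + 1) with hκ
  have hκ1 : (q + 1) * κ = q * (sp * p) + σ' * m := by rw [hκ]; field_simp
  have hκ0 : 0 ≤ (N : ℝ) + κ := by
    have h1 : (q + 1) * (N + κ) = q * (N + sp * p) + (N + σ' * m) := by linarith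
    have h2 : 0 ≤ q * ((N : ℝ) + sp * p) := by positivity
    by_contra hneg
    push Not at hneg
    nlinarith
  obtain ⟨C, hC, HA⟩ := exists_lintegral_diff_le_gagInt hN1 hq hκ0
  set v := volume (Metric.ball (0 : Rn N) 1) with hv
  have hvt : v ≠ ∞ := measure_ball_lt_top.ne
  set M := ∫⁻ k in Metric.ball (0 : Rn N) 1, ENNReal.ofReal (kern ((σ' - σ) * m) k) with hM
  have hMt : M < ∞ := lintegral_kern_ball_lt_top hN1 (by
    rw [hσ', sub_sub_cancel_left]; nlinarith)
  set Y : ℝ → ℝ≥0∞ := fun D => M * (v + fσ (13 / 16 * D)) +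
      ENNReal.ofReal (2 ^ m) * ENNReal.ofReal ((1 / 16 : ℝ) ^ (-((N : ℝ) + σ' * m))) *
        ENNReal.ofReal (D ^ (-((N : ℝ) + σ' * m))) * (v * v) with hY
  refine ⟨fun D => C * (fc (1 / 16 * D) * fσ (12 / 16 * D) +
    ENNReal.ofReal (2 ^ m) * (2 * Y D)), ?_, ?_⟩
  · have h1 := hfc.comp_mul (c := 1 / 16) (by norm_num) (by norm_num)
    have h2 := hfσ.comp_mul (c := 12 / 16) (by norm_num) (by norm_num)
    have h3 := hfσ.comp_mul (c := 13 / 16) (by norm_num) (by norm_num)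
    have h4 : PolyBound Y := ((PolyBound.const hMt.ne).mul ((PolyBound.const hvt).add h3)).add
      ((((PolyBound.const (by simp)).mul (PolyBound.const (by simp))).mul (PolyBound.pow _)).mul
        (PolyBound.const (by finiteness)))
    exact (PolyBound.const hC).mul ((h1.mul h2).add ((PolyBound.const (by simp)).mul
      ((PolyBound.const (by simp)).mul h4)))
  intro x₀ R lam u Z hu r hr hrR h hh
  have hmu := hu.meas
  have hR1 := hu.R_lt
  set D := R - r with hD
  have hD0 : 0 < D := by linarith
  set d := 1 / 16 * D with hd
  have hd0 : 0 < d := by positivity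
  have hhd : ‖h‖ ≤ d := by rw [hd]; linarith
  have hrd : r + 16 * d = R := by rw [hd, hD]; ring
  -- The case h = 0 is separated because the interpolation parameter below must be positive.
  rcases eq_or_ne h 0 with rfl | hh0
  · have : ∀ x, ENNReal.ofReal (|diff (diff u 0) 0 x| ^ q) = 0 := fun x => by
      simp [diff, Real.zero_rpow (show q ≠ 0 by linarith)]
    simp [this]
  have hhpos : 0 < ‖h‖ := norm_pos_iff.2 hh0
  set w := diff u h with hw
  have hwm : Measurable w := measurable_diff hmu h
  set ρ := r + 2 * d with hρ
  set B := Metric.ball x₀ ρ with hB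
  have hBm : MeasurableSet B := Metric.isOpen_ball.measurableSet
  -- The parameter has the size of the Caccioppoli energy: s^{−1/(q+1)}·s = s^{q/(q+1)}, so both
  -- terms of the interpolation carry the same power of |h|.
  set s := ‖h‖ ^ (σ * q) with hs
  have hs0 : 0 < s := by positivity
  have hE := HC x₀ R lam u Z hu ρ d hd0 (by linarith) (by linarith) h hhd
  have hI := Hσ x₀ R lam u Z hu (ρ + 2 * d) (by linarith) (by linarith) h (by linarith)
  rw [show R - (ρ + 2 * d) = 12 / 16 * D by rw [hρ, hd, hD]; ring] at hI
  have hE' := hE.trans (mul_le_mul_right hI _)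
  have hG := gagInt_le_of_diff_bound (σ := σ) (σ' := σ') (m := m) (q := q) (ρ := ρ + d) (d := d)
    (T := fσ (13 / 16 * D)) (x₀ := x₀) (u := u) hm0 hmq hd0 hNσ hmu (by linarith)
    (fun x hx => hu.bdd x (Metric.ball_subset_ball (by linarith) hx)) (fun k hk => by
      have := Hσ x₀ R lam u Z hu (ρ + d) (by linarith) (by linarith) k (by linarith)
      rwa [show R - (ρ + d) = 13 / 16 * D by rw [hρ, hd, hD]; ring] at this)
  have hGY : gagInt (σ' * m) m (Metric.ball x₀ (ρ + d)) u ≤ Y D := by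
    refine hG.trans ?_
    rw [hY]
    refine add_le_add (mul_le_mul_left (lintegral_mono_set (Metric.ball_subset_ball
      (by linarith))) _) (le_of_eq ?_)
    rw [hd, Real.mul_rpow (by norm_num) hD0.le, ENNReal.ofReal_mul (by positivity)]
    ring
  have hG1 : gagInt (σ' * m) m B u ≤ Y D :=
    (gagInt_mono (Metric.ball_subset_ball (by linarith)) u).trans hGY
  have hG2 : gagInt (σ' * m) m B (fun x => u (x + h)) ≤ Y D :=
    (gagInt_translate_le hBm Metric.isOpen_ball.measurableSet
      (fun x hx => add_mem_ball hx hhd le_rfl) u).trans hGY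
  have hint : gagInt κ q B w ≤ ENNReal.ofReal (s ^ (q / (q + 1))) *
      (fc d * fσ (12 / 16 * D) + ENNReal.ofReal (2 ^ m) * (2 * Y D)) := by
    have hpt : ∀ z : Rn N × Rn N, ENNReal.ofReal (|w z.1 - w z.2| ^ q * kern κ (z.1 - z.2)) ≤
        ENNReal.ofReal (s ^ (-(1 / (q + 1)))) * ENNReal.ofReal
          ((|u (z.1 + h) - u (z.2 + h)| + |u z.1 - u z.2|) ^ (p - 2) *
            |w z.1 - w z.2| ^ (q + 1) * kern (sp * p) (z.1 - z.2)) +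
        ENNReal.ofReal (s ^ (q / (q + 1))) * (ENNReal.ofReal (2 ^ m) *
          (ENNReal.ofReal (|u (z.1 + h) - u (z.2 + h)| ^ m * kern (σ' * m) (z.1 - z.2)) +
            ENNReal.ofReal (|u z.1 - u z.2| ^ m * kern (σ' * m) (z.1 - z.2)))) := by
      intro z
      have k1 := kern_nonneg (sp * p) (z.1 - z.2)
      have k2 := kern_nonneg (σ' * m) (z.1 - z.2)
      rw [← ENNReal.ofReal_add (mul_nonneg (by positivity) k2) (mul_nonneg (by positivity) k2),
        ← ENNReal.ofReal_mul (by positivity), ← ENNReal.ofReal_mul (by positivity),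
        ← ENNReal.ofReal_mul (by positivity), ← ENNReal.ofReal_add
          (mul_nonneg (by positivity) (mul_nonneg (by positivity) k1))
          (mul_nonneg (by positivity) (mul_nonneg (by positivity) (by positivity)))]
      refine ENNReal.ofReal_le_ofReal ?_
      rcases eq_or_ne z.1 z.2 with he | hne
      · rw [he, sub_self, abs_zero, Real.zero_rpow (by linarith), zero_mul]
        rw [he] at k1 k2
        positivity
      have hDz : 0 < ‖z.1 - z.2‖ := norm_pos_iff.2 (sub_ne_zero.2 hne)
      have hδA : |w z.1 - w z.2| ≤ |u (z.1 + h) - u (z.2 + h)| + |u z.1 - u z.2| := by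
        have : w z.1 - w z.2 = (u (z.1 + h) - u (z.2 + h)) - (u z.1 - u z.2) := by
          simp only [hw, diff]; ring
        rw [this]; exact abs_sub _ _
      have key := energy_interpolation (p := p) (s := s) (a := -((N : ℝ) + sp * p))
        (b := -((N : ℝ) + σ' * m)) (c := -((N : ℝ) + κ)) hq (abs_nonneg (w z.1 - w z.2)) hδA hDz hs0
        (by linarith)
      refine key.trans ?_
      unfold kern
      refine add_le_add le_rfl (mul_le_mul_of_nonneg_left ?_ (by positivity))
      have e1 : (|u (z.1 + h) - u (z.2 + h)| + |u z.1 - u z.2|) ^ m ≤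
        2 ^ m * (|u (z.1 + h) - u (z.2 + h)| ^ m + |u z.1 - u z.2| ^ m) :=
        add_rpow_le_mul hm0.le (abs_nonneg _) (abs_nonneg _)
      have e2 : 0 ≤ ‖z.1 - z.2‖ ^ (-((N : ℝ) + σ' * m)) := by positivity
      calc _ ≤ 2 ^ m * (|u (z.1 + h) - u (z.2 + h)| ^ m + |u z.1 - u z.2| ^ m) *
            ‖z.1 - z.2‖ ^ (-((N : ℝ) + σ' * m)) := by gcongr
        _ = _ := by ring
    have hs1 : s ^ (-(1 / (q + 1))) * s = s ^ (q / (q + 1)) := by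
      rw [← Real.rpow_add_one hs0.ne']
      congr 1; field_simp; ring
    unfold gagInt at hG1 hG2 ⊢
    refine (lintegral_mono fun z => hpt z).trans ?_
    rw [lintegral_add_left (by fun_prop), lintegral_const_mul' _ _ (by finiteness),
      lintegral_const_mul' _ _ (by finiteness), lintegral_const_mul' _ _ (by finiteness),
      lintegral_add_left (by fun_prop), mul_add (ENNReal.ofReal (s ^ (q / (q + 1))))]
    refine add_le_add ?_ ?_
    · calc _ ≤ ENNReal.ofReal (s ^ (-(1 / (q + 1)))) *
            (fc d * (fσ (12 / 16 * D) * ENNReal.ofReal s)) := mul_le_mul_right hE' _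
        _ = ENNReal.ofReal (s ^ (-(1 / (q + 1)))) * ENNReal.ofReal s *
            (fc d * fσ (12 / 16 * D)) := by ring
        _ = _ := by rw [← ENNReal.ofReal_mul (by positivity), hs1]
    · rw [two_mul]
      exact mul_le_mul_right (mul_le_mul_right (add_le_add hG2 hG1) _) _
  have hfin := HA x₀ w h r ρ hwm (by linarith)
  refine hfin.trans ((mul_le_mul_right hint _).trans ?_)
  -- The exponent on the left is q times the quotient by q + 1 of the right side of the assumption
  -- on τ. Since |h| < 1, a smaller exponent gives a weaker bound.
  have hpow : ‖h‖ ^ κ * s ^ (q / (q + 1)) ≤ ‖h‖ ^ (τ * q) := by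
    rw [hs, ← Real.rpow_mul hhpos.le, ← Real.rpow_add hhpos]
    refine Real.rpow_le_rpow_of_exponent_ge hhpos (by linarith) ?_
    have e : κ + σ * q * (q / (q + 1)) =
        q * ((sp * p + (σ - ε) * (2 - p) + σ * q) / (q + 1)) := by
      rw [hκ, hm, hσ']; field_simp
    rw [e, mul_comm τ]
    gcongr
    rw [le_div_iff₀ hq1]; linarith
  calc _ = C * (ENNReal.ofReal (‖h‖ ^ κ) * ENNReal.ofReal (s ^ (q / (q + 1)))) *
        (fc d * fσ (12 / 16 * D) + ENNReal.ofReal (2 ^ m) * (2 * Y D)) := by ring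
    _ ≤ C * ENNReal.ofReal (‖h‖ ^ (τ * q)) *
        (fc d * fσ (12 / 16 * D) + ENNReal.ofReal (2 ^ m) * (2 * Y D)) := by
        rw [← ENNReal.ofReal_mul (by positivity)]
        gcongr
    _ = _ := by ring

/-! ### From second differences to first differences -/

/-- Comparison along dyadic dilations. -/
lemma le_of_doubling {E : Type*} [NormedAddCommGroup E] [NormedSpace ℝ E] {φ b : E → ℝ}
    {e : E → ℝ} {d : ℝ}
    (hφ : ∀ h, ‖h‖ ≤ d → φ h ≤ φ ((2 : ℝ) • h) / 2 + e h)
    (hbase : ∀ h, d < ‖h‖ → ‖h‖ ≤ 2 * d → φ h ≤ b h)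
    (hb : ∀ h, h ≠ 0 → ‖h‖ ≤ d → b ((2 : ℝ) • h) / 2 + e h ≤ b h) :
    ∀ h, h ≠ 0 → ‖h‖ ≤ 2 * d → φ h ≤ b h := by
  have key : ∀ n : ℕ, ∀ h, h ≠ 0 → d < 2 ^ n * ‖h‖ → ‖h‖ ≤ 2 * d → φ h ≤ b h := by
    intro n
    induction n with
    | zero => intro h _ h1 h2; exact hbase h (by simpa using h1) h2
    | succ n ih =>
      intro h h0 h1 h2
      rcases lt_or_ge d ‖h‖ with hlt | hle
      · exact hbase h hlt h2
      · have e1 : ‖(2 : ℝ) • h‖ = 2 * ‖h‖ := by rw [norm_smul]; simp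
        have := ih ((2 : ℝ) • h) (smul_ne_zero (by norm_num) h0)
          (by rw [e1]; rw [pow_succ] at h1; linarith)
          (by rw [e1]; linarith)
        linarith [hφ h hle, hb h h0 hle]
  intro h h0 h2
  have hpos : 0 < ‖h‖ := norm_pos_iff.2 h0
  obtain ⟨n, hn⟩ := pow_unbounded_of_one_lt (d / ‖h‖) (one_lt_two : (1 : ℝ) < 2)
  exact key n h h0 (by rwa [div_lt_iff₀ hpos] at hn) h2

/-- Order `τ ≠ 1` decay of second differences gives order `min τ 1` decay of first differences. -/
lemma doubling_bound {E : Type*} [NormedAddCommGroup E] [NormedSpace ℝ E] {τ : ℝ}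
    (hτ0 : 0 ≤ τ) (hτ1 : τ ≠ 1) : ∃ c : ℝ, 0 ≤ c ∧ ∀ (φ : E → ℝ) (d M K : ℝ), 0 < d → 2 * d ≤ 1 →
      0 ≤ M → 0 ≤ K →
      (∀ h, ‖h‖ ≤ d → φ h ≤ φ ((2 : ℝ) • h) / 2 + K * ‖h‖ ^ τ) →
      (∀ h, ‖h‖ ≤ 2 * d → φ h ≤ M) →
      ∀ h, h ≠ 0 → ‖h‖ ≤ 2 * d → φ h ≤ (M * d ^ (-(min τ 1)) + c * K) * ‖h‖ ^ (min τ 1) := by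
  have hnorm : ∀ h : E, ‖(2 : ℝ) • h‖ = 2 * ‖h‖ := fun h => by rw [norm_smul]; simp
  rcases lt_or_gt_of_ne hτ1 with hlt | hgt
  · have h2 : (2 : ℝ) ^ τ < 2 := by
      calc (2 : ℝ) ^ τ < 2 ^ (1 : ℝ) := Real.rpow_lt_rpow_of_exponent_lt (by norm_num) hlt
        _ = 2 := by norm_num
    set c : ℝ := (1 - 2 ^ τ / 2)⁻¹ with hc
    have hc0 : 0 < 1 - (2 : ℝ) ^ τ / 2 := by linarith
    refine ⟨c, by positivity, ?_⟩
    intro φ d M K hd hd1 hM hK hφ hφM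
    rw [min_eq_left hlt.le]
    refine le_of_doubling hφ ?_ ?_
    · intro h h1 h2
      refine (hφM h h2).trans ?_
      have e1 : 1 ≤ d ^ (-τ) * ‖h‖ ^ τ := by
        rw [Real.rpow_neg hd.le, inv_mul_eq_div, le_div_iff₀ (by positivity), one_mul]
        exact Real.rpow_le_rpow hd.le h1.le hτ0
      have e2 : 0 ≤ c * K * ‖h‖ ^ τ := by positivity
      nlinarith
    · intro h h0 h1
      rw [hnorm, Real.mul_rpow (by norm_num) (norm_nonneg _)]
      have e1 : (1 - (2 : ℝ) ^ τ / 2) * c = 1 := mul_inv_cancel₀ hc0.ne'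
      -- For τ < 1 the power Λ|h|^τ is itself a barrier: Λ2^τ/2 + K ≤ Λ, by the choice of c.
      set Λ := M * d ^ (-τ) + c * K with hΛ
      have e2 : K ≤ (1 - (2 : ℝ) ^ τ / 2) * Λ := by
        have : 0 ≤ M * d ^ (-τ) := by positivity
        calc K = (1 - (2 : ℝ) ^ τ / 2) * c * K := by rw [e1, one_mul]
          _ = (1 - (2 : ℝ) ^ τ / 2) * (0 + c * K) := by ring
          _ ≤ _ := by rw [hΛ]; gcongr
      have e3 : 0 ≤ ‖h‖ ^ τ := by positivity
      nlinarith
  · have h2 : (2 : ℝ) < 2 ^ τ := by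
      calc (2 : ℝ) = 2 ^ (1 : ℝ) := by norm_num
        _ < (2 : ℝ) ^ τ := Real.rpow_lt_rpow_of_exponent_lt (by norm_num) hgt
    set c : ℝ := (2 ^ τ / 2 - 1)⁻¹ with hc
    have hc0 : 0 < (2 : ℝ) ^ τ / 2 - 1 := by linarith
    refine ⟨c, by positivity, ?_⟩
    intro φ d M K hd hd1 hM hK hφ hφM h h0 hh
    rw [min_eq_right hgt.le]
    simp only [Real.rpow_one, Real.rpow_neg_one]
    -- For τ > 1 a linear function is invariant under b ↦ b(2h)/2 and absorbs no error. The
    -- subtracted term makes room for it, since (2^τ/2 − 1)c = 1, and |h| ≤ 1 keeps the barrier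
    -- above M at the starting scales.
    have hbd := le_of_doubling (b := fun h => (M * d⁻¹ + c * K) * ‖h‖ - c * K * ‖h‖ ^ τ) hφ ?_ ?_
      h h0 hh
    · have : 0 ≤ c * K * ‖h‖ ^ τ := by positivity
      linarith
    · intro h h1 h2
      refine (hφM h h2).trans ?_
      have e1 : 1 ≤ d⁻¹ * ‖h‖ := by
        rw [inv_mul_eq_div, le_div_iff₀ hd, one_mul]; exact h1.le
      have e2 : ‖h‖ ^ τ ≤ ‖h‖ := by
        calc ‖h‖ ^ τ ≤ ‖h‖ ^ (1 : ℝ) :=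
              Real.rpow_le_rpow_of_exponent_ge (by linarith) (by linarith) hgt.le
          _ = ‖h‖ := Real.rpow_one _
      have e3 : 0 ≤ c * K := by positivity
      nlinarith
    · intro h h0 h1
      simp only [hnorm]
      rw [Real.mul_rpow (by norm_num) (norm_nonneg _)]
      have e1 : ((2 : ℝ) ^ τ / 2 - 1) * c = 1 := mul_inv_cancel₀ hc0.ne'
      have e2 : ((2 : ℝ) ^ τ / 2 - 1) * (c * K) * ‖h‖ ^ τ = K * ‖h‖ ^ τ := by
        rw [← mul_assoc, e1, one_mul]
      linarith

lemma NormSol.lintegral_diff_le {p s₁ sp q : ℝ} {x₀ : Rn N} {R lam : ℝ} {u : Rn N → ℝ}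
    {Z : Rn N × Rn N → ℝ} (hu : NormSol s₁ sp p x₀ R lam u Z) (hq : 1 ≤ q) {r : ℝ} {h : Rn N}
    (hr : r < R) (hh : ‖h‖ ≤ R - r) :
    ∫⁻ x in Metric.ball x₀ r, ENNReal.ofReal (|diff u h x| ^ q) ≤
      ENNReal.ofReal (2 ^ q) * volume (Metric.ball (0 : Rn N) 1) := by
  calc _ ≤ ∫⁻ _ in Metric.ball x₀ r, ENNReal.ofReal (2 ^ q) := by
        refine setLIntegral_mono' Metric.isOpen_ball.measurableSet fun x hx => ?_
        refine ENNReal.ofReal_le_ofReal (Real.rpow_le_rpow (abs_nonneg _) ?_ (by linarith))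
        exact hu.abs_diff_le (Metric.ball_subset_ball (by linarith) hx)
          (add_mem_ball hx hh (by linarith))
    _ ≤ _ := by
        rw [setLIntegral_const, Measure.addHaar_ball_center volume x₀ r]
        exact mul_le_mul_right (measure_mono (Metric.ball_subset_ball (by linarith [hu.R_lt]))) _

lemma diff_two_smul (u : Rn N → ℝ) (h x : Rn N) :
    diff u h x = diff u ((2 : ℝ) • h) x / 2 - diff (diff u h) h x / 2 := by
  simp only [diff, two_smul, add_assoc]; ring

lemma lintegral_diff_rpow_le {u : Rn N → ℝ} (hu : Measurable u) {q : ℝ} (hq : 1 ≤ q)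
    (A : Set (Rn N)) (h : Rn N) :
    (∫⁻ x in A, ENNReal.ofReal (|diff u h x| ^ q)) ^ (1 / q) ≤
      ENNReal.ofReal 2⁻¹ * (∫⁻ x in A, ENNReal.ofReal (|diff u ((2 : ℝ) • h) x| ^ q)) ^ (1 / q) +
      ENNReal.ofReal 2⁻¹ * (∫⁻ x in A, ENNReal.ofReal (|diff (diff u h) h x| ^ q)) ^ (1 / q) := by
  have hq0 : 0 < q := by linarith
  have m1 : Measurable (diff u ((2 : ℝ) • h)) := measurable_diff hu _
  have m2 : Measurable (diff (diff u h) h) := measurable_diff (measurable_diff hu h) h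
  have hscale : ∀ f : Rn N → ℝ, ENNReal.ofReal 2⁻¹ *
      (∫⁻ x in A, ENNReal.ofReal (|f x| ^ q)) ^ (1 / q) =
      (∫⁻ x in A, ENNReal.ofReal (|f x / 2|) ^ q) ^ (1 / q) := by
    intro f
    have : ∀ x, ENNReal.ofReal (|f x / 2|) ^ q =
        ENNReal.ofReal 2⁻¹ ^ q * ENNReal.ofReal (|f x| ^ q) := fun x => by
      rw [← ENNReal.ofReal_rpow_of_nonneg (abs_nonneg _) hq0.le,
        ← ENNReal.mul_rpow_of_nonneg _ _ hq0.le,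
        ← ENNReal.ofReal_mul (by norm_num), abs_div, abs_two, div_eq_inv_mul]
    simp only [this]
    rw [lintegral_const_mul' _ _ (ENNReal.rpow_ne_top_of_nonneg hq0.le ENNReal.ofReal_ne_top),
      ENNReal.mul_rpow_of_nonneg _ _ (by positivity), ← ENNReal.rpow_mul,
      mul_one_div_cancel hq0.ne', ENNReal.rpow_one]
  rw [hscale, hscale]
  refine le_trans ?_ (ENNReal.lintegral_Lp_add_le (by fun_prop) (by fun_prop) hq)
  gcongr with x
  simp only [Pi.add_apply]
  rw [← ENNReal.ofReal_add (abs_nonneg _) (abs_nonneg _),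
    ENNReal.ofReal_rpow_of_nonneg (by positivity) hq0.le]
  refine ENNReal.ofReal_le_ofReal (Real.rpow_le_rpow (abs_nonneg _) ?_ hq0.le)
  conv_lhs => rw [diff_two_smul]
  exact abs_sub _ _

/-- By `diff_two_smul` and Minkowski's inequality, the L^q norm of δ_h u on a fixed ball satisfies
the doubling hypothesis with K a root of the second difference constant. No radius is lost, because
|2h| still fits in the margin. -/
lemma SecondDiffBound.first {p q s₁ sp τ : ℝ} (hq : 1 ≤ q) (hτ0 : 0 ≤ τ) (hτ1 : τ ≠ 1)
    (H : SecondDiffBound N p s₁ sp q τ) : FirstDiffBound N p s₁ sp q (min τ 1) := by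
  obtain ⟨F, hF, HF⟩ := H
  obtain ⟨c, hc, Hc⟩ := doubling_bound (E := Rn N) hτ0 hτ1
  have hq0 : 0 < q := by linarith
  set τ' := min τ 1 with hτ'
  have hτ'0 : 0 ≤ τ' := le_min hτ0 zero_le_one
  set V : ℝ≥0∞ := ENNReal.ofReal (2 ^ q) * volume (Metric.ball (0 : Rn N) 1) with hV
  have hVt : V ≠ ∞ := by
    have : volume (Metric.ball (0 : Rn N) 1) < ∞ := measure_ball_lt_top
    finiteness
  have hVt' : V ^ (1 / q) ≠ ∞ := ENNReal.rpow_ne_top_of_nonneg (by positivity) hVt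
  refine ⟨fun D => (V ^ (1 / q) * ENNReal.ofReal ((1 / 16 * D) ^ (-τ')) +
    ENNReal.ofReal c * F D ^ (1 / q)) ^ q, ?_, ?_⟩
  · refine PolyBound.rpow (((PolyBound.const hVt').mul ?_).add ((PolyBound.const (by simp)).mul
      (hF.rpow (by positivity)))) hq0.le
    exact (PolyBound.pow (-τ')).comp_mul (by norm_num) (by norm_num)
  intro x₀ R lam u Z hu r hr hrR h hh
  have hR1 := hu.R_lt
  set D := R - r with hD
  have hD0 : 0 < D := by linarith
  have hDI : D ∈ Ioo (0 : ℝ) 1 := ⟨hD0, by linarith⟩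
  set I : Rn N → ℝ≥0∞ := fun h =>
    (∫⁻ x in Metric.ball x₀ r, ENNReal.ofReal (|diff u h x| ^ q)) ^ (1 / q) with hI
  have hIV : ∀ h, ‖h‖ ≤ D → I h ≤ V ^ (1 / q) := fun h hh =>
    ENNReal.rpow_le_rpow (hu.lintegral_diff_le hq hrR hh) (by positivity)
  have hIt : ∀ h, ‖h‖ ≤ D → I h ≠ ∞ := fun h hh => ((hIV h hh).trans_lt hVt'.lt_top).ne
  have hFt : F D ^ (1 / q) ≠ ∞ :=
    ENNReal.rpow_ne_top_of_nonneg (by positivity) (hF.ne_top hDI)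
  have hsuff : I h ≤ (V ^ (1 / q) * ENNReal.ofReal ((1 / 16 * D) ^ (-τ')) +
      ENNReal.ofReal c * F D ^ (1 / q)) * ENNReal.ofReal (‖h‖ ^ τ') := by
    have hreal : ∀ h : Rn N, h ≠ 0 → ‖h‖ ≤ 2 * (1 / 16 * D) → (I h).toReal ≤
        ((V ^ (1 / q)).toReal * (1 / 16 * D) ^ (-τ') + c * (F D ^ (1 / q)).toReal) * ‖h‖ ^ τ' := by
      refine Hc (fun h => (I h).toReal) (1 / 16 * D) _ _ (by positivity) (by linarith)
        ENNReal.toReal_nonneg ENNReal.toReal_nonneg ?_ ?_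
      · intro h hh
        have h2 : ‖(2 : ℝ) • h‖ ≤ D := by rw [norm_smul]; norm_num; linarith
        have e1 := lintegral_diff_rpow_le hu.meas hq (Metric.ball x₀ r) h
        have e2 := ENNReal.rpow_le_rpow (HF x₀ R lam u Z hu r hr hrR h (by linarith))
          (show 0 ≤ 1 / q by positivity)
        rw [ENNReal.mul_rpow_of_nonneg _ _ (by positivity),
          ENNReal.ofReal_rpow_of_nonneg (by positivity) (by positivity),
          ← Real.rpow_mul (norm_nonneg _), mul_assoc, mul_one_div_cancel hq0.ne', mul_one] at e2
        have e3 : I h ≤ ENNReal.ofReal 2⁻¹ * I ((2 : ℝ) • h) +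
            ENNReal.ofReal 2⁻¹ * (F D ^ (1 / q) * ENNReal.ofReal (‖h‖ ^ τ)) :=
          e1.trans (add_le_add le_rfl (mul_le_mul_right e2 _))
        have hI2 := hIt _ h2
        have e4 := ENNReal.toReal_mono (by finiteness) e3
        rw [ENNReal.toReal_add (by finiteness) (by finiteness), ENNReal.toReal_mul,
          ENNReal.toReal_mul, ENNReal.toReal_mul, ENNReal.toReal_ofReal (by norm_num),
          ENNReal.toReal_ofReal (by positivity)] at e4
        have e5 : 0 ≤ (F D ^ (1 / q)).toReal * ‖h‖ ^ τ :=
          mul_nonneg ENNReal.toReal_nonneg (by positivity)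
        linarith
      · intro h hh
        exact ENNReal.toReal_mono hVt' (hIV h (by linarith))
    rcases eq_or_ne h 0 with rfl | h0
    · have : I 0 = 0 := by
        simp [hI, diff, Real.zero_rpow hq0.ne', hq0]
      rw [this]; exact zero_le
    rcases le_total ‖h‖ (2 * (1 / 16 * D)) with hle | hge
    · have := ENNReal.ofReal_le_ofReal (hreal h h0 hle)
      rw [ENNReal.ofReal_toReal (hIt h hh.le), ENNReal.ofReal_mul (by positivity),
        ENNReal.ofReal_add (by positivity) (by positivity), ENNReal.ofReal_mul (by positivity),
        ENNReal.ofReal_mul hc, ENNReal.ofReal_toReal hVt', ENNReal.ofReal_toReal hFt] at this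
      exact this
    -- For |h| comparable to the margin, boundedness of u suffices.
    · refine (hIV h hh.le).trans ?_
      have e1 : 1 ≤ (1 / 16 * D) ^ (-τ') * ‖h‖ ^ τ' := by
        rw [Real.rpow_neg (by positivity), inv_mul_eq_div, le_div_iff₀ (by positivity), one_mul]
        exact Real.rpow_le_rpow (by positivity) (by linarith) hτ'0
      calc V ^ (1 / q) = V ^ (1 / q) * ENNReal.ofReal 1 := by simp
        _ ≤ V ^ (1 / q) * ENNReal.ofReal ((1 / 16 * D) ^ (-τ') * ‖h‖ ^ τ') := by gcongr
        _ = V ^ (1 / q) * ENNReal.ofReal ((1 / 16 * D) ^ (-τ')) * ENNReal.ofReal (‖h‖ ^ τ') := by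
            rw [ENNReal.ofReal_mul (by positivity), mul_assoc]
        _ ≤ _ := by
            gcongr
            exact le_self_add
  have hfin := ENNReal.rpow_le_rpow hsuff hq0.le
  rw [hI] at hfin
  beta_reduce at hfin
  rw [← ENNReal.rpow_mul, one_div_mul_cancel hq0.ne', ENNReal.rpow_one,
    ENNReal.mul_rpow_of_nonneg _ _ hq0.le,
    ENNReal.ofReal_rpow_of_nonneg (by positivity) hq0.le, ← Real.rpow_mul (norm_nonneg _)] at hfin
  exact hfin

/-! ### The iteration up to order one -/

lemma firstDiffBound_zero {p q s₁ sp : ℝ} (hq : 1 ≤ q) : FirstDiffBound N p s₁ sp q 0 := by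
  refine ⟨fun _ => ENNReal.ofReal (2 ^ q) * volume (Metric.ball (0 : Rn N) 1),
    PolyBound.const ?_, ?_⟩
  · have : volume (Metric.ball (0 : Rn N) 1) < ∞ := measure_ball_lt_top
    finiteness
  intro x₀ R lam u Z hu r hr hrR h hh
  simpa using hu.lintegral_diff_le hq hrR hh.le

/-- Lipschitz bound in `L^q` for normalised solutions. -/
lemma firstDiffBound_one (hN : 2 ≤ N) {p q s₁ sp : ℝ} (hp : 1 < p) (hp2 : p < 2)
    (hs₁ : s₁ ∈ Ioo (0 : ℝ) 1) (hsp : sp ∈ Ioo ((p - 1) / p) 1) (hq : 1 ≤ q) :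
    FirstDiffBound N p s₁ sp q 1 := by
  have hp0 : 0 < p := by linarith
  have hsp' : sp ∈ Ioo (0 : ℝ) 1 := ⟨lt_trans (by apply div_pos <;> linarith) hsp.1, hsp.2⟩
  -- Positivity of this number is the only place where the lower bound on s_p beyond s_p > 0 is
  -- used.
  set γ := sp * p - (p - 1) with hγ
  have hγ0 : 0 < γ := by
    have := (div_lt_iff₀ hp0).1 hsp.1
    linarith
  have hγ1 : γ < 1 := by nlinarith [hsp.2]
  obtain ⟨n, hn⟩ := exists_nat_gt (2 * (q + 1) / γ)
  -- A multiple of 2/(2n+1) equals 1 only if 2n + 1 is even. The orders jg therefore never equal 1,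
  -- the exceptional order of the doubling argument.
  set g : ℝ := 2 / (2 * n + 1) with hg
  have hn1 : (0 : ℝ) < 2 * n + 1 := by positivity
  have hg0 : 0 < g := by positivity
  have hgγ : 2 * (q + 1) * g ≤ γ := by
    rw [div_lt_iff₀ hγ0] at hn
    rw [hg, mul_div_assoc', div_le_iff₀ hn1]
    nlinarith
  have key : ∀ j : ℕ, FirstDiffBound N p s₁ sp q (min (j * g) 1) := by
    intro j
    induction j with
    | zero => simpa using firstDiffBound_zero hq
    | succ j ih =>
      rcases le_or_gt 1 (j * g) with h | h
      · have h2 : 1 ≤ ((j + 1 : ℕ) : ℝ) * g := by push_cast; linarith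
        rw [min_eq_right h] at ih
        rwa [min_eq_right h2]
      · rw [min_eq_left h.le] at ih
        have hjg : 0 ≤ j * g := by positivity
        have hne : ((j + 1 : ℕ) : ℝ) * g ≠ 1 := by
          intro heq
          rw [hg, mul_div_assoc', div_eq_one_iff_eq hn1.ne'] at heq
          have h3 : (j + 1) * 2 = 2 * n + 1 := by exact_mod_cast heq
          omega
        refine SecondDiffBound.first hq (by positivity) hne ?_
        -- This ε satisfies εm ≤ 1 and ε(2−p) ≤ γ/2. For σ = jg < 1, s_p p − (p−1)σ − ε(2−p) is then
        -- at least γ/2, which covers (q+1)g.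
        refine ih.second (ε := γ / (2 * q)) hN hp hp2 hs₁ hsp' hq hjg (by positivity) ?_ ?_
        · have : γ / (2 * q) * ((2 - p) * q) = γ * (2 - p) / 2 := by field_simp
          rw [this]
          nlinarith
        · have hε : γ / (2 * q) ≤ γ / 2 := by
            gcongr; linarith
          have hε0 : 0 < γ / (2 * q) := by positivity
          push_cast
          nlinarith
  have h1 : (1 : ℝ) ≤ ((n + 1 : ℕ) : ℝ) * g := by
    rw [hg, mul_div_assoc', le_div_iff₀ hn1]; push_cast; linarith
  have := key (n + 1)
  rwa [min_eq_right h1] at this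

/-! ### Difference quotients and weak derivatives -/

open Filter Topology in
/-- Difference quotients converge to the weak derivative, in the sense of distributions. -/
lemma tendsto_integral_diffQuot {Ω : Set (Rn N)} (hΩ : IsOpen Ω) {u : Rn N → ℝ}
    (hu : LocallyIntegrableOn u Ω) {φ : Rn N → ℝ}
    (hφ : ContDiff ℝ ((⊤ : ℕ∞) : WithTop ℕ∞) φ) (hc : HasCompactSupport φ) (hs : tsupport φ ⊆ Ω)
    (e : Rn N) :
    Tendsto (fun t : ℝ => ∫ x, (t⁻¹ * diff u (t • e) x) * φ x) (𝓝[>] 0)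
      (𝓝 (-∫ x, u x * fderiv ℝ φ x e)) := by
  obtain ⟨δ, hδ, hδΩ⟩ := hc.isCompact.exists_cthickening_subset_open hΩ hs
  set K := Metric.cthickening δ (tsupport φ) with hK
  have hKc : IsCompact K := hc.isCompact.cthickening
  have hsub : tsupport φ ⊆ K := Metric.self_subset_cthickening _
  have huK : IntegrableOn u K := hu.integrableOn_compact_subset hδΩ hKc
  -- Truncation to a compact neighbourhood of the support makes u globally integrable without
  -- changing the integrals for small t.
  set v := K.indicator u with hv
  have hvi : Integrable v := (integrable_indicator_iff hKc.measurableSet).2 huK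
  obtain ⟨C, hC⟩ := ContDiff.lipschitzWith_of_hasCompactSupport hc hφ (by simp)
  -- The difference quotient is moved onto φ, which reverses the direction to −e.
  have h1 := hC.integral_inv_smul_sub_mul_tendsto_integral_lineDeriv_mul (μ := volume) hvi (-e)
  have hlim : ∫ x, lineDeriv ℝ φ x (-e) * v x = -∫ x, u x * fderiv ℝ φ x e := by
    rw [← integral_neg]
    refine integral_congr_ae (Eventually.of_forall fun x => ?_)
    have hd : DifferentiableAt ℝ φ x := (hφ.differentiable (by simp)) x
    simp only [hd.lineDeriv_eq_fderiv, map_neg]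
    by_cases hx : x ∈ K
    · rw [hv, indicator_of_mem hx]; ring
    · have : fderiv ℝ φ x = 0 := by
        have hx' : x ∉ tsupport φ := fun h => hx (hsub h)
        exact image_eq_zero_of_notMem_tsupport fun h => hx' (tsupport_fderiv_subset ℝ h)
      simp [this]
  rw [hlim] at h1
  refine h1.congr' ?_
  have hev : ∀ᶠ t : ℝ in 𝓝[>] 0, t * ‖e‖ < δ := by
    have : Tendsto (fun t : ℝ => t * ‖e‖) (𝓝[>] 0) (𝓝 (0 * ‖e‖)) :=
      (tendsto_id.mono_left nhdsWithin_le_nhds).mul_const _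
    rw [zero_mul] at this
    exact this.eventually (gt_mem_nhds hδ)
  filter_upwards [hev, self_mem_nhdsWithin] with t ht ht0
  have ht0' : (0 : ℝ) < t := ht0
  have hshift : ∀ x, diff u (t • e) x * φ x = (v (x + t • e) - v x) * φ x := by
    intro x
    by_cases hx : x ∈ tsupport φ
    · have hx' : x + t • e ∈ K := by
        refine Metric.mem_cthickening_of_dist_le _ x δ _ hx ?_
        rw [dist_eq_norm, add_sub_cancel_left, norm_smul, Real.norm_of_nonneg ht0'.le]
        exact ht.le
      rw [hv, indicator_of_mem hx', indicator_of_mem (hsub hx), diff]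
    · rw [image_eq_zero_of_notMem_tsupport hx]; simp
  have hφi : ∀ w : Rn N → ℝ, Integrable w → ∀ ψ : Rn N → ℝ, Continuous ψ → HasCompactSupport ψ →
      Integrable fun x => w x * ψ x := by
    intro w hw ψ hψ hψc
    obtain ⟨B, hB⟩ := hψc.exists_bound_of_continuous hψ
    exact hw.mul_bdd hψ.aestronglyMeasurable (Eventually.of_forall hB)
  have hφc : Continuous φ := hφ.continuous
  have hφs : Continuous fun x => φ (x + t • -e) := by fun_prop
  have hφsc : HasCompactSupport fun x => φ (x + t • -e) :=
    hc.comp_homeomorph (Homeomorph.addRight (t • -e))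
  have i1 := hφi _ (hvi.comp_add_right (t • e)) φ hφc hc
  have i2 := hφi _ hvi φ hφc hc
  have i3 := hφi _ hvi _ hφs hφsc
  have hI : ∫ x, v (x + t • e) * φ x = ∫ x, v x * φ (x + t • -e) := by
    rw [← integral_add_right_eq_self _ (t • -e)]
    simp
  calc ∫ x, (t⁻¹ • (φ (x + t • -e) - φ x)) * v x
      = t⁻¹ * ∫ x, (v x * φ (x + t • -e) - v x * φ x) := by
        rw [← integral_const_mul]
        refine integral_congr_ae (Eventually.of_forall fun x => ?_)
        simp only [smul_eq_mul]; ring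
    _ = t⁻¹ * ∫ x, (v (x + t • e) * φ x - v x * φ x) := by
        rw [integral_sub i3 i2, integral_sub i1 i2, hI]
    _ = _ := by
        rw [← integral_const_mul]
        refine integral_congr_ae (Eventually.of_forall fun x => ?_)
        simp only
        rw [mul_assoc, hshift]; ring

/-- Jensen's inequality for the probability measure with density w. -/
lemma rpow_lintegral_mul_le {X : Type*} [MeasurableSpace X] {μ : Measure X} {q : ℝ} (hq : 1 ≤ q)
    {f w : X → ℝ≥0∞} (hf : AEMeasurable f μ) (hw : Measurable w) (hw1 : ∫⁻ x, w x ∂μ = 1) :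
    (∫⁻ x, f x * w x ∂μ) ^ q ≤ ∫⁻ x, f x ^ q * w x ∂μ := by
  have hq0 : 0 < q := by linarith
  have hprob : IsProbabilityMeasure (μ.withDensity w) := ⟨by
    rw [withDensity_apply _ MeasurableSet.univ, Measure.restrict_univ, hw1]⟩
  have hf' : AEMeasurable f (μ.withDensity w) := hf.mono_ac (withDensity_absolutelyContinuous μ w)
  have h1 : ∀ g : X → ℝ≥0∞, AEMeasurable g μ →
      ∫⁻ x, g x * w x ∂μ = ∫⁻ x, g x ∂(μ.withDensity w) := by
    intro g hg
    rw [lintegral_withDensity_eq_lintegral_mul₀ hw.aemeasurable hg]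
    simp only [Pi.mul_apply, mul_comm]
  rw [h1 f hf, h1 _ (hf.pow_const q)]
  have := eLpNorm'_le_eLpNorm'_of_exponent_le (μ := μ.withDensity w) (f := f) one_pos hq
    hf'.aestronglyMeasurable
  simp only [eLpNorm', enorm_eq_self, ENNReal.rpow_one, div_one] at this
  calc _ ≤ ((∫⁻ x, f x ^ q ∂(μ.withDensity w)) ^ (1 / q)) ^ q := ENNReal.rpow_le_rpow this hq0.le
    _ = _ := by rw [← ENNReal.rpow_mul, one_div_mul_cancel hq0.ne', ENNReal.rpow_one]

open Filter Topology in
/-- Weak lower semicontinuity of the `L^q` norm under distributional convergence. -/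
lemma lintegral_rpow_le_of_tendsto {q : ℝ} (hq : 1 ≤ q) {x₀ : Rn N} {r r' : ℝ} (hrr : r < r')
    {G : Rn N → ℝ} (hG : IntegrableOn G (Metric.ball x₀ r')) {f : ℕ → Rn N → ℝ}
    (hf : ∀ k, AEMeasurable (f k)) {T : ℝ≥0∞}
    (hT : ∀ k, ∫⁻ x in Metric.ball x₀ r', ENNReal.ofReal (|f k x| ^ q) ≤ T)
    (hlim : ∀ φ : Rn N → ℝ, ContDiff ℝ ((⊤ : ℕ∞) : WithTop ℕ∞) φ → HasCompactSupport φ →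
      tsupport φ ⊆ Metric.ball x₀ r' →
      Tendsto (fun k => ∫ x, f k x * φ x) atTop (𝓝 (∫ x, G x * φ x))) :
    ∫⁻ x in Metric.ball x₀ r, ENNReal.ofReal (|G x| ^ q) ≤ T := by
  have hq0 : 0 < q := by linarith
  set B' := Metric.ball x₀ r' with hB'
  have hB'm : MeasurableSet B' := Metric.isOpen_ball.measurableSet
  set G' := B'.indicator G with hG'
  have hG'i : Integrable G' := (integrable_indicator_iff hB'm).2 hG
  -- Mollifiers of radius below r' − r: centred at points of the small ball, they are admissible
  -- test functions on the large one.
  set ρ : ℕ → ContDiffBump (0 : Rn N) := fun n =>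
    ⟨(r' - r) / (n + 2) / 2, (r' - r) / (n + 2), by
      have : 0 < r' - r := by linarith
      positivity, by
      have : 0 < r' - r := by linarith
      exact half_lt_self (by positivity)⟩ with hρ
  have hrout : ∀ n, (ρ n).rOut = (r' - r) / (n + 2) := fun n => rfl
  have hrout0 : Tendsto (fun n => (ρ n).rOut) atTop (𝓝 0) := by
    simp only [hrout]
    have h1 : Tendsto (fun n : ℕ => (n : ℝ) + 2) atTop atTop :=
      tendsto_atTop_add_const_right _ _ tendsto_natCast_atTop_atTop
    exact tendsto_const_nhds.div_atTop h1
  have hroutlt : ∀ n, (ρ n).rOut < r' - r := fun n => by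
    rw [hrout, div_lt_iff₀ (by positivity)]
    have h1 : 0 < r' - r := by linarith
    have h2 : (0 : ℝ) ≤ n := by positivity
    nlinarith
  have hae := ContDiffBump.ae_convolution_tendsto_right_of_locallyIntegrable (φ := ρ) (K := 2)
    (μ := volume) hrout0 (Eventually.of_forall fun n => by
      change (r' - r) / (n + 2) ≤ 2 * ((r' - r) / (n + 2) / 2); linarith)
    hG'i.locallyIntegrable
  set w : ℕ → Rn N → ℝ := fun n => (ρ n).normed volume with hw
  have hwc : ∀ n, Continuous (w n) := fun n => (ρ n).continuous_normed
  have hw0 : ∀ n x, 0 ≤ w n x := fun n x => (ρ n).nonneg_normed x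
  have hw1 : ∀ n, ∫⁻ x, ENNReal.ofReal (w n x) = 1 := fun n => by
    rw [← ofReal_integral_eq_lintegral_ofReal ((ρ n).integrable_normed)
      (Eventually.of_forall fun x => hw0 n x), (ρ n).integral_normed, ENNReal.ofReal_one]
  have hmeas : ∀ k, AEMeasurable (fun z : Rn N × Rn N => ENNReal.ofReal (|f k z.2| ^ q))
      (volume.prod volume) := fun k =>
    (((hf k).norm.pow_const q).ennreal_ofReal).comp_quasiMeasurePreserving
      Measure.quasiMeasurePreserving_snd
  -- At fixed n the mollification at x is the limit over k of f_k paired with a test function.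
  -- Jensen, Fatou in k and Tonelli bound its L^q integral by T.
  have hstep : ∀ n, ∫⁻ x in Metric.ball x₀ r, ENNReal.ofReal
      (|(convolution (w n) G' (ContinuousLinearMap.lsmul ℝ ℝ) volume) x| ^ q) ≤ T := by
    intro n
    have hpt : ∀ x ∈ Metric.ball x₀ r, ENNReal.ofReal
        (|(convolution (w n) G' (ContinuousLinearMap.lsmul ℝ ℝ) volume) x| ^ q) ≤
        liminf (fun k => ∫⁻ y in B', ENNReal.ofReal (|f k y| ^ q) * ENNReal.ofReal (w n (x - y)))
          atTop := by
      intro x hx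
      set φ : Rn N → ℝ := fun y => w n (x - y) with hφ
      have hsupp : ∀ y, φ y ≠ 0 → y ∈ Metric.ball x (ρ n).rOut := by
        intro y hy
        have : x - y ∈ Function.support ((ρ n).normed volume) := hy
        rw [(ρ n).support_normed_eq, mem_ball_zero_iff] at this
        rwa [Metric.mem_ball, dist_comm, dist_eq_norm]
      have hts : tsupport φ ⊆ Metric.closedBall x (ρ n).rOut := by
        refine closure_minimal (fun y hy => ?_) Metric.isClosed_closedBall
        exact Metric.ball_subset_closedBall (hsupp y hy)
      have hts' : Metric.closedBall x (ρ n).rOut ⊆ B' := by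
        refine Metric.closedBall_subset_ball' ?_
        rw [Metric.mem_ball] at hx
        linarith [hroutlt n]
      have hφc : HasCompactSupport φ :=
        (isCompact_closedBall x (ρ n).rOut).of_isClosed_subset (isClosed_tsupport _) hts
      have hφd : ContDiff ℝ ((⊤ : ℕ∞) : WithTop ℕ∞) φ :=
        (ρ n).contDiff_normed.comp (contDiff_const.sub contDiff_id)
      have hzero : ∀ y, y ∉ B' → φ y = 0 := fun y hy => by
        by_contra h
        exact hy (hts' (Metric.ball_subset_closedBall (hsupp y h)))
      have hconv : (convolution (w n) G' (ContinuousLinearMap.lsmul ℝ ℝ) volume) x =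
          ∫ y, G y * φ y := by
        rw [convolution_eq_swap]
        refine integral_congr_ae (Eventually.of_forall fun y => ?_)
        simp only [ContinuousLinearMap.lsmul_apply, smul_eq_mul, hG']
        by_cases hy : y ∈ B'
        · rw [indicator_of_mem hy, mul_comm]
        · rw [indicator_of_notMem hy, hzero y hy]; simp
      have hl := hlim φ hφd hφc (hts.trans hts')
      rw [hconv]
      have hl2 : Tendsto (fun k => ENNReal.ofReal (|∫ y, f k y * φ y| ^ q)) atTop
          (𝓝 (ENNReal.ofReal (|∫ y, G y * φ y| ^ q))) := by
        refine (ENNReal.continuous_ofReal.tendsto _).comp ?_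
        exact (hl.abs).rpow_const (Or.inr hq0.le)
      rw [← hl2.liminf_eq]
      refine liminf_le_liminf (Eventually.of_forall fun k => ?_)
      have hφ1 : ∫⁻ y, ENNReal.ofReal (φ y) = 1 := by
        rw [← hw1 n, ← lintegral_sub_left_eq_self (fun y => ENNReal.ofReal (w n y)) x]
      calc ENNReal.ofReal (|∫ y, f k y * φ y| ^ q)
          = ENNReal.ofReal (|∫ y, f k y * φ y|) ^ q := by
            rw [ENNReal.ofReal_rpow_of_nonneg (abs_nonneg _) hq0.le]
        _ ≤ (∫⁻ y, ENNReal.ofReal |f k y| * ENNReal.ofReal (φ y)) ^ q := by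
            refine ENNReal.rpow_le_rpow ?_ hq0.le
            rw [← Real.norm_eq_abs, ofReal_norm]
            refine (enorm_integral_le_lintegral_enorm _).trans (lintegral_mono fun y => ?_)
            rw [← ofReal_norm, Real.norm_eq_abs, abs_mul, ENNReal.ofReal_mul (abs_nonneg _),
              abs_of_nonneg (hw0 n _)]
        _ ≤ ∫⁻ y, ENNReal.ofReal |f k y| ^ q * ENNReal.ofReal (φ y) :=
            rpow_lintegral_mul_le hq (hf k).norm.ennreal_ofReal
              hφd.continuous.measurable.ennreal_ofReal hφ1
        _ = ∫⁻ y in B', ENNReal.ofReal (|f k y| ^ q) * ENNReal.ofReal (φ y) := by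
            rw [← lintegral_indicator hB'm]
            refine lintegral_congr fun y => ?_
            rw [ENNReal.ofReal_rpow_of_nonneg (abs_nonneg _) hq0.le]
            by_cases hy : y ∈ B'
            · rw [indicator_of_mem hy]
            · rw [indicator_of_notMem hy, hzero y hy]; simp
        _ = _ := rfl
    refine (setLIntegral_mono' Metric.isOpen_ball.measurableSet hpt).trans ?_
    have hwm : Measurable fun z : Rn N × Rn N => ENNReal.ofReal (w n (z.1 - z.2)) :=
      ((hwc n).comp (by fun_prop : Continuous fun z : Rn N × Rn N =>
        z.1 - z.2)).measurable.ennreal_ofReal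
    have hjoint : ∀ k, AEMeasurable (fun z : Rn N × Rn N =>
        ENNReal.ofReal (|f k z.2| ^ q) * ENNReal.ofReal (w n (z.1 - z.2)))
        ((volume.restrict (Metric.ball x₀ r)).prod (volume.restrict B')) := fun k =>
      ((hmeas k).mul hwm.aemeasurable).mono_measure (by
        rw [Measure.prod_restrict]; exact Measure.restrict_le_self)
    refine (lintegral_liminf_le' fun k => (hjoint k).lintegral_prod_right').trans ?_
    refine (liminf_le_liminf (Eventually.of_forall fun k => ?_)).trans
      (liminf_const T).le
    rw [lintegral_lintegral_swap (hjoint k)]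
    refine le_trans (lintegral_mono fun y => ?_) (hT k)
    change ∫⁻ x in Metric.ball x₀ r, ENNReal.ofReal (|f k y| ^ q) * ENNReal.ofReal (w n (x - y)) ≤ _
    rw [lintegral_const_mul' _ _ (by finiteness)]
    calc _ ≤ ENNReal.ofReal (|f k y| ^ q) * 1 := by
          gcongr
          refine (setLIntegral_le_lintegral _ _).trans (le_of_eq ?_)
          rw [← hw1 n, ← lintegral_sub_right_eq_self (fun y => ENNReal.ofReal (w n y)) y]
      _ = _ := mul_one _
  -- The mollifications converge almost everywhere, and a second use of Fatou's lemma, in n,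
  -- transfers the bound to G.
  have hlimG : ∀ᵐ x ∂(volume.restrict (Metric.ball x₀ r)), ENNReal.ofReal (|G x| ^ q) ≤
      liminf (fun n => ENNReal.ofReal
        (|(convolution (w n) G' (ContinuousLinearMap.lsmul ℝ ℝ) volume) x| ^ q)) atTop := by
    filter_upwards [ae_restrict_of_ae hae, ae_restrict_mem Metric.isOpen_ball.measurableSet] with
      x hx hxr
    have hxB : x ∈ B' := Metric.ball_subset_ball hrr.le hxr
    have : G' x = G x := indicator_of_mem hxB _
    rw [← this]
    have hl2 : Tendsto (fun n => ENNReal.ofReal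
        (|(convolution (w n) G' (ContinuousLinearMap.lsmul ℝ ℝ) volume) x| ^ q)) atTop
        (𝓝 (ENNReal.ofReal (|G' x| ^ q))) := by
      refine (ENNReal.continuous_ofReal.tendsto _).comp ?_
      exact (hx.abs).rpow_const (Or.inr hq0.le)
    exact hl2.liminf_eq.ge
  refine (lintegral_mono_ae hlimG).trans ?_
  refine (lintegral_liminf_le fun n => ?_).trans ?_
  · have : Continuous (convolution (w n) G' (ContinuousLinearMap.lsmul ℝ ℝ) volume) :=
      HasCompactSupport.continuous_convolution_left _ (ρ n).hasCompactSupport_normed (hwc n)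
        hG'i.locallyIntegrable
    exact (this.measurable.abs.pow_const q).ennreal_ofReal
  · exact (liminf_le_liminf (Eventually.of_forall hstep)).trans (liminf_const T).le

open Filter Topology in
/-- Weak sequential compactness of bounded sequences in a real Hilbert space. -/
lemma exists_inner_eq_of_tendsto {E : Type*} [NormedAddCommGroup E] [InnerProductSpace ℝ E]
    [CompleteSpace E] (h : ℕ → E) {C : ℝ} (hb : ∀ k, ‖h k‖ ≤ C) :
    ∃ H : E, ∀ (ψ : E) (l : ℝ), Tendsto (fun k => inner ℝ (h k) ψ) atTop (𝓝 l) →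
      inner ℝ H ψ = l := by
  set F : ℕ → WeakDual ℝ E := fun k =>
    StrongDual.toWeakDual (InnerProductSpace.toDual ℝ E (h k)) with hF
  have hK := WeakDual.isCompact_closedBall (𝕜 := ℝ) (0 : StrongDual ℝ E) C
  -- Banach–Alaoglu along a free ultrafilter: no subsequence and no separability are needed, because
  -- only pairings that already converge have to be identified.
  obtain ⟨L, -, hL⟩ := hK.ultrafilter_le_nhds ((hyperfilter ℕ).map F) (by
    rw [Ultrafilter.coe_map]
    refine tendsto_principal.2 (Eventually.of_forall fun k => ?_)
    have : InnerProductSpace.toDual ℝ E (h k) ∈ Metric.closedBall (0 : StrongDual ℝ E) C := by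
      rw [mem_closedBall_zero_iff, LinearIsometryEquiv.norm_map]
      exact hb k
    exact this)
  refine ⟨(InnerProductSpace.toDual ℝ E).symm (WeakDual.toStrongDual L), fun ψ l hl => ?_⟩
  rw [InnerProductSpace.toDual_symm_apply]
  have h1 : Tendsto (fun k => inner ℝ (h k) ψ) (hyperfilter ℕ : Filter ℕ) (𝓝 (L ψ)) := by
    have hc : Tendsto (fun φ : WeakDual ℝ E => φ ψ) (𝓝 L) (𝓝 (L ψ)) :=
      (WeakDual.eval_continuous ψ).tendsto L
    exact hc.comp hL
  exact tendsto_nhds_unique h1 (hl.mono_left (by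
    rw [← Nat.cofinite_eq_atTop]; exact hyperfilter_le_cofinite))

lemma exists_pos_forall_le_le {a : ℕ → ℝ} (ha : ∀ n, 0 < a n) (J : ℕ) :
    ∃ m, 0 < m ∧ ∀ n ≤ J, m ≤ a n := by
  obtain ⟨n, -, hn⟩ := Finset.exists_min_image (Finset.range (J + 1)) a ⟨0, by simp⟩
  exact ⟨a n, ha n, fun k hk => hn k (by simp; omega)⟩

open Filter Topology in
/-- A locally integrable function whose difference quotients in direction `e` are locally bounded
in `L²` has a weak derivative in direction `e`. -/
lemma exists_weakDeriv {Ω : Set (Rn N)} (hΩ : IsOpen Ω) {u : Rn N → ℝ} (hum : AEMeasurable u)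
    (hu : LocallyIntegrableOn u Ω) (e : Rn N)
    (h : ∀ x ∈ Ω, ∃ ρ > 0, ∃ δ > 0, ∃ C : NNReal, ∀ t : ℝ, 0 < t → t < δ →
      ∫⁻ y in Metric.ball x ρ, ‖t⁻¹ * diff u (t • e) y‖ₑ ^ (2 : ℝ) ≤ C) :
    ∃ G : Rn N → ℝ, LocallyIntegrableOn G Ω ∧
      ∀ φ : Rn N → ℝ, ContDiff ℝ ((⊤ : ℕ∞) : WithTop ℕ∞) φ → HasCompactSupport φ →
        tsupport φ ⊆ Ω → ∫ x, G x * φ x = -∫ x, u x * fderiv ℝ φ x e := by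
  rcases Ω.eq_empty_or_nonempty with rfl | hne
  · refine ⟨0, by simp [LocallyIntegrableOn], fun φ _ _ hs => ?_⟩
    have hφ : φ = 0 := tsupport_eq_empty_iff.1 (subset_empty_iff.1 hs)
    subst hφ
    simp
  choose! ρ hρ δ hδ C hC using h
  obtain ⟨T, hTΩ, hTc, hTcov⟩ := TopologicalSpace.countable_cover_nhdsWithin (s := Ω)
    (f := fun x => Metric.ball x (ρ x))
    (fun x hx => mem_nhdsWithin_of_mem_nhds (Metric.ball_mem_nhds x (hρ x hx)))
  have hTne : T.Nonempty := by
    obtain ⟨x, hx⟩ := hne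
    obtain ⟨i, hi, -⟩ := mem_iUnion₂.1 (hTcov hx)
    exact ⟨i, hi⟩
  obtain ⟨c, rfl⟩ := hTc.exists_eq_range hTne
  have hcΩ : ∀ n, c n ∈ Ω := fun n => hTΩ (mem_range_self n)
  set B : ℕ → Set (Rn N) := fun n => Metric.ball (c n) (ρ (c n)) with hB
  have hBo : ∀ n, IsOpen (B n) := fun n => Metric.isOpen_ball
  have hcov : Ω ⊆ ⋃ n, B n := by simpa only [biUnion_range] using hTcov
  have hex : ∀ x, ∃ n, x ∈ B n ∪ Ωᶜ := fun x => by
    by_cases hx : x ∈ Ω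
    · obtain ⟨n, hn⟩ := mem_iUnion.1 (hcov hx)
      exact ⟨n, Or.inl hn⟩
    · exact ⟨0, Or.inr hx⟩
  classical
  set j : Rn N → ℕ := fun x => Nat.find (hex x) with hj
  have hjm : Measurable j := measurable_find hex fun n =>
    (hBo n).measurableSet.union hΩ.measurableSet.compl
  have hjB : ∀ x ∈ Ω, x ∈ B (j x) := fun x hx =>
    (Nat.find_spec (hex x)).resolve_right fun h => h hx
  have hjle : ∀ n, ∀ x ∈ B n, j x ≤ n := fun n x hx => Nat.find_min' (hex x) (Or.inl hx)
  obtain ⟨ε, hε, hεsum⟩ := ENNReal.exists_pos_sum_of_countable (ε := 1) one_ne_zero ℕ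
  -- The local L² bounds are not uniform over Ω. Giving the n-th ball of a countable cover the
  -- weight a_n makes the weighted bounds sum to at most 1, so a single weak limit on all of Ω
  -- suffices and no gluing is required.
  set a : ℕ → ℝ := fun n => ε n / (C (c n) + 1) with ha
  have ha0 : ∀ n, 0 < a n := fun n => by
    have := hε n
    simp only [ha]; positivity
  set t : ℕ → ℝ := fun k => 1 / ((k : ℝ) + 1) with ht
  have ht0 : ∀ k, 0 < t k := fun k => by simp only [ht]; positivity
  have htlim : Tendsto t atTop (𝓝 0) := tendsto_one_div_add_atTop_nhds_zero_nat
  set D : ℕ → Rn N → ℝ := fun k x => (t k)⁻¹ * diff u (t k • e) x with hD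
  have hDm : ∀ k, AEMeasurable (D k) := fun k => by
    refine AEMeasurable.const_mul ?_ _
    exact (hum.comp_quasiMeasurePreserving
      (measurePreserving_add_right volume (t k • e)).quasiMeasurePreserving).sub hum
  -- A point takes the weight of the first ball containing it. The quotient is replaced by zero
  -- while t_k is too large for that ball's bound.
  set hh : ℕ → Rn N → ℝ := fun k x =>
    Real.sqrt (a (j x)) * (if t k < δ (c (j x)) then D k x else 0) with hhh
  have hcj : ∀ f : ℕ → ℝ, Measurable fun x => f (j x) := fun f =>
    (measurable_of_countable f).comp hjm
  have hhm : ∀ k, AEMeasurable (hh k) := fun k => by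
    refine (hcj fun n => Real.sqrt (a n)).aemeasurable.mul ?_
    have : (fun x => if t k < δ (c (j x)) then D k x else 0) =
        fun x => (if t k < δ (c (j x)) then (1 : ℝ) else 0) * D k x := by
      funext x; split_ifs <;> simp
    rw [this]
    exact (hcj fun n => if t k < δ (c n) then (1 : ℝ) else 0).aemeasurable.mul (hDm k)
  have hhb : ∀ k, ∫⁻ x in Ω, ‖hh k x‖ₑ ^ (2 : ℝ) ≤ 1 := fun k => by
    have hpt : ∀ x ∈ Ω, ‖hh k x‖ₑ ^ (2 : ℝ) ≤ ∑' n, (B n).indicator (fun x =>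
        ENNReal.ofReal (a n) * (if t k < δ (c n) then ‖D k x‖ₑ ^ (2 : ℝ) else 0)) x := by
      intro x hx
      refine le_trans ?_ (ENNReal.le_tsum (j x))
      rw [indicator_of_mem (hjB x hx)]
      simp only [hhh]
      rw [enorm_mul, ENNReal.mul_rpow_of_nonneg _ _ (by norm_num)]
      refine mul_le_mul' (le_of_eq ?_) ?_
      · rw [Real.enorm_of_nonneg (Real.sqrt_nonneg _),
          ENNReal.ofReal_rpow_of_nonneg (Real.sqrt_nonneg _) (by norm_num)]
        congr 1
        rw [Real.rpow_two, Real.sq_sqrt (ha0 _).le]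
      · split_ifs <;> simp
    refine (setLIntegral_mono' hΩ.measurableSet hpt).trans ?_
    have hmn : ∀ n, AEMeasurable ((B n).indicator (fun x =>
        ENNReal.ofReal (a n) * (if t k < δ (c n) then ‖D k x‖ₑ ^ (2 : ℝ) else 0)))
        (volume.restrict Ω) := fun n => by
      refine AEMeasurable.indicator ?_ (hBo n).measurableSet
      refine AEMeasurable.const_mul ?_ _
      by_cases hlt : t k < δ (c n)
      · simp only [hlt, if_true]
        exact ((hDm k).enorm.pow_const _).restrict
      · simp only [hlt, if_false]; exact aemeasurable_const
    rw [lintegral_tsum hmn]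
    refine le_trans (ENNReal.tsum_le_tsum fun n => ?_) hεsum.le
    refine (setLIntegral_le_lintegral _ _).trans ?_
    rw [lintegral_indicator (hBo n).measurableSet, lintegral_const_mul' _ _ ENNReal.ofReal_ne_top]
    have : ∫⁻ x in B n, (if t k < δ (c n) then ‖D k x‖ₑ ^ (2 : ℝ) else 0) ≤ C (c n) := by
      by_cases hlt : t k < δ (c n)
      · simp only [hlt, if_true]
        exact hC _ (hcΩ n) _ (ht0 k) hlt
      · simp [hlt]
    refine (mul_le_mul_right this _).trans ?_
    rw [← ENNReal.ofReal_coe_nnreal (p := C (c n)), ← ENNReal.ofReal_mul (ha0 n).le,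
      ← ENNReal.ofReal_coe_nnreal (p := ε n)]
    refine ENNReal.ofReal_le_ofReal ?_
    simp only [ha]
    rw [div_mul_eq_mul_div, div_le_iff₀ (by positivity)]
    have := (hε n)
    have h2 : (0 : ℝ) < ε n := this
    nlinarith
  have hLp : ∀ k, MemLp (hh k) 2 (volume.restrict Ω) ∧
      eLpNorm (hh k) 2 (volume.restrict Ω) ≤ 1 := fun k => by
    have : eLpNorm (hh k) 2 (volume.restrict Ω) ≤ 1 := by
      rw [eLpNorm_eq_lintegral_rpow_enorm_toReal (by norm_num) (by norm_num)]
      simp only [ENNReal.toReal_ofNat]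
      calc _ ≤ (1 : ℝ≥0∞) ^ (1 / (2 : ℝ)) := ENNReal.rpow_le_rpow (hhb k) (by norm_num)
        _ = 1 := ENNReal.one_rpow _
    exact ⟨⟨(hhm k).aestronglyMeasurable.restrict, this.trans_lt ENNReal.one_lt_top⟩, this⟩
  obtain ⟨H, hH⟩ := exists_inner_eq_of_tendsto (E := Lp ℝ 2 (volume.restrict Ω))
    (fun k => (hLp k).1.toLp (hh k)) (C := 1) (fun k => by
      rw [Lp.norm_toLp]
      exact ENNReal.toReal_le_of_le_ofReal zero_le_one (by simpa using (hLp k).2))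
  have hHm : MemLp (H : Rn N → ℝ) 2 (volume.restrict Ω) := Lp.memLp H
  refine ⟨fun x => (Real.sqrt (a (j x)))⁻¹ * H x, ?_, ?_⟩
  · intro x hx
    obtain ⟨m, hm0, hm⟩ := exists_pos_forall_le_le ha0 (j x)
    refine ⟨Metric.ball (c (j x)) (ρ (c (j x))) ∩ Ω, ?_, ?_⟩
    · exact inter_mem (mem_nhdsWithin_of_mem_nhds ((hBo _).mem_nhds (hjB x hx)))
        self_mem_nhdsWithin
    · have hfin : IsFiniteMeasure (volume.restrict (B (j x) ∩ Ω)) := ⟨by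
        rw [Measure.restrict_apply_univ]
        exact (measure_mono inter_subset_left).trans_lt measure_ball_lt_top⟩
      have h2 : MemLp (H : Rn N → ℝ) 2 (volume.restrict (B (j x) ∩ Ω)) :=
        hHm.mono_measure (Measure.restrict_mono inter_subset_right le_rfl)
      have h1 : Integrable (H : Rn N → ℝ) (volume.restrict (B (j x) ∩ Ω)) :=
        h2.integrable (by norm_num)
      refine Integrable.bdd_mul (c := (Real.sqrt m)⁻¹) h1
        ((hcj fun n => (Real.sqrt (a n))⁻¹).aestronglyMeasurable) ?_
      filter_upwards [ae_restrict_mem ((hBo _).measurableSet.inter hΩ.measurableSet)] with y hy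
      rw [Real.norm_of_nonneg (by positivity)]
      have := hm _ (hjle _ y hy.1)
      gcongr
  · intro φ hφ hc hs
    -- On the support of φ only finitely many weights occur. Dividing by them keeps the test
    -- function in L², and the cut on t_k is eventually inactive.
    obtain ⟨I, hI⟩ := hc.isCompact.elim_finite_subcover B hBo (hs.trans hcov)
    set J := I.sup id with hJ
    have hjJ : ∀ x ∈ tsupport φ, j x ≤ J := fun x hx => by
      obtain ⟨n, hn, hxn⟩ := mem_iUnion₂.1 (hI hx)
      exact (hjle n x hxn).trans (Finset.le_sup (f := id) hn)
    obtain ⟨m, hm0, hm⟩ := exists_pos_forall_le_le ha0 J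
    obtain ⟨d, hd0, hd⟩ := exists_pos_forall_le_le (fun n => hδ (c n) (hcΩ n)) J
    set ψ : Rn N → ℝ := fun x => (Real.sqrt (a (j x)))⁻¹ * φ x with hψ
    have hψm : AEStronglyMeasurable ψ (volume.restrict Ω) :=
      ((hcj fun n => (Real.sqrt (a n))⁻¹).mul hφ.continuous.measurable).aestronglyMeasurable
    have hφL : MemLp φ 2 (volume.restrict Ω) :=
      (hφ.continuous.memLp_of_hasCompactSupport hc).restrict _
    have hψL : MemLp ψ 2 (volume.restrict Ω) := by
      refine hφL.of_le_mul (c := (Real.sqrt m)⁻¹) hψm (Eventually.of_forall fun x => ?_)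
      by_cases hx : x ∈ tsupport φ
      · rw [hψ, norm_mul, Real.norm_of_nonneg (by positivity)]
        have := hm _ (hjJ x hx)
        gcongr
      · simp [hψ, image_eq_zero_of_notMem_tsupport hx]
    have hoff : ∀ (g : Rn N → ℝ), ∫ x in Ω, g x * φ x = ∫ x, g x * φ x := fun g =>
      setIntegral_eq_integral_of_forall_compl_eq_zero fun x hx => by
        rw [image_eq_zero_of_notMem_tsupport fun h => hx (hs h), mul_zero]
    have hlim := (tendsto_integral_diffQuot hΩ hu hφ hc hs e).comp
      (tendsto_nhdsWithin_iff.2 ⟨htlim, Eventually.of_forall fun k => ht0 k⟩)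
    have := hH (hψL.toLp ψ) _ (hlim.congr' ?_)
    · rw [← this, L2.inner_def, ← hoff]
      refine integral_congr_ae ?_
      filter_upwards [hψL.coeFn_toLp] with x hx
      rw [hx]
      simp only [hψ, RCLike.inner_apply, conj_trivial]
      ring
    · filter_upwards [htlim.eventually (gt_mem_nhds hd0)] with k hk
      change ∫ x, D k x * φ x = _
      rw [L2.inner_def, ← hoff]
      refine integral_congr_ae ?_
      filter_upwards [hψL.coeFn_toLp, (hLp k).1.coeFn_toLp] with x hx hx'
      rw [hx, hx']
      simp only [hψ, hhh, RCLike.inner_apply, conj_trivial]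
      by_cases hxs : x ∈ tsupport φ
      · rw [if_pos (hk.trans_le (hd _ (hjJ x hxs)))]
        have : Real.sqrt (a (j x)) ≠ 0 := (Real.sqrt_pos.2 (ha0 _)).ne'
        field_simp
      · simp [image_eq_zero_of_notMem_tsupport hxs]

/-! ### Weak gradients by components -/

/-- The weak gradient, characterised through its components. -/
lemma isWeakGradient_iff {Ω : Set (Rn N)} {u : Rn N → ℝ} {g : Rn N → Rn N}
    (hu : LocallyIntegrableOn u Ω) (hg : LocallyIntegrableOn g Ω) :
    IsWeakGradient Ω u g ↔ ∀ i, ∀ φ : Rn N → ℝ, ContDiff ℝ ((⊤ : ℕ∞) : WithTop ℕ∞) φ →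
      HasCompactSupport φ → tsupport φ ⊆ Ω →
      ∫ x, g x i * φ x = -∫ x, u x * fderiv ℝ φ x (EuclideanSpace.single i 1) := by
  have key : ∀ φ : Rn N → ℝ, ContDiff ℝ ((⊤ : ℕ∞) : WithTop ℕ∞) φ →
      HasCompactSupport φ → tsupport φ ⊆ Ω →
      ((∫ x in Ω, u x • gradient φ x = -∫ x in Ω, φ x • g x) ↔
        ∀ i, ∫ x, g x i * φ x = -∫ x, u x * fderiv ℝ φ x (EuclideanSpace.single i 1)) := by
    intro φ hφ hc hs
    have hgc : Continuous (gradient φ) := by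
      have : gradient φ = fun x => (InnerProductSpace.toDual ℝ (Rn N)).symm (fderiv ℝ φ x) := rfl
      rw [this]
      exact (LinearIsometryEquiv.continuous _).comp (hφ.continuous_fderiv (by simp))
    have hgi : ∀ x i, gradient φ x i = fderiv ℝ φ x (EuclideanSpace.single i 1) := fun x i => by
      rw [← toDual_gradient, InnerProductSpace.toDual_apply_apply,
        EuclideanSpace.inner_single_right]
      simp
    have hf0 : ∀ x ∉ tsupport φ, fderiv ℝ φ x = 0 := fun x hx =>
      image_eq_zero_of_notMem_tsupport fun h => hx (tsupport_fderiv_subset ℝ h)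
    have hg0 : ∀ x ∉ tsupport φ, gradient φ x = 0 := fun x hx => by
      change (InnerProductSpace.toDual ℝ (Rn N)).symm (fderiv ℝ φ x) = 0
      rw [hf0 x hx, map_zero]
    have e1 : ∫ x in Ω, u x • gradient φ x = ∫ x in tsupport φ, u x • gradient φ x := by
      rw [setIntegral_eq_integral_of_forall_compl_eq_zero fun x hx => by
        rw [hg0 x fun h => hx (hs h), smul_zero],
        setIntegral_eq_integral_of_forall_compl_eq_zero fun x hx => by
        rw [hg0 x hx, smul_zero]]
    have e2 : ∫ x in Ω, φ x • g x = ∫ x in tsupport φ, φ x • g x := by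
      rw [setIntegral_eq_integral_of_forall_compl_eq_zero fun x hx => by
        rw [image_eq_zero_of_notMem_tsupport fun h => hx (hs h), zero_smul],
        setIntegral_eq_integral_of_forall_compl_eq_zero fun x hx => by
        rw [image_eq_zero_of_notMem_tsupport hx, zero_smul]]
    have e3 : ∀ i, ∫ x, g x i * φ x = ∫ x in tsupport φ, g x i * φ x := fun i => by
      rw [setIntegral_eq_integral_of_forall_compl_eq_zero fun x hx => by
        rw [image_eq_zero_of_notMem_tsupport hx, mul_zero]]
    have e4 : ∀ i, ∫ x, u x * fderiv ℝ φ x (EuclideanSpace.single i 1) =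
        ∫ x in tsupport φ, u x * fderiv ℝ φ x (EuclideanSpace.single i 1) := fun i => by
      rw [setIntegral_eq_integral_of_forall_compl_eq_zero fun x hx => by
        rw [hf0 x hx]; simp]
    have hK : IsCompact (tsupport φ) := hc
    -- Integrability on the compact support justifies taking components inside the vector-valued
    -- integrals.
    have i1 : IntegrableOn (fun x => u x • gradient φ x) (tsupport φ) :=
      (hu.integrableOn_compact_subset hs hK).smul_continuousOn hgc.continuousOn hK
    have i2 : IntegrableOn (fun x => φ x • g x) (tsupport φ) :=
      (hg.integrableOn_compact_subset hs hK).continuousOn_smul hφ.continuous.continuousOn hK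
    have c1 : ∀ i, (∫ x in tsupport φ, u x • gradient φ x) i =
        ∫ x in tsupport φ, u x * fderiv ℝ φ x (EuclideanSpace.single i 1) := fun i => by
      have := (EuclideanSpace.proj i : Rn N →L[ℝ] ℝ).integral_comp_comm i1
      refine Eq.trans this.symm (integral_congr_ae (Filter.Eventually.of_forall fun x => ?_))
      change u x * gradient φ x i = _
      rw [hgi]
    have c2 : ∀ i, (∫ x in tsupport φ, φ x • g x) i = ∫ x in tsupport φ, g x i * φ x := fun i => by
      have := (EuclideanSpace.proj i : Rn N →L[ℝ] ℝ).integral_comp_comm i2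
      refine Eq.trans this.symm (integral_congr_ae (Filter.Eventually.of_forall fun x => ?_))
      change φ x * g x i = _
      rw [mul_comm]
    rw [e1, e2]
    constructor
    · intro h i
      rw [e3, e4, ← c1, ← c2, h]
      simp
    · intro h
      ext i
      have := h i
      rw [e3, e4, ← c1, ← c2] at this
      rw [PiLp.neg_apply, this, neg_neg]
  constructor
  · intro h i φ hφ hc hs
    exact (key φ hφ hc hs).1 (h.integral_eq φ hφ hc hs) i
  · intro h
    exact ⟨hu, hg, fun φ hφ hc hs => (key φ hφ hc hs).2 fun i => h i φ hφ hc hs⟩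

/-! ### From weak solutions to normalised solutions -/

lemma kern_eq_inv (α : ℝ) (z : Rn N) : kern α z = (‖z‖ ^ ((N : ℝ) + α))⁻¹ :=
  Real.rpow_neg (norm_nonneg z) _

/-- Passes from extended-valued quotients to the real kernel. The condition at z = 0 is needed: for
a ≠ 0 the quotient is infinite there, while the real kernel takes the default value 0. -/
lemma enorm_rpow_div_eq {m α : ℝ} (hm : 0 < m) (hα : 0 < α) {a : ℝ} {z : Rn N}
    (h : z = 0 → a = 0) :
    ‖a‖ₑ ^ m / ‖z‖ₑ ^ ((N : ℝ) + α) = ENNReal.ofReal (|a| ^ m * kern α z) := by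
  have hk : 0 < (N : ℝ) + α := by positivity
  rcases eq_or_ne z 0 with rfl | hz
  · simp [h rfl, hm, hk, Real.zero_rpow hm.ne']
  · have hz' : 0 < ‖z‖ := norm_pos_iff.2 hz
    rw [kern_eq_inv, ← div_eq_mul_inv, ENNReal.ofReal_div_of_pos (by positivity),
      ← ENNReal.ofReal_rpow_of_nonneg (abs_nonneg _) hm.le,
      ← ENNReal.ofReal_rpow_of_nonneg (norm_nonneg _) hk.le, ofReal_norm, ← Real.norm_eq_abs,
      ofReal_norm]

open Filter in
lemma ae_prod_of_ae_eq {u v : Rn N → ℝ} (h : u =ᵐ[volume] v) :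
    ∀ᵐ z : Rn N × Rn N, u z.1 = v z.1 ∧ u z.2 = v z.2 :=
  (Measure.quasiMeasurePreserving_fst.ae h).and (Measure.quasiMeasurePreserving_snd.ae h)

lemma gagInt_congr_ae {α m : ℝ} {A : Set (Rn N)} {u v : Rn N → ℝ} (h : u =ᵐ[volume] v) :
    gagInt α m A u = gagInt α m A v := by
  refine lintegral_congr_ae (ae_restrict_of_ae ?_)
  filter_upwards [ae_prod_of_ae_eq h] with z hz
  rw [hz.1, hz.2]

lemma gagInt_const_mul {α m c : ℝ} {A : Set (Rn N)} (hc : 0 ≤ c) (u : Rn N → ℝ) :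
    gagInt α m A (fun x => c * u x) = ENNReal.ofReal (c ^ m) * gagInt α m A u := by
  unfold gagInt
  rw [← lintegral_const_mul' _ _ ENNReal.ofReal_ne_top]
  refine lintegral_congr fun z => ?_
  rw [← ENNReal.ofReal_mul (by positivity), ← mul_sub, abs_mul, abs_of_nonneg hc,
    Real.mul_rpow hc (abs_nonneg _), mul_assoc]

open Filter in
lemma gagliardo_rpow_eq {s m : ℝ} (hs : 0 < s) (hm : 0 < m) {A : Set (Rn N)} {u : Rn N → ℝ}
    (hu : AEMeasurable u) :
    gagliardo s m A u ^ m = gagInt (s * m) m A u := by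
  have hsm : 0 < s * m := by positivity
  unfold gagliardo gagInt
  rw [← ENNReal.rpow_mul, one_div_mul_cancel hm.ne', ENNReal.rpow_one, Measure.volume_eq_prod,
    ← Measure.prod_restrict, lintegral_prod]
  · refine lintegral_congr fun x => lintegral_congr fun y => ?_
    refine enorm_rpow_div_eq hm hsm fun h => ?_
    rw [sub_eq_zero.1 h, sub_self]
  · have h1 : AEMeasurable (fun z : Rn N × Rn N => u z.1) (volume.prod volume) :=
      hu.comp_quasiMeasurePreserving Measure.quasiMeasurePreserving_fst
    have h2 : AEMeasurable (fun z : Rn N × Rn N => u z.2) (volume.prod volume) :=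
      hu.comp_quasiMeasurePreserving Measure.quasiMeasurePreserving_snd
    have h3 : Measurable fun z : Rn N × Rn N => kern (s * m) (z.1 - z.2) :=
      (measurable_kern _).comp (measurable_fst.sub measurable_snd)
    have := ((((h1.sub h2).norm.pow_const m).mul h3.aemeasurable).ennreal_ofReal)
    rw [Measure.prod_restrict]
    exact this.restrict

lemma gagliardo_lt_top_iff {s m : ℝ} (hs : 0 < s) (hm : 0 < m) {A : Set (Rn N)} {u : Rn N → ℝ}
    (hu : AEMeasurable u) : gagliardo s m A u < ∞ ↔ gagInt (s * m) m A u < ∞ := by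
  rw [← gagliardo_rpow_eq hs hm hu, ENNReal.rpow_lt_top_iff_of_pos hm]

/-- Bounded measurable functions supported strictly inside a ball with finite Gagliardo seminorms
on that ball are admissible in the weak formulation. -/
lemma isTestFunction_of_bounded {s₁ sp p : ℝ} (hs₁ : 0 < s₁) (hsp : 0 < sp) (hp : 0 < p)
    {Ω : Set (Rn N)} {x₀ : Rn N} {R ρ B : ℝ} (hΩ : Metric.ball x₀ R ⊆ Ω) {φ : Rn N → ℝ}
    (hφ : Measurable φ) (hρ : ρ < R) (hB : ∀ x, |φ x| ≤ B)
    (hzero : ∀ x ∉ Metric.closedBall x₀ ρ, φ x = 0)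
    (h1 : gagInt s₁ 1 (Metric.ball x₀ R) φ < ∞)
    (h2 : gagInt (sp * p) p (Metric.ball x₀ R) φ < ∞) : IsTestFunction s₁ sp p Ω φ := by
  have hLp : ∀ q : ℝ≥0∞, MemLp φ q (volume.restrict univ) := by
    intro q
    have hfin : IsFiniteMeasure (volume.restrict (Metric.closedBall x₀ ρ)) := ⟨by
      rw [Measure.restrict_apply_univ]; exact measure_closedBall_lt_top⟩
    have : (Metric.closedBall x₀ ρ).indicator φ = φ := by
      rw [indicator_eq_self]
      intro x hx
      by_contra h
      exact hx (hzero x h)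
    rw [Measure.restrict_univ, ← this,
      memLp_indicator_iff_restrict Metric.isClosed_closedBall.measurableSet]
    exact MemLp.of_bound hφ.aestronglyMeasurable B (Filter.Eventually.of_forall hB)
  have hd : 0 < R - ρ := by linarith
  have hR : ρ + (R - ρ) = R := by ring
  refine ⟨⟨hLp _, ?_⟩, ⟨hLp _, ?_⟩, ?_, ?_⟩
  · rw [gagliardo_lt_top_iff hs₁ one_pos hφ.aemeasurable, mul_one]
    exact gagInt_univ_lt_top hs₁ one_pos hd hφ hB hzero (by rwa [hR])
  · rw [gagliardo_lt_top_iff hsp hp hφ.aemeasurable]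
    exact gagInt_univ_lt_top (by positivity) hp hd hφ hB hzero (by rwa [hR])
  · exact HasCompactSupport.intro (isCompact_closedBall x₀ ρ) hzero
  · refine Subset.trans ?_ ((Metric.closedBall_subset_ball hρ).trans hΩ)
    refine closure_minimal (fun x hx => ?_) Metric.isClosed_closedBall
    by_contra h
    exact hx (hzero x h)

/-- Off the ball, 1 + |x| is at most a constant times |x − x₀|, so the weight in the tail is
dominated by the one defining the tail space. -/
lemma tail_lt_top_of_memTailSpace {sp p : ℝ} (hp : 1 < p) (hsp : 0 < sp) {u : Rn N → ℝ}
    (hu : MemTailSpace sp p u) (x₀ : Rn N) {R : ℝ} (hR : 0 < R) : tail sp p u x₀ R < ∞ := by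
  have hk : 0 < (N : ℝ) + sp * p := by positivity
  set k := (N : ℝ) + sp * p with hkdef
  set c : ℝ≥0∞ := ENNReal.ofReal ((1 + ‖x₀‖) / R + 1) with hc
  have hck : c ^ k ≠ ∞ := (ENNReal.rpow_lt_top_of_nonneg hk.le ENNReal.ofReal_ne_top).ne
  unfold tail
  refine ENNReal.rpow_lt_top_of_nonneg (by rw [one_div_nonneg]; linarith) (ne_of_lt ?_)
  refine ENNReal.mul_lt_top ENNReal.ofReal_lt_top ?_
  have hpt : ∀ x ∈ (Metric.ball x₀ R)ᶜ, ‖u x‖ₑ ^ (p - 1) / ‖x - x₀‖ₑ ^ k ≤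
      c ^ k * (‖u x‖ₑ ^ (p - 1) / (1 + ‖x‖ₑ) ^ k) := by
    intro x hx
    have hx' : R ≤ ‖x - x₀‖ := by
      rw [mem_compl_iff, Metric.mem_ball, not_lt, dist_eq_norm] at hx; exact hx
    have h0 : 0 < ‖x - x₀‖ := hR.trans_le hx'
    have h1 : 1 + ‖x‖ₑ ≤ c * ‖x - x₀‖ₑ := by
      rw [← ofReal_norm, ← ofReal_norm, hc, ← ENNReal.ofReal_mul (by positivity),
        ← ENNReal.ofReal_one, ← ENNReal.ofReal_add zero_le_one (norm_nonneg _)]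
      refine ENNReal.ofReal_le_ofReal ?_
      have h2 : ‖x‖ ≤ ‖x₀‖ + ‖x - x₀‖ := by
        have := norm_add_le x₀ (x - x₀)
        rwa [add_sub_cancel] at this
      have h3 : 1 + ‖x₀‖ ≤ (1 + ‖x₀‖) / R * ‖x - x₀‖ := by
        rw [div_mul_eq_mul_div, le_div_iff₀ hR]
        have : 0 ≤ 1 + ‖x₀‖ := by positivity
        gcongr
      linarith
    have h2 : (1 + ‖x‖ₑ) ^ k ≤ c ^ k * ‖x - x₀‖ₑ ^ k := by
      rw [← ENNReal.mul_rpow_of_nonneg _ _ hk.le]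
      exact ENNReal.rpow_le_rpow h1 hk.le
    have hz0 : ‖x - x₀‖ₑ ^ k ≠ 0 := by
      rw [Ne, ENNReal.rpow_eq_zero_iff_of_pos hk, enorm_eq_zero, ← norm_eq_zero]; exact h0.ne'
    have hzt : ‖x - x₀‖ₑ ^ k ≠ ∞ := (ENNReal.rpow_lt_top_of_nonneg hk.le enorm_ne_top).ne
    have h10 : (1 + ‖x‖ₑ) ^ k ≠ 0 := by
      rw [Ne, ENNReal.rpow_eq_zero_iff_of_pos hk]; simp
    have h1t : (1 + ‖x‖ₑ) ^ k ≠ ∞ :=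
      (ENNReal.rpow_lt_top_of_nonneg hk.le (by finiteness)).ne
    rw [ENNReal.div_le_iff hz0 hzt, mul_right_comm, ← mul_div_assoc,
      ENNReal.le_div_iff_mul_le (Or.inl h10) (Or.inl h1t), mul_comm (_ * _)]
    exact mul_le_mul_right h2 _
  refine (setLIntegral_mono' Metric.isOpen_ball.measurableSet.compl hpt).trans_lt ?_
  refine (setLIntegral_le_lintegral _ _).trans_lt ?_
  rw [lintegral_const_mul' _ _ hck]
  exact ENNReal.mul_lt_top hck.lt_top hu.2

lemma aemeasurable_of_memTailSpace {sp p : ℝ} {u : Rn N → ℝ} (hu : MemTailSpace sp p u) :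
    AEMeasurable u := by
  have : ∀ n : ℕ, AEMeasurable u (volume.restrict (Metric.ball (0 : Rn N) n)) := fun n =>
    (hu.1 _ Metric.isOpen_ball
      ⟨Metric.isBounded_ball.isCompact_closure, subset_univ _⟩).aestronglyMeasurable.aemeasurable
  rw [← aemeasurable_iUnion_iff, Metric.iUnion_ball_nat, Measure.restrict_univ] at this
  exact this

open Filter in
/-- Normalisation of a locally bounded weak solution on a ball. -/
lemma exists_normSol {s₁ sp p : ℝ} (hs₁ : 0 < s₁) (hsp : 0 < sp) (hp : 1 < p)
    {Ω : Set (Rn N)} {u : Rn N → ℝ} (hu : IsWeakSolution s₁ sp p Ω u) (hb : MemLpLoc ∞ Ω u)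
    {x₀ : Rn N} {R : ℝ} (hR : R ∈ Ioo (0 : ℝ) 1) (hB : CompactlyInside (Metric.ball x₀ R) Ω) :
    ∃ M : ℝ, 0 < M ∧ ENNReal.ofReal M ≤
      eLpNorm u ∞ (volume.restrict (Metric.ball x₀ R)) + tail sp p u x₀ R + 1 ∧
      ∃ (v : Rn N → ℝ) (Z : Rn N × Rn N → ℝ) (lam : ℝ), NormSol s₁ sp p x₀ R lam v Z ∧
        u =ᵐ[volume] fun x => M * v x := by
  set b := eLpNorm u ∞ (volume.restrict (Metric.ball x₀ R)) with hbdef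
  set τ := tail sp p u x₀ R with hτ
  have hum : AEMeasurable u := aemeasurable_of_memTailSpace hu.memTail
  have hbt : b < ∞ := (hb _ Metric.isOpen_ball hB).2
  have hτt : τ < ∞ := tail_lt_top_of_memTailSpace hp hsp hu.memTail x₀ hR.1
  have hbτ : b + τ + 1 ≠ ∞ := by finiteness
  -- The summand 1 gives M ≥ 1, hence M^{−(p−1)} ≤ 1.
  set M := (b + τ + 1).toReal with hM
  have hMof : ENNReal.ofReal M = b + τ + 1 := ENNReal.ofReal_toReal hbτ
  have hM1 : 1 ≤ M := by
    rw [← ENNReal.ofReal_le_ofReal_iff ENNReal.toReal_nonneg, ← hM, hMof, ENNReal.ofReal_one]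
    exact le_add_self
  have hM0 : 0 < M := by linarith
  have hp1 : 0 < p - 1 := by linarith
  set B := Metric.ball x₀ R with hBdef
  have hBm : MeasurableSet B := Metric.isOpen_ball.measurableSet
  set w := hum.mk u with hw
  have hwm : Measurable w := hum.measurable_mk
  -- A null set on which the measurable representative exceeds the essential bound. Setting the
  -- function to zero there makes the bound hold at every point of the ball.
  set S : Set (Rn N) := B ∩ {x | M < |w x|} with hS
  have hSm : MeasurableSet S := hBm.inter (measurableSet_lt measurable_const hwm.abs)
  set v : Rn N → ℝ := fun x => M⁻¹ * Sᶜ.indicator w x with hv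
  have hvm : Measurable v := (hwm.indicator hSm.compl).const_mul _
  have huv : u =ᵐ[volume] fun x => M * v x := by
    have h1 : ∀ᵐ x, x ∈ B → |u x| ≤ M := by
      rw [← ae_restrict_iff' hBm]
      filter_upwards [ae_le_eLpNormEssSup (f := u) (μ := volume.restrict B)] with x hx
      rw [← ENNReal.ofReal_le_ofReal_iff hM0.le, hMof, ← Real.norm_eq_abs, ofReal_norm]
      refine hx.trans ?_
      rw [← eLpNorm_exponent_top, add_assoc]
      exact le_self_add
    filter_upwards [h1, hum.ae_eq_mk] with x hx hxw
    have hxS : x ∈ Sᶜ := by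
      intro h
      have := hx h.1
      rw [hxw] at this
      exact absurd h.2 (not_lt.2 this)
    simp only [hv]
    rw [indicator_of_mem hxS, mul_inv_cancel_left₀ hM0.ne', hxw]
  have hvu : v =ᵐ[volume] fun x => M⁻¹ * u x := by
    filter_upwards [huv] with x hx
    rw [hx, inv_mul_cancel_left₀ hM0.ne']
  have hMi : 0 ≤ M⁻¹ := by positivity
  obtain ⟨Z, hZm, hZs, hZe⟩ := hu.exists_sign
  refine ⟨M, hM0, hMof.le, v, Z, M ^ (-(p - 1)), ⟨hvm, hR.1, hR.2, ?_, ?_, ?_, ?_, ?_, ?_, ?_, ?_,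
    ?_⟩, huv⟩
  · intro x hx
    simp only [hv]
    rw [abs_mul, abs_of_nonneg hMi, inv_mul_le_iff₀ hM0, mul_one]
    by_cases hxS : x ∈ S
    · rw [indicator_of_notMem (not_not.2 hxS), abs_zero]; exact hM0.le
    · rw [indicator_of_mem hxS]
      by_contra h
      exact hxS ⟨hx, not_le.1 h⟩
  · have hα : 0 < sp * p := by positivity
    set I := ∫⁻ x in Bᶜ, ‖u x‖ₑ ^ (p - 1) / ‖x - x₀‖ₑ ^ ((N : ℝ) + sp * p) with hI
    have e1 : ∫⁻ x in Bᶜ, ENNReal.ofReal (|v x| ^ (p - 1) * kern (sp * p) (x - x₀)) =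
        ENNReal.ofReal ((M⁻¹) ^ (p - 1)) * I := by
      rw [hI, ← lintegral_const_mul' _ _ ENNReal.ofReal_ne_top]
      refine lintegral_congr_ae ?_
      filter_upwards [ae_restrict_of_ae hvu, ae_restrict_mem hBm.compl] with x hx hxB
      rw [hx, enorm_rpow_div_eq hp1 hα, ← ENNReal.ofReal_mul (by positivity), abs_mul,
        abs_of_nonneg hMi, Real.mul_rpow hMi (abs_nonneg _), mul_assoc]
      intro h
      exfalso
      rw [sub_eq_zero] at h
      exact hxB (h ▸ Metric.mem_ball_self hR.1)
    have e2 : ENNReal.ofReal (R ^ (sp * p)) * I = τ ^ (p - 1) := by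
      rw [hτ, tail, ← ENNReal.rpow_mul, one_div_mul_cancel hp1.ne', ENNReal.rpow_one]
    have e3 : τ ^ (p - 1) ≤ ENNReal.ofReal (M ^ (p - 1)) := by
      rw [← ENNReal.ofReal_rpow_of_nonneg hM0.le hp1.le, hMof]
      refine ENNReal.rpow_le_rpow ?_ hp1.le
      rw [add_comm b, add_assoc]
      exact le_self_add
    have hRp := hR.1
    calc _ = ENNReal.ofReal ((M⁻¹) ^ (p - 1)) * I := e1
      _ = ENNReal.ofReal ((M⁻¹) ^ (p - 1)) * (ENNReal.ofReal (R ^ (-(sp * p))) *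
          (ENNReal.ofReal (R ^ (sp * p)) * I)) := by
          rw [← mul_assoc (ENNReal.ofReal (R ^ (-(sp * p)))), ← ENNReal.ofReal_mul (by positivity),
            ← Real.rpow_add hRp, neg_add_cancel, Real.rpow_zero, ENNReal.ofReal_one, one_mul]
      _ ≤ ENNReal.ofReal ((M⁻¹) ^ (p - 1)) * (ENNReal.ofReal (R ^ (-(sp * p))) *
          ENNReal.ofReal (M ^ (p - 1))) :=
          mul_le_mul_right (mul_le_mul_right (e2.trans_le e3) _) _
      _ = ENNReal.ofReal (R ^ (-(sp * p))) := by
          rw [mul_left_comm, ← ENNReal.ofReal_mul (by positivity), ← Real.mul_rpow hMi hM0.le,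
            inv_mul_cancel₀ hM0.ne', Real.one_rpow, ENNReal.ofReal_one, mul_one]
  · rw [gagInt_congr_ae hvu, gagInt_const_mul hMi]
    have := (gagliardo_lt_top_iff hs₁ one_pos hum).1 (hu.memLoc_one _ Metric.isOpen_ball hB).2
    rw [mul_one] at this
    exact ENNReal.mul_lt_top ENNReal.ofReal_lt_top this
  · rw [gagInt_congr_ae hvu, gagInt_const_mul hMi]
    exact ENNReal.mul_lt_top ENNReal.ofReal_lt_top
      ((gagliardo_lt_top_iff hsp (by linarith) hum).1 (hu.memLoc_p _ Metric.isOpen_ball hB).2)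
  · positivity
  · exact Real.rpow_le_one_of_one_le_of_nonpos hM1 (by linarith)
  · exact hZm.1
  -- The set-valued sign is invariant under multiplication by M > 0, so the same selection Z serves
  -- for the rescaled function.
  · filter_upwards [hZs, ae_prod_of_ae_eq huv] with z hz hz'
    rw [hz'.1, hz'.2, ← mul_sub] at hz
    rcases hz with ⟨h0, h1⟩ | ⟨h0, h1⟩
    · exact Or.inl ⟨(mul_eq_zero.1 h0).resolve_left hM0.ne', h1⟩
    · refine Or.inr ⟨right_ne_zero_of_mul h0, ?_⟩
      rw [h1, abs_mul, abs_of_pos hM0, mul_div_mul_left _ _ hM0.ne']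
  · intro φ ρ B' hφ hρ hφB hzero h1 h2
    have hsub : B ⊆ Ω := subset_closure.trans hB.2
    have htest := isTestFunction_of_bounded hs₁ hsp (by linarith) hsub hφ hρ hφB hzero h1 h2
    have h0 := hZe φ htest
    have e1 : ∫ z : Rn N × Rn N, Z z * ((φ z.1 - φ z.2) / ‖z.1 - z.2‖ ^ ((N : ℝ) + s₁)) =
        ∫ z : Rn N × Rn N, Z z * ((φ z.1 - φ z.2) * kern s₁ (z.1 - z.2)) := by
      simp only [kern_eq_inv, div_eq_mul_inv]
    have e2 : ∫ z : Rn N × Rn N, |u z.1 - u z.2| ^ (p - 2) * (u z.1 - u z.2) * (φ z.1 - φ z.2) /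
        ‖z.1 - z.2‖ ^ ((N : ℝ) + sp * p) = M ^ (p - 1) *
        ∫ z : Rn N × Rn N, oddPow p (v z.1 - v z.2) * (φ z.1 - φ z.2) *
          kern (sp * p) (z.1 - z.2) := by
      rw [← integral_const_mul]
      refine integral_congr_ae ?_
      filter_upwards [ae_prod_of_ae_eq huv] with z hz
      rw [hz.1, hz.2, ← mul_sub, abs_mul, abs_of_pos hM0, Real.mul_rpow hM0.le (abs_nonneg _),
        kern_eq_inv, oddPow, div_eq_mul_inv, show p - 1 = p - 2 + 1 by ring,
        Real.rpow_add_one hM0.ne']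
      ring
    rw [e1, e2] at h0
    have hMM : M ^ (-(p - 1)) * M ^ (p - 1) = 1 := by
      rw [← Real.rpow_add hM0, neg_add_cancel, Real.rpow_zero]
    -- Only the flux term scales, by M^{p−1}. Dividing by it moves the factor onto the sign term as
    -- λ.
    have h3 := congrArg (fun t => M ^ (-(p - 1)) * t) h0
    simp only [mul_zero, mul_add, ← mul_assoc, hMM, one_mul] at h3
    rw [h3]
    simp only [mul_assoc]

/-! ### The local gradient estimate -/

open Filter in
lemma diff_ae_eq {u w : Rn N → ℝ} (h : u =ᵐ[volume] w) (k : Rn N) :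
    diff u k =ᵐ[volume] diff w k := by
  have h' : ∀ᵐ x, u (x + k) = w (x + k) :=
    (measurePreserving_add_right volume k).quasiMeasurePreserving.ae h
  filter_upwards [h, h'] with x hx hx'
  rw [diff, diff, hx, hx']

open Filter in
lemma lintegral_diffQuot_le {q M d r : ℝ} (hM : 0 ≤ M) {u v : Rn N → ℝ}
    (huv : u =ᵐ[volume] fun x => M * v x) {x₀ : Rn N} {F : ℝ≥0∞}
    (hv : ∀ h : Rn N, ‖h‖ < d →
      ∫⁻ x in Metric.ball x₀ r, ENNReal.ofReal (|diff v h x| ^ q) ≤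
        F * ENNReal.ofReal (‖h‖ ^ (1 * q)))
    {e : Rn N} (he : ‖e‖ = 1) {t : ℝ} (ht : 0 < t) (htd : t < d) :
    ∫⁻ x in Metric.ball x₀ r, ENNReal.ofReal (|t⁻¹ * diff u (t • e) x| ^ q) ≤
      ENNReal.ofReal (M ^ q) * F := by
  have hn : ‖t • e‖ = t := by rw [norm_smul, he, mul_one, Real.norm_of_nonneg ht.le]
  have hti : 0 ≤ t⁻¹ := by positivity
  have e1 : ∫⁻ x in Metric.ball x₀ r, ENNReal.ofReal (|t⁻¹ * diff u (t • e) x| ^ q) =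
      ENNReal.ofReal ((t⁻¹ * M) ^ q) *
        ∫⁻ x in Metric.ball x₀ r, ENNReal.ofReal (|diff v (t • e) x| ^ q) := by
    rw [← lintegral_const_mul' _ _ ENNReal.ofReal_ne_top]
    refine lintegral_congr_ae ?_
    filter_upwards [ae_restrict_of_ae (diff_ae_eq huv (t • e))] with x hx
    have hx' : diff u (t • e) x = M * diff v (t • e) x := by rw [hx, diff, diff]; ring
    rw [← ENNReal.ofReal_mul (by positivity), hx', ← mul_assoc, abs_mul,
      abs_of_nonneg (by positivity), Real.mul_rpow (by positivity) (abs_nonneg _)]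
  rw [e1]
  refine (mul_le_mul_right (hv _ (by rwa [hn])) _).trans (le_of_eq ?_)
  rw [hn, one_mul, mul_left_comm, ← ENNReal.ofReal_mul (by positivity), mul_comm,
    Real.mul_rpow hti hM, mul_right_comm, ← Real.mul_rpow hti ht.le, inv_mul_cancel₀ ht.ne',
    Real.one_rpow, one_mul]

open Filter Topology in
/-- Bounds for difference quotients pass to the components of a weak gradient. -/
lemma lintegral_weakGradient_comp_le {q d r r' : ℝ} (hq : 1 ≤ q) (hd : 0 < d) (hrr : r < r')
    {Ω : Set (Rn N)} (hΩ : IsOpen Ω) {u : Rn N → ℝ} (hum : AEMeasurable u) {g : Rn N → Rn N}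
    (hg : IsWeakGradient Ω u g) {x₀ : Rn N} (hB : Metric.closedBall x₀ r' ⊆ Ω) (i : Fin N)
    {T : ℝ≥0∞} (hT : ∀ t : ℝ, 0 < t → t < d → ∫⁻ x in Metric.ball x₀ r',
      ENNReal.ofReal (|t⁻¹ * diff u (t • EuclideanSpace.single i 1) x| ^ q) ≤ T) :
    ∫⁻ x in Metric.ball x₀ r, ENNReal.ofReal (|g x i| ^ q) ≤ T := by
  set e : Rn N := EuclideanSpace.single i 1 with he
  have hgB : IntegrableOn g (Metric.ball x₀ r') :=
    (hg.locInt_grad.integrableOn_compact_subset hB (isCompact_closedBall _ _)).mono_set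
      Metric.ball_subset_closedBall
  have hgi : IntegrableOn (fun x => g x i) (Metric.ball x₀ r') :=
    (EuclideanSpace.proj i : Rn N →L[ℝ] ℝ).integrable_comp hgB
  set t : ℕ → ℝ := fun k => d / ((k : ℝ) + 2) with ht
  have ht0 : ∀ k, 0 < t k := fun k => by simp only [ht]; positivity
  have htd : ∀ k, t k < d := fun k => by
    simp only [ht]
    rw [div_lt_iff₀ (by positivity)]
    have : (0 : ℝ) ≤ k := by positivity
    nlinarith
  have htlim : Tendsto t atTop (𝓝[>] 0) := by
    refine tendsto_nhdsWithin_iff.2 ⟨?_, Eventually.of_forall ht0⟩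
    exact tendsto_const_nhds.div_atTop
      (tendsto_atTop_add_const_right _ _ tendsto_natCast_atTop_atTop)
  refine lintegral_rpow_le_of_tendsto hq hrr hgi
    (f := fun k x => (t k)⁻¹ * diff u (t k • e) x) (fun k => ?_)
    (fun k => hT _ (ht0 k) (htd k)) fun φ hφ hc hs => ?_
  · refine AEMeasurable.const_mul ?_ _
    exact (hum.comp_quasiMeasurePreserving
      (measurePreserving_add_right volume (t k • e)).quasiMeasurePreserving).sub hum
  · have hs' : tsupport φ ⊆ Ω := hs.trans (Metric.ball_subset_closedBall.trans hB)
    rw [(isWeakGradient_iff hg.locInt hg.locInt_grad).1 hg i φ hφ hc hs']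
    exact (tendsto_integral_diffQuot hΩ hg.locInt hφ hc hs' e).comp htlim

lemma enorm_rpow_le_sum {q : ℝ} (hq : 1 ≤ q) (y : Rn N) :
    ‖y‖ₑ ^ q ≤ ENNReal.ofReal ((N : ℝ) ^ (q - 1)) * ∑ i, ENNReal.ofReal (|y i| ^ q) := by
  have h1 : ‖y‖ ≤ ∑ i, |y i| := by
    conv_lhs => rw [← (EuclideanSpace.basisFun (Fin N) ℝ).sum_repr y]
    refine (norm_sum_le _ _).trans (Finset.sum_le_sum fun i _ => ?_)
    simp [norm_smul]
  rw [← ofReal_norm, ENNReal.ofReal_rpow_of_nonneg (norm_nonneg _) (by linarith),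
    ← ENNReal.ofReal_sum_of_nonneg fun i _ => by positivity, ← ENNReal.ofReal_mul (by positivity)]
  refine ENNReal.ofReal_le_ofReal ((Real.rpow_le_rpow (norm_nonneg _) h1 (by linarith)).trans ?_)
  have := Real.rpow_sum_le_const_mul_sum_rpow (Finset.univ : Finset (Fin N)) (fun i => y i) hq
  simpa using this

lemma eLpNorm_rpow_eq {F : Type*} [NormedAddCommGroup F] {q : ℝ} (hq : 0 < q) (g : Rn N → F)
    (μ : Measure (Rn N)) : eLpNorm g (ENNReal.ofReal q) μ ^ q = ∫⁻ x, ‖g x‖ₑ ^ q ∂μ := by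
  rw [eLpNorm_eq_lintegral_rpow_enorm_toReal (by simpa using hq) ENNReal.ofReal_ne_top,
    ENNReal.toReal_ofReal hq.le, ← ENNReal.rpow_mul, one_div_mul_cancel hq.ne', ENNReal.rpow_one]

/-- The local gradient bound. -/
lemma exists_polyBound_gradient {p s₁ sp q : ℝ} (hs₁ : 0 < s₁) (hsp : 0 < sp) (hp : 1 < p)
    (hq : 1 ≤ q) (hbound : FirstDiffBound N p s₁ sp q 1) :
    ∃ F, PolyBound F ∧ ∀ (Ω : Set (Rn N)) (u : Rn N → ℝ), IsOpen Ω →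
      IsWeakSolution s₁ sp p Ω u → MemLpLoc ∞ Ω u → ∀ g : Rn N → Rn N, IsWeakGradient Ω u g →
      ∀ (x₀ : Rn N) (R r : ℝ), R ∈ Ioo (0 : ℝ) 1 → r ∈ Ioo 0 R →
        CompactlyInside (Metric.ball x₀ R) Ω →
        ∫⁻ x in Metric.ball x₀ r, ‖g x‖ₑ ^ q ≤ F (R - r) *
          (eLpNorm u ∞ (volume.restrict (Metric.ball x₀ R)) + tail sp p u x₀ R + 1) ^ q := by
  obtain ⟨f, hf, H⟩ := hbound
  refine ⟨fun d => ENNReal.ofReal ((N : ℝ) ^ (q - 1)) * N * f (1 / 2 * d),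
    (PolyBound.const (by finiteness)).mul (hf.comp_mul (by norm_num) (by norm_num)), ?_⟩
  intro Ω u hΩ hu hb g hg x₀ R r hR hr hB
  have hq0 : 0 < q := by linarith
  have hum : AEMeasurable u := aemeasurable_of_memTailSpace hu.memTail
  obtain ⟨M, hM0, hM, v, Z, lam, hv, huv⟩ := exists_normSol hs₁ hsp hp hu hb hR hB
  have hr0 := hr.1
  have hrR := hr.2
  -- The midpoint splits the margin: R − r' bounds the increments of the difference quotients, and
  -- r' − r leaves room for mollification.
  set r' := (r + R) / 2 with hr'
  have hRr : R - r' = 1 / 2 * (R - r) := by rw [hr']; ring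
  have hcl : Metric.closedBall x₀ r' ⊆ Ω :=
    (Metric.closedBall_subset_ball (by rw [hr']; linarith)).trans (subset_closure.trans hB.2)
  set T := ENNReal.ofReal (M ^ q) * f (R - r') with hT
  have hcomp : ∀ i, ∫⁻ x in Metric.ball x₀ r, ENNReal.ofReal (|g x i| ^ q) ≤ T := fun i =>
    lintegral_weakGradient_comp_le (d := R - r') hq (by rw [hr']; linarith)
      (by rw [hr']; linarith) hΩ hum hg hcl i fun t ht htd =>
      lintegral_diffQuot_le hM0.le huv
        (H x₀ R lam v Z hv r' (by rw [hr']; linarith) (by rw [hr']; linarith))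
        (by simp) ht htd
  have hgB : AEStronglyMeasurable g (volume.restrict (Metric.ball x₀ r)) :=
    (hg.locInt_grad.integrableOn_compact_subset hcl (isCompact_closedBall _ _)).1.mono_measure
      (Measure.restrict_mono ((Metric.ball_subset_ball (by rw [hr']; linarith)).trans
        Metric.ball_subset_closedBall) le_rfl)
  have hgm : ∀ i, AEMeasurable (fun x => ENNReal.ofReal (|g x i| ^ q))
      (volume.restrict (Metric.ball x₀ r)) := fun i => by
    have h1 : AEMeasurable (fun x => g x i) (volume.restrict (Metric.ball x₀ r)) :=
      ((EuclideanSpace.proj i : Rn N →L[ℝ] ℝ).continuous.comp_aestronglyMeasurable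
        hgB).aemeasurable
    exact (h1.norm.pow_const q).ennreal_ofReal
  calc ∫⁻ x in Metric.ball x₀ r, ‖g x‖ₑ ^ q
      ≤ ∫⁻ x in Metric.ball x₀ r, ENNReal.ofReal ((N : ℝ) ^ (q - 1)) *
          ∑ i, ENNReal.ofReal (|g x i| ^ q) := lintegral_mono fun x => enorm_rpow_le_sum hq _
    _ = ENNReal.ofReal ((N : ℝ) ^ (q - 1)) *
          ∑ i, ∫⁻ x in Metric.ball x₀ r, ENNReal.ofReal (|g x i| ^ q) := by
        rw [lintegral_const_mul' _ _ ENNReal.ofReal_ne_top,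
          lintegral_finsetSum' _ fun i _ => hgm i]
    _ ≤ ENNReal.ofReal ((N : ℝ) ^ (q - 1)) * ∑ _i : Fin N, T :=
        mul_le_mul_right (Finset.sum_le_sum fun i _ => hcomp i) _
    _ = ENNReal.ofReal ((N : ℝ) ^ (q - 1)) * N * f (1 / 2 * (R - r)) * ENNReal.ofReal M ^ q := by
        rw [Finset.sum_const, Finset.card_univ, Fintype.card_fin, nsmul_eq_mul, hT, hRr,
          ENNReal.ofReal_rpow_of_nonneg hM0.le hq0.le]
        ring
    _ ≤ _ := mul_le_mul_right (ENNReal.rpow_le_rpow hM hq0.le) _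

/-! ### Local integrability and existence of the weak gradient -/

lemma exists_compactlyInside_ball {Ω : Set (Rn N)} (hΩ : IsOpen Ω) {x : Rn N} (hx : x ∈ Ω) :
    ∃ R ∈ Ioo (0 : ℝ) 1, CompactlyInside (Metric.ball x R) Ω := by
  obtain ⟨ε, hε, hsub⟩ := Metric.nhds_basis_closedBall.mem_iff.1 (hΩ.mem_nhds hx)
  refine ⟨min ε (1 / 2), ⟨by positivity, (min_le_right _ _).trans_lt (by norm_num)⟩,
    Metric.isBounded_ball.isCompact_closure, ?_⟩
  exact Metric.closure_ball_subset_closedBall.trans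
    ((Metric.closedBall_subset_closedBall (min_le_left _ _)).trans hsub)

lemma memLpLoc_of_top {Ω : Set (Rn N)} {u : Rn N → ℝ} (hb : MemLpLoc ∞ Ω u) (q : ℝ≥0∞) :
    MemLpLoc q Ω u := fun U hU hUΩ => by
  have : IsFiniteMeasure (volume.restrict U) := ⟨by
    rw [Measure.restrict_apply_univ]
    exact (measure_mono subset_closure).trans_lt hUΩ.1.measure_lt_top⟩
  exact (hb U hU hUΩ).mono_exponent le_top

lemma locallyIntegrableOn_of_memLpLoc {Ω : Set (Rn N)} (hΩ : IsOpen Ω) {u : Rn N → ℝ}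
    (hb : MemLpLoc 1 Ω u) : LocallyIntegrableOn u Ω := fun x hx => by
  obtain ⟨R, hR, hB⟩ := exists_compactlyInside_ball hΩ hx
  exact ⟨Metric.ball x R, mem_nhdsWithin_of_mem_nhds (Metric.ball_mem_nhds x hR.1),
    memLp_one_iff_integrable.1 (hb _ Metric.isOpen_ball hB)⟩

lemma locallyIntegrableOn_toLp {Ω : Set (Rn N)} {G : Fin N → Rn N → ℝ}
    (hG : ∀ i, LocallyIntegrableOn (G i) Ω) :
    LocallyIntegrableOn (fun x => (WithLp.toLp 2 fun i => G i x : Rn N)) Ω := by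
  have h : ∀ s : Finset (Fin N), LocallyIntegrableOn
      (fun x => ∑ i ∈ s, G i x • (EuclideanSpace.single i 1 : Rn N)) Ω := by
    intro s
    induction s using Finset.induction_on with
    | empty => simpa using locallyIntegrableOn_const (0 : Rn N)
    | insert i s his ih =>
      simp only [Finset.sum_insert his]
      exact (((ContinuousLinearMap.id ℝ ℝ).smulRight
        (EuclideanSpace.single i 1 : Rn N)).locallyIntegrableOn_comp (hG i)).add ih
  convert h Finset.univ using 2 with x
  ext j
  simp [Finset.sum_apply, Pi.single_apply]

/-- Existence of the weak gradient of a locally bounded weak solution. -/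
lemma exists_isWeakGradient {p s₁ sp : ℝ} (hs₁ : 0 < s₁) (hsp : 0 < sp) (hp : 1 < p)
    (hbound : FirstDiffBound N p s₁ sp 2 1) {Ω : Set (Rn N)} (hΩ : IsOpen Ω) {u : Rn N → ℝ}
    (hu : IsWeakSolution s₁ sp p Ω u) (hb : MemLpLoc ∞ Ω u) :
    ∃ g, IsWeakGradient Ω u g := by
  obtain ⟨f, hf, H⟩ := hbound
  have hum : AEMeasurable u := aemeasurable_of_memTailSpace hu.memTail
  have hui : LocallyIntegrableOn u Ω :=
    locallyIntegrableOn_of_memLpLoc hΩ (memLpLoc_of_top hb 1)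
  have hex : ∀ i : Fin N, ∃ G : Rn N → ℝ, LocallyIntegrableOn G Ω ∧
      ∀ φ : Rn N → ℝ, ContDiff ℝ ((⊤ : ℕ∞) : WithTop ℕ∞) φ → HasCompactSupport φ →
        tsupport φ ⊆ Ω →
        ∫ x, G x * φ x = -∫ x, u x * fderiv ℝ φ x (EuclideanSpace.single i 1) := by
    intro i
    -- The normalising constant depends on the ball, so only bounds local to each point are
    -- available here.
    refine exists_weakDeriv hΩ hum hui _ fun x hx => ?_
    obtain ⟨R, hR, hB⟩ := exists_compactlyInside_ball hΩ hx
    obtain ⟨M, hM0, -, v, Z, lam, hv, huv⟩ := exists_normSol hs₁ hsp hp hu hb hR hB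
    have hR0 := hR.1
    have hR1 := hR.2
    have hfin : ENNReal.ofReal (M ^ (2 : ℝ)) * f (R - R / 2) ≠ ∞ :=
      ENNReal.mul_ne_top ENNReal.ofReal_ne_top
        (hf.ne_top ⟨by linarith, by linarith⟩)
    refine ⟨R / 2, by positivity, R - R / 2, by linarith, (ENNReal.ofReal (M ^ (2 : ℝ)) *
      f (R - R / 2)).toNNReal, fun t ht htd => ?_⟩
    rw [ENNReal.coe_toNNReal hfin]
    refine le_trans (le_of_eq ?_) (lintegral_diffQuot_le hM0.le huv
      (H x R lam v Z hv (R / 2) (by positivity) (by linarith))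
      (e := EuclideanSpace.single i 1) (by simp) ht htd)
    refine lintegral_congr fun y => ?_
    rw [← ofReal_norm, ENNReal.ofReal_rpow_of_nonneg (norm_nonneg _) (by norm_num),
      Real.norm_eq_abs]
  choose G hGi hG using hex
  refine ⟨fun x => WithLp.toLp 2 fun i => G i x, ?_⟩
  exact (isWeakGradient_iff hui (locallyIntegrableOn_toLp hGi)).2 hG

lemma memLpLoc_of_forall_ball {q : ℝ} (hq : 0 < q) {Ω : Set (Rn N)} {g : Rn N → Rn N}
    (hg : LocallyIntegrableOn g Ω)
    (h : ∀ x ∈ Ω, ∃ r > 0, ∫⁻ y in Metric.ball x r, ‖g y‖ₑ ^ q < ∞) :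
    MemLpLoc (ENNReal.ofReal q) Ω g := by
  intro U _ hUΩ
  have hK : ∫⁻ y in closure U, ‖g y‖ₑ ^ q < ∞ := by
    refine hUΩ.1.induction_on (p := fun s => ∫⁻ y in s, ‖g y‖ₑ ^ q < ∞) (by simp)
      (fun s t hst ht => (lintegral_mono_set hst).trans_lt ht)
      (fun s t hs ht => (lintegral_union_le _ s t).trans_lt (ENNReal.add_lt_top.2 ⟨hs, ht⟩))
      fun x hx => ?_
    obtain ⟨r, hr, hlt⟩ := h x (hUΩ.2 hx)
    exact ⟨_, mem_nhdsWithin_of_mem_nhds (Metric.ball_mem_nhds x hr), hlt⟩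
  refine ⟨((hg.integrableOn_compact_subset hUΩ.2 hUΩ.1).mono_set subset_closure).1, ?_⟩
  have := (lintegral_mono_set subset_closure).trans_lt hK
  rwa [← eLpNorm_rpow_eq hq, ENNReal.rpow_lt_top_iff_of_pos hq] at this

end FracReg
end

/-! ### The main theorem -/

theorem theorem1p2 (N : ℕ) (hN : 2 ≤ N) (p s₁ sp q : ℝ)
    (hp : p ∈ Set.Ioo (1 : ℝ) 2) (hs₁ : s₁ ∈ Set.Ioo (0 : ℝ) 1)
    (hsp : sp ∈ Set.Ioo ((p - 1) / p) 1) (hq : p ≤ q) :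
    ∃ C κ : ℝ, 0 < C ∧ 0 < κ ∧
      ∀ (Ω : Set (Rn N)) (u : Rn N → ℝ),
        IsOpen Ω → IsConnected Ω → Bornology.IsBounded Ω →
        IsWeakSolution s₁ sp p Ω u → MemLpLoc ∞ Ω u →
        MemSobolevOneLoc q Ω u ∧
        ∀ g : Rn N → Rn N, IsWeakGradient Ω u g →
          ∀ (x₀ : Rn N) (R r : ℝ), R ∈ Set.Ioo (0 : ℝ) 1 → r ∈ Set.Ioo 0 R →
            CompactlyInside (Metric.ball x₀ R) Ω →
            (eLpNorm g (ENNReal.ofReal q) (volume.restrict (Metric.ball x₀ r))) ^ q ≤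
              ENNReal.ofReal (C / (R - r) ^ κ) *
                ((eLpNorm u ∞ (volume.restrict (Metric.ball x₀ R)) + tail sp p u x₀ R) +
                  gagliardo sp p (Metric.ball x₀ R) u + 1) ^ q := by
  have hp1 : 1 < p := hp.1
  have hq1 : 1 ≤ q := by linarith
  have hq0 : 0 < q := by linarith
  have hsp0 : 0 < sp := (div_pos (by linarith) (by linarith)).trans hsp.1
  obtain ⟨F, ⟨C, κ, hC, hκ, hF⟩, H⟩ := FracReg.exists_polyBound_gradient hs₁.1 hsp0 hp1 hq1
    (FracReg.firstDiffBound_one hN hp1 hp.2 hs₁ hsp hq1)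
  -- The polynomial bound gives only nonnegative constants. Adding 1 makes them positive and weakens
  -- the bound, since R − r < 1.
  refine ⟨C + 1, κ + 1, by linarith, by linarith, fun Ω u hΩ _ _ hu hb => ⟨?_, ?_⟩⟩
  -- Existence of the gradient uses the exponent 2 whatever q is. The exponent q enters through the
  -- estimate, which holds for every weak gradient.
  · obtain ⟨g, hg⟩ := FracReg.exists_isWeakGradient hs₁.1 hsp0 hp1
      (FracReg.firstDiffBound_one hN hp1 hp.2 hs₁ hsp one_le_two) hΩ hu hb
    refine ⟨FracReg.memLpLoc_of_top hb _, g, hg,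
      FracReg.memLpLoc_of_forall_ball hq0 hg.locInt_grad fun x hx => ?_⟩
    obtain ⟨R, hR, hB⟩ := FracReg.exists_compactlyInside_ball hΩ hx
    have hR0 := hR.1
    have hR1 := hR.2
    have hbt : eLpNorm u ∞ (volume.restrict (Metric.ball x R)) < ∞ :=
      (hb _ Metric.isOpen_ball hB).2
    have hτt : tail sp p u x R < ∞ :=
      FracReg.tail_lt_top_of_memTailSpace hp1 hsp0 hu.memTail x hR0
    refine ⟨R / 2, by positivity, (H Ω u hΩ hu hb g hg x R (R / 2) hR
      ⟨by positivity, by linarith⟩ hB).trans_lt (ENNReal.mul_lt_top ?_ ?_)⟩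
    · exact (hF _ ⟨by linarith, by linarith⟩).trans_lt ENNReal.ofReal_lt_top
    · exact ENNReal.rpow_lt_top_of_nonneg hq0.le (by finiteness)
  · intro g hg x₀ R r hR hr hB
    rw [FracReg.eLpNorm_rpow_eq hq0]
    have hd : R - r ∈ Ioo (0 : ℝ) 1 := ⟨by linarith [hr.2], by linarith [hr.1, hR.2]⟩
    have hd0 := hd.1
    refine (H Ω u hΩ hu hb g hg x₀ R r hR hr hB).trans (mul_le_mul' ((hF _ hd).trans ?_) ?_)
    · refine ENNReal.ofReal_le_ofReal ?_
      rw [div_eq_mul_inv, ← Real.rpow_neg hd0.le]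
      have h1 := FracReg.rpow_neg_mono hd (show κ ≤ κ + 1 by linarith)
      have h2 : 0 ≤ (R - r) ^ (-κ) := by positivity
      nlinarith
    · refine ENNReal.rpow_le_rpow (add_le_add_left ?_ 1) hq0.le
      -- The proved bound contains no seminorm of u. It is added here only to reach the stated form.
      exact le_self_add
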